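/- Let $a>0$, $b,c\in\mathbb{R}$ with $c\neq 0$, $\theta_1,\theta_2\in[0,2\pi)$, and $\mathcal{H}=L^2(0,1)$ (real-valued functions, norm $\|\cdot\|$). On $H^2(0,1)$ let $\mathcal{A}f=af''+bf$ and $$\mathcal{B}f=\big(\cos(\theta_1)f(0)-\sin(\theta_1)f'(0),\ \cos(\theta_2)f(1)+\sin(\theta_2)f'(1)\big)\in\mathbb{R}^2 .$$ The restriction $\mathcal{A}_0$ of $\mathcal{A}$ to $H^2(0,1)\cap\ker\mathcal{B}$ generates a $C_0$-semigroup $S(t)$ on $\mathcal{H}$, and the eigenvalues of $\mathcal{A}_0+cI$ form a strictly decreasing sequence $(\lambda_n)_{n\ge1}$; let $e_n$ be a unit eigenvector associated with $\lambda_n$. Let $k\ge 2$ be an integer with $\cos\theta_m+k\sin\theta_m\neq0$ for $m=1,2$, and for $v=(v_1,v_2)\in\mathbb{R}^2$ let $$[L_kv](x)=\frac{v_1(1-x)^k}{\cos\theta_1+k\sin\theta_1}+\frac{v_2x^k}{\cos\theta_2+k\sin\theta_2},\qquad x\in[0,1].$$ Given $N_0\ge1$ and $K\in\mathbb{R}^{2\times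 N_0}$, a mild solution of the closed-loop delayed reaction–diffusion system $$\dot X(t)=\mathcal{A}X(t)+cX(t-h(t))+p(t),\qquad \mathcal{B}X(t)=u(t),\qquad X(\tau)=\Phi(\tau)\ \ (\tau\in[-h_M,0]),$$ with $u=KY$, $Y(t)=(\langle X(t),e_1\rangle,\dots,\langle X(t),e_{N_0}\rangle)^\top$, is a function $X$ on $[-h_M,\infty)$ with $X\in C^0(\mathbb{R}_+;\mathcal{H})$, $X=\Phi$ on $[-h_M,0]$, with $u=KY$ absolutely continuous on every compact interval of $\mathbb{R}_+$, such that for all $t\ge0$ $$X(t)=S(t)\{\Phi(0)-L_ku(0)\}+L_ku(t)+\int_0^tS(t-s)\{\mathcal{A}L_ku(s)-L_k\dot u(s)+cX(s-h(s))+p(s)\}\,ds .$$ Let $0<h_m<h_M$ and $\kappa>0$ be arbitrary. Then there exist $N_0\ge1$, $K\in\mathbb{R}^{2\times N_0}$ and constants $C_0,C_1>0$ such that for every $\Phi\in C^0([-h_M,0];\mathcal{H})$, every $p\in L^\infty_{\mathrm{loc}}(\mathbb{R}_+;\mathcal{H})$ and every $h\in C^0(\mathbb{R}_+;\mathbb{R})$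 with $h_m\le h\le h_M$, the closed-loop system has a unique mild solution $X$, and for all $t\ge0$ $$\|X(t)\|\le C_0e^{-\kappa t}\sup_{\tau\in[-h_M,0]}\|\Phi(\tau)\|+C_1\operatorname*{ess\,sup}_{\tau\in[0,t]}e^{-\kappa(t-\tau)}\|p(\tau)\|,$$ $$\|u(t)\|\le C_0\|K\|e^{-\kappa t}\sup_{\tau\in[-h_M,0]}\|\Phi(\tau)\|+C_1\|K\|\operatorname*{ess\,sup}_{\tau\in[0,t]}e^{-\kappa(t-\tau)}\|p(\tau)\|,$$ where $\mathbb{R}^2$ carries the Euclidean norm and $\|K\|$ is the norm induced by the Euclidean norms. -/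

import Mathlib

open MeasureTheory Set Filter Topology

namespace DelayRD

/-- The state space `L²(0,1)` of real-valued functions. -/
abbrev H : Type := Lp ℝ 2 (volume.restrict (Ioo (0 : ℝ) 1))

/-- The control space `ℝ²` with its Euclidean norm. -/
abbrev U : Type := EuclideanSpace ℝ (Fin 2)

/-- `f ∈ L²(0,1)` belongs to `H²(0,1)`, with continuous representative `φ`, absolutely continuous
derivative `φ'` (both on `[0,1]`), and second derivative `f'' = w ∈ L²(0,1)`. -/
def IsH2Rep (f : H) (φ φ' : ℝ → ℝ) (w : H) : Prop :=
  (f =ᵐ[volume.restrict (Ioo (0 : ℝ) 1)] φ) ∧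
  (∀ x ∈ Icc (0 : ℝ) 1, φ x = φ 0 + ∫ ξ in (0 : ℝ)..x, φ' ξ) ∧
  (∀ x ∈ Icc (0 : ℝ) 1, φ' x = φ' 0 + ∫ ξ in (0 : ℝ)..x, w ξ)

/-- The Sobolev space `H²(0,1)`. -/
def MemH2 (f : H) : Prop := ∃ φ φ' w, IsH2Rep f φ φ' w

/-- The data `(f, f', f'')` of a function of `H²(0,1)`: on `[0,1]` the first two components, and as
an element of `L²(0,1)` the third, are determined by `f`. Arbitrary value outside `H²(0,1)`. -/
noncomputable def h2Data (f : H) : (ℝ → ℝ) × (ℝ → ℝ) × H :=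
  Classical.epsilon fun q => IsH2Rep f q.1 q.2.1 q.2.2

theorem h2Data_spec {f : H} (hf : MemH2 f) :
    IsH2Rep f (h2Data f).1 (h2Data f).2.1 (h2Data f).2.2 := by
  obtain ⟨φ, φ', w, h⟩ := hf
  exact Classical.epsilon_spec (p := fun q : (ℝ → ℝ) × (ℝ → ℝ) × H => IsH2Rep f q.1 q.2.1 q.2.2)
    ⟨(φ, φ', w), h⟩

/-- The operator `𝒜 f = a f'' + b f` on `D(𝒜) = H²(0,1)`. -/
noncomputable def opA (a b : ℝ) (f : H) : H := a • (h2Data f).2.2 + b • f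

/-- The Robin boundary operator `ℬ f` on `D(ℬ) = H²(0,1)`. -/
noncomputable def opB (θ₁ θ₂ : ℝ) (f : H) : U :=
  !₂[Real.cos θ₁ * (h2Data f).1 0 - Real.sin θ₁ * (h2Data f).2.1 0,
     Real.cos θ₂ * (h2Data f).1 1 + Real.sin θ₂ * (h2Data f).2.1 1]

/-- The domain `D(𝒜₀) = D(𝒜) ∩ ker ℬ` of the disturbance-free operator `𝒜₀`. -/
def domA₀ (θ₁ θ₂ : ℝ) : Set H := {f | MemH2 f ∧ opB θ₁ θ₂ f = 0}

/-- `S` (on `t ≥ 0`) is a `C₀`-semigroup of bounded operators on `L²(0,1)`. -/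
structure IsC0Semigroup (S : ℝ → H →L[ℝ] H) : Prop where
  zero : S 0 = ContinuousLinearMap.id ℝ H
  add : ∀ s t : ℝ, 0 ≤ s → 0 ≤ t → S (s + t) = (S s).comp (S t)
  strongly_continuous : ∀ x : H, Tendsto (fun t => S t x) (𝓝[>] 0) (𝓝 x)

/-- `𝒜₀` is the infinitesimal generator of the `C₀`-semigroup `S`, domains included. -/
def IsGeneratedByA₀ (a b θ₁ θ₂ : ℝ) (S : ℝ → H →L[ℝ] H) : Prop :=
  IsC0Semigroup S ∧
  ∀ f g : H, Tendsto (fun t : ℝ => t⁻¹ • (S t f - f)) (𝓝[>] 0) (𝓝 g) ↔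
    (f ∈ domA₀ θ₁ θ₂ ∧ g = opA a b f)

/-- `lam` is the strictly decreasing enumeration of all the eigenvalues of `𝒜₀ + c I`, and `e n` is a
unit eigenvector for `lam n`. Indexing starts at `0`: `lam n` and `e n` are `λ_{n+1}` and `e_{n+1}`. -/
structure IsEigensystem (a b c θ₁ θ₂ : ℝ) (lam : ℕ → ℝ) (e : ℕ → H) : Prop where
  strictAnti : StrictAnti lam
  mem_dom : ∀ n, e n ∈ domA₀ θ₁ θ₂
  norm_eq_one : ∀ n, ‖e n‖ = 1
  eigen : ∀ n, opA a b (e n) + c • e n = lam n • e n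
  exhaustive : ∀ (μ : ℝ) (f : H), f ∈ domA₀ θ₁ θ₂ → f ≠ 0 →
    opA a b f + c • f = μ • f → ∃ n, μ = lam n

/-- The function `L_k u` on `[0,1]`. -/
noncomputable def liftFun (θ₁ θ₂ : ℝ) (k : ℕ) (u : U) (x : ℝ) : ℝ :=
  u 0 * (1 - x) ^ k / (Real.cos θ₁ + k * Real.sin θ₁) +
    u 1 * x ^ k / (Real.cos θ₂ + k * Real.sin θ₂)

theorem memLp_liftFun (θ₁ θ₂ : ℝ) (k : ℕ) (u : U) :
    MemLp (liftFun θ₁ θ₂ k u) 2 (volume.restrict (Ioo (0 : ℝ) 1)) := by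
  have hc : Continuous (liftFun θ₁ θ₂ k u) := by unfold liftFun; fun_prop
  refine MemLp.of_bound (C := |u 0| / |Real.cos θ₁ + k * Real.sin θ₁| +
    |u 1| / |Real.cos θ₂ + k * Real.sin θ₂|) hc.aestronglyMeasurable ?_
  filter_upwards [ae_restrict_mem measurableSet_Ioo] with x hx
  have h1 : |(1 - x) ^ k| ≤ 1 := by
    rw [abs_pow]
    exact pow_le_one₀ (abs_nonneg _) (abs_le.2 ⟨by linarith [hx.2], by linarith [hx.1]⟩)
  have h2 : |x ^ k| ≤ 1 := by
    rw [abs_pow]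
    exact pow_le_one₀ (abs_nonneg _) (abs_le.2 ⟨by linarith [hx.1], hx.2.le⟩)
  refine (abs_add_le _ _).trans (add_le_add ?_ ?_)
  · rw [abs_div, abs_mul]
    gcongr
    exact mul_le_of_le_one_right (abs_nonneg _) h1
  · rw [abs_div, abs_mul]
    gcongr
    exact mul_le_of_le_one_right (abs_nonneg _) h2

/-- The lifting operator `L_k : ℝ² → L²(0,1)`. -/
noncomputable def lift (θ₁ θ₂ : ℝ) (k : ℕ) (u : U) : H := (memLp_liftFun θ₁ θ₂ k u).toLp _

/-- The vector `Y = (⟨x, e_1⟩, …, ⟨x, e_{N₀}⟩) ∈ ℝ^{N₀}` of the first `N₀` modes of `x`. -/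
noncomputable def modes (e : ℕ → H) (N₀ : ℕ) (x : H) : EuclideanSpace ℝ (Fin N₀) :=
  WithLp.toLp 2 fun i => inner ℝ x (e i)

/-- The feedback `t ↦ K Y(t)`. -/
noncomputable def feedback (e : ℕ → H) {N₀ : ℕ} (K : Matrix (Fin 2) (Fin N₀) ℝ) (X : ℝ → H)
    (t : ℝ) : U :=
  Matrix.toEuclideanLin K (modes e N₀ (X t))

/-- The matrix norm induced by the Euclidean norms. -/
noncomputable def matNorm {N₀ : ℕ} (K : Matrix (Fin 2) (Fin N₀) ℝ) : ℝ :=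
  ‖LinearMap.toContinuousLinearMap (Matrix.toEuclideanLin K)‖

/-- `p ∈ L^∞_loc(ℝ₊; L²(0,1))`. -/
def MemLinftyLoc (p : ℝ → H) : Prop :=
  ∀ T : ℝ, 0 ≤ T → MemLp p ⊤ (volume.restrict (Icc 0 T))

/-- `X ∈ C⁰(ℝ₊; L²(0,1))` is a mild solution of
`X'(t) = 𝒜 X(t) + c X(t - h(t)) + p(t)`, `ℬ X(t) = u(t)`, `X = Φ` on `[-h_M, 0]`,
for an input `u ∈ AC_loc(ℝ₊; ℝ²)`; `S` is the semigroup generated by `𝒜₀`. -/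
structure IsMildSolution (a b c θ₁ θ₂ : ℝ) (k : ℕ) (S : ℝ → H →L[ℝ] H) (hM : ℝ) (Φ p : ℝ → H)
    (h : ℝ → ℝ) (u : ℝ → U) (X : ℝ → H) : Prop where
  continuousOn : ContinuousOn X (Ici 0)
  ac_input : ∀ T : ℝ, 0 ≤ T → AbsolutelyContinuousOnInterval u 0 T
  initial : ∀ τ ∈ Icc (-hM) 0, X τ = Φ τ
  duhamel : ∀ t : ℝ, 0 ≤ t →
    X t = S t (Φ 0 - lift θ₁ θ₂ k (u 0)) + lift θ₁ θ₂ k (u t) +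
      ∫ s in (0 : ℝ)..t, S (t - s) (opA a b (lift θ₁ θ₂ k (u s)) - lift θ₁ θ₂ k (deriv u s)
        + c • X (s - h s) + p s)

/-- The right-hand side
`C₀ e^{-κt} sup_{τ ∈ [-h_M,0]} ‖Φ(τ)‖ + C₁ ess sup_{τ ∈ [0,t]} e^{-κ(t-τ)} ‖p(τ)‖`
of the fading-memory estimate. -/
noncomputable def fadingBound (hM κ C₀ C₁ : ℝ) (Φ p : ℝ → H) (t : ℝ) : ℝ :=
  C₀ * Real.exp (-κ * t) * (⨆ τ : Icc (-hM) 0, ‖Φ τ‖) +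
    C₁ * essSup (fun τ => Real.exp (-κ * (t - τ)) * ‖p τ‖) (volume.restrict (Icc 0 t))

end DelayRD

open DelayRD

namespace DelayRD

/-! ### Primitives of integrable functions on `[0, T]` -/

/-! The delayed term is a scalar multiple of the identity applied to the delayed state, so it
commutes with every bounded change of coordinates. It therefore suffices to find a feedback and a
bounded invertible map `R` such that `X = R ξ` makes the undelayed closed loop diagonal with all
rates at most `-σ`. The delay then acts on a diagonal system as a perturbation of size `|c|`, and
large `σ` absorbs it, whatever the size or variation of the delay.

The Laplacian with the given boundary conditions is symmetric with compact resolvent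
(`IsH2Rep.green`, `exists_resolvent`), so the `e n` form a Hilbert basis, the eigenvalues tend to
`-∞`, and the semigroup is diagonal (`IsGeneratedByA₀.eq_diagonal`). In this basis a mild solution
is a sequence of scalar equations `x_n' = r_n x_n + β_n u + F_n` with `r_n = lam n - c`
(`mild_iff_modes`). By Green's formula `β_n` is `a` times the boundary amplitude of `e n` at `0`,
and this is nonzero by uniqueness for the Cauchy problem (`IsEigensystem.inputCoeff_ne_zero`). The
first input channel thus controls every mode, and the second is set to zero.

If `r_m ≤ -σ`, the first `m + 1` rates are moved to distinct points `μ_j` between `r_{m+1}` and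
`r_m`. The closed loop has eigenvectors `v_j = (β_n / (μ_j - r_n))_n` and, for `n > m`, the
unchanged `e n`. The first `m + 1` coordinates of the `v_j` form a row-scaled Cauchy matrix, which
is invertible; this yields both the gain and the coordinates (`exists_pole_placement`,
`exists_transform`, `exists_closedLoop`).

In the new coordinates the positive lower bound of the delay gives existence and uniqueness by the
method of steps, and the maximum of `e^{κs} ‖ξ(s)‖` is estimated by Duhamel's formula
(`IsDelaySolution.exp_mul_norm_le`). -/

theorem absolutelyContinuousOnInterval_congr {X : Type*} [PseudoMetricSpace X] {f g : ℝ → X}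
    {a b : ℝ} (hf : AbsolutelyContinuousOnInterval f a b) (hfg : EqOn f g (uIcc a b)) :
    AbsolutelyContinuousOnInterval g a b := by
  rw [absolutelyContinuousOnInterval_iff] at hf ⊢
  intro ε hε
  obtain ⟨δ, hδ, H⟩ := hf ε hε
  refine ⟨δ, hδ, fun E hE hlen => ?_⟩
  convert H E hE hlen using 2 with i hi
  have := hE.1 i hi
  rw [hfg this.1, hfg this.2]

/-- On `[0, T]`, the function `F` is a primitive of the integrable function `q`. -/
def IsPrim (F q : ℝ → ℝ) (T : ℝ) : Prop :=
  IntervalIntegrable q volume 0 T ∧ ∀ x ∈ Icc (0 : ℝ) T, F x = F 0 + ∫ ξ in (0 : ℝ)..x, q ξ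

namespace IsPrim

variable {F G q r : ℝ → ℝ} {T : ℝ}

theorem mono (hF : IsPrim F q T) {T' : ℝ} (h0 : 0 ≤ T') (hT : T' ≤ T) : IsPrim F q T' := by
  refine ⟨hF.1.mono_set ?_, fun x hx => hF.2 x ⟨hx.1, hx.2.trans hT⟩⟩
  rw [uIcc_of_le h0, uIcc_of_le (h0.trans hT)]
  exact Icc_subset_Icc_right hT

theorem ac (hF : IsPrim F q T) (hT : 0 ≤ T) : AbsolutelyContinuousOnInterval F 0 T := by
  have h1 := hF.1.absolutelyContinuousOnInterval_intervalIntegral (c := 0) left_mem_uIcc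
  have h2 : AbsolutelyContinuousOnInterval (fun _ : ℝ => F 0) 0 T :=
    (LipschitzWith.const (F 0)).lipschitzOnWith.absolutelyContinuousOnInterval
  refine absolutelyContinuousOnInterval_congr (h2.add h1) fun x hx => ?_
  rw [uIcc_of_le hT] at hx
  exact (hF.2 x hx).symm

theorem continuousOn (hF : IsPrim F q T) (hT : 0 ≤ T) : ContinuousOn F (Icc 0 T) := by
  have := (hF.ac hT).continuousOn
  rwa [uIcc_of_le hT] at this

theorem ae_hasDerivAt (hF : IsPrim F q T) (hT : 0 ≤ T) :
    ∀ᵐ x, x ∈ Ioo 0 T → HasDerivAt F (q x) x := by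
  filter_upwards [hF.1.ae_hasDerivAt_integral] with x hx hxT
  have h1 := (hx (by rw [uIcc_of_le hT]; exact Ioo_subset_Icc_self hxT) 0
    left_mem_uIcc).const_add (F 0)
  refine h1.congr_of_eventuallyEq ?_
  filter_upwards [Ioo_mem_nhds hxT.1 hxT.2] with y hy
  exact hF.2 y (Ioo_subset_Icc_self hy)

theorem of_ac (hF : AbsolutelyContinuousOnInterval F 0 T) : IsPrim F (deriv F) T := by
  refine ⟨hF.intervalIntegrable_deriv, fun x hx => ?_⟩
  have hT : 0 ≤ T := hx.1.trans hx.2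
  have : AbsolutelyContinuousOnInterval F 0 x := hF.mono (by
    rw [uIcc_of_le hx.1, uIcc_of_le hT]; exact Icc_subset_Icc_right hx.2)
  rw [this.integral_deriv_eq_sub]; ring

theorem congr_right (hF : IsPrim F q T) (hT : 0 ≤ T) (h : ∀ᵐ x, x ∈ Ioo 0 T → q x = r x) :
    IsPrim F r T := by
  have h' : ∀ᵐ x, x ∈ uIoc 0 T → q x = r x := by
    filter_upwards [h, compl_mem_ae_iff.2 (measure_singleton T)] with x hx hxT hxI
    rw [uIoc_of_le hT] at hxI
    exact hx ⟨hxI.1, lt_of_le_of_ne hxI.2 hxT⟩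
  refine ⟨hF.1.congr_ae ((ae_restrict_iff' measurableSet_uIoc).2 h'), fun x hx => ?_⟩
  rw [hF.2 x hx]
  congr 1
  refine intervalIntegral.integral_congr_ae ?_
  filter_upwards [h'] with y hy hyx
  refine hy ?_
  rw [uIoc_of_le hx.1] at hyx
  rw [uIoc_of_le hT]
  exact ⟨hyx.1, hyx.2.trans hx.2⟩

theorem congr_left (hF : IsPrim F q T) (h : EqOn F G (Icc 0 T)) : IsPrim G q T := by
  refine ⟨hF.1, fun x hx => ?_⟩
  rw [← h hx, hF.2 x hx, h ⟨le_rfl, hx.1.trans hx.2⟩]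

/-- An absolutely continuous function is recovered from its almost everywhere derivative. Products,
sums and multiples of primitives thus reduce to the pointwise rules of differentiation. -/
theorem of_ac_of_ae (hF : AbsolutelyContinuousOnInterval F 0 T) (hT : 0 ≤ T)
    (h : ∀ᵐ x, x ∈ Ioo 0 T → HasDerivAt F (q x) x) : IsPrim F q T := by
  refine (of_ac hF).congr_right hT ?_
  filter_upwards [h] with x hx hxT
  exact (hx hxT).deriv

theorem mul (hF : IsPrim F q T) (hG : IsPrim G r T) (hT : 0 ≤ T) :
    IsPrim (fun x => F x * G x) (fun x => q x * G x + F x * r x) T := by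
  refine of_ac_of_ae ((hF.ac hT).mul (hG.ac hT)) hT ?_
  filter_upwards [hF.ae_hasDerivAt hT, hG.ae_hasDerivAt hT] with x h1 h2 hx
  exact (h1 hx).mul (h2 hx)

theorem add (hF : IsPrim F q T) (hG : IsPrim G r T) (hT : 0 ≤ T) :
    IsPrim (fun x => F x + G x) (fun x => q x + r x) T := by
  refine of_ac_of_ae ((hF.ac hT).add (hG.ac hT)) hT ?_
  filter_upwards [hF.ae_hasDerivAt hT, hG.ae_hasDerivAt hT] with x h1 h2 hx
  exact (h1 hx).add (h2 hx)

theorem const_mul (hF : IsPrim F q T) (hT : 0 ≤ T) (s : ℝ) :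
    IsPrim (fun x => s * F x) (fun x => s * q x) T := by
  refine of_ac_of_ae ((hF.ac hT).const_mul s) hT ?_
  filter_upwards [hF.ae_hasDerivAt hT] with x h1 hx
  exact (h1 hx).const_mul s

theorem of_hasDerivAt (h : ∀ x, HasDerivAt F (q x) x) (hq : Continuous q) : IsPrim F q T := by
  refine ⟨hq.intervalIntegrable _ _, fun x _ => ?_⟩
  rw [intervalIntegral.integral_eq_sub_of_hasDerivAt (fun y _ => h y) (hq.intervalIntegrable _ _)]
  ring

theorem integral (hq : IntervalIntegrable q volume 0 T) :
    IsPrim (fun x => ∫ ξ in (0 : ℝ)..x, q ξ) q T := ⟨hq, fun x _ => by simp⟩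

/-- Continuity of the density gives a right derivative at every point instead of almost every point,
as required by the uniqueness theorem for ODEs. -/
theorem hasDerivWithinAt_Ici (hF : IsPrim F q T) (hq : ContinuousOn q (Icc 0 T)) {x : ℝ}
    (hx : x ∈ Ico 0 T) : HasDerivWithinAt F (q x) (Ici x) x := by
  have hT : 0 < T := hx.1.trans_lt hx.2
  have hqx : ContinuousWithinAt q (Ioi x) x :=
    (hq x ⟨hx.1, hx.2.le⟩).mono_of_mem_nhdsWithin
      (mem_of_superset (Ioo_mem_nhdsGT hx.2) fun y hy => ⟨hx.1.trans hy.1.le, hy.2.le⟩)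
  have hm : StronglyMeasurableAtFilter q (𝓝[>] x) := by
    refine ⟨Ioo x T, Ioo_mem_nhdsGT hx.2, ?_⟩
    exact (hq.mono fun y hy => ⟨hx.1.trans hy.1.le, hy.2.le⟩).aestronglyMeasurable
      measurableSet_Ioo
  have h := intervalIntegral.integral_hasDerivWithinAt_right
    ((hF.mono hx.1 hx.2.le).1) hm hqx (s := Ici x)
  refine (h.const_add (F 0)).congr_of_eventuallyEq ?_ (hF.2 x ⟨hx.1, hx.2.le⟩)
  filter_upwards [Ico_mem_nhdsGE hx.2] with y hy
  exact hF.2 y ⟨hx.1.trans hy.1, hy.2.le⟩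

theorem ae_eq_of_eqOn (hF : IsPrim F q T) (hG : IsPrim G r T) (hT : 0 ≤ T)
    (h : EqOn F G (Icc 0 T)) : ∀ᵐ x, x ∈ Ioo 0 T → q x = r x := by
  filter_upwards [hF.ae_hasDerivAt hT, hG.ae_hasDerivAt hT] with x h1 h2 hx
  refine (h1 hx).unique ((h2 hx).congr_of_eventuallyEq ?_)
  filter_upwards [Ioo_mem_nhds hx.1 hx.2] with y hy
  exact h (Ioo_subset_Icc_self hy)

end IsPrim

/-- Continuous functions on `[0, T]` which agree almost everywhere are equal. -/
theorem eqOn_Icc_of_ae_eq {f g : ℝ → ℝ} {T : ℝ} (hT : 0 < T) (hf : ContinuousOn f (Icc 0 T))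
    (hg : ContinuousOn g (Icc 0 T)) (h : ∀ᵐ x, x ∈ Ioo 0 T → f x = g x) :
    EqOn f g (Icc 0 T) := by
  have h1 : EqOn f g (Ioo 0 T) :=
    Measure.eqOn_Ioo_of_ae_eq volume
      ((ae_restrict_iff' measurableSet_Ioo).2 h) (hf.mono Ioo_subset_Icc_self)
      (hg.mono Ioo_subset_Icc_self)
  have := h1.of_subset_closure hf hg Ioo_subset_Icc_self (by rw [closure_Ioo hT.ne])
  exact this

/-! ### The space `L²(0,1)` -/

theorem ae_Ioo_iff {P : ℝ → Prop} :
    (∀ᵐ x ∂(volume.restrict (Ioo (0 : ℝ) 1)), P x) ↔ ∀ᵐ x, x ∈ Ioo (0 : ℝ) 1 → P x :=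
  ae_restrict_iff' measurableSet_Ioo

/-- With total mass one, the `L²` norm dominates the `L¹` norm and is dominated by the supremum,
without constants. -/
instance : IsProbabilityMeasure (volume.restrict (Ioo (0 : ℝ) 1)) := ⟨by simp⟩

theorem integral_Ioo_eq (f : ℝ → ℝ) :
    ∫ x, f x ∂(volume.restrict (Ioo (0 : ℝ) 1)) = ∫ x in (0 : ℝ)..1, f x := by
  rw [intervalIntegral.integral_of_le zero_le_one, integral_Ioc_eq_integral_Ioo]

theorem intervalIntegrable_coe (f : H) : IntervalIntegrable f volume 0 1 := by
  rw [intervalIntegrable_iff_integrableOn_Ioo_of_le zero_le_one]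
  exact (Lp.memLp f).integrable (by norm_num)

theorem inner_eq_integral (f g : H) : inner ℝ f g = ∫ x in (0 : ℝ)..1, f x * g x := by
  rw [L2.inner_def, ← integral_Ioo_eq]
  simp [mul_comm]

theorem integral_abs_le_norm (f : H) : ∫ x in (0 : ℝ)..1, |f x| ≤ ‖f‖ := by
  have h1 : eLpNorm f 1 (volume.restrict (Ioo (0 : ℝ) 1)) ≤
      eLpNorm f 2 (volume.restrict (Ioo (0 : ℝ) 1)) :=
    eLpNorm_le_eLpNorm_of_exponent_le (by norm_num) (Lp.aestronglyMeasurable f)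
  have h2 := ENNReal.toReal_mono (Lp.eLpNorm_ne_top f) h1
  rw [← Lp.norm_def] at h2
  refine le_trans (le_of_eq ?_) h2
  rw [eLpNorm_one_eq_lintegral_enorm, ← integral_Ioo_eq,
    ← integral_norm_eq_lintegral_enorm (Lp.aestronglyMeasurable f)]
  rfl

theorem norm_le_of_ae_le {f : H} {φ : ℝ → ℝ} (h : f =ᵐ[volume.restrict (Ioo (0 : ℝ) 1)] φ) {C : ℝ}
    (hC : 0 ≤ C) (hφ : ∀ x ∈ Icc (0 : ℝ) 1, |φ x| ≤ C) : ‖f‖ ≤ C := by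
  have := Lp.norm_le_of_ae_bound (f := f) (p := 2) (C := C) hC ?_
  · have h1 : measureUnivNNReal (volume.restrict (Ioo (0 : ℝ) 1)) = 1 := by
      simp [measureUnivNNReal]
    simpa [h1] using this
  · filter_upwards [h, ae_restrict_mem measurableSet_Ioo] with x hx hxI
    rw [hx]
    exact hφ x (Ioo_subset_Icc_self hxI)

theorem memLp_of_continuousOn {φ : ℝ → ℝ} (h : ContinuousOn φ (Icc 0 1)) :
    MemLp φ 2 (volume.restrict (Ioo (0 : ℝ) 1)) := by
  obtain ⟨C, hC⟩ := isCompact_Icc.exists_bound_of_continuousOn h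
  refine MemLp.of_bound (C := C)
    ((h.mono Ioo_subset_Icc_self).aestronglyMeasurable measurableSet_Ioo) ?_
  filter_upwards [ae_restrict_mem measurableSet_Ioo] with x hx
  exact hC x (Ioo_subset_Icc_self hx)

/-! ### The Sobolev space `H²(0,1)` -/

theorem isH2Rep_iff {f : H} {φ φ' : ℝ → ℝ} {w : H} :
    IsH2Rep f φ φ' w ↔ (∀ᵐ x, x ∈ Ioo (0 : ℝ) 1 → f x = φ x) ∧ IsPrim φ φ' 1 ∧ IsPrim φ' w 1 := by
  constructor
  · rintro ⟨h1, h2, h3⟩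
    have h4 : IsPrim φ' w 1 := ⟨intervalIntegrable_coe w, h3⟩
    refine ⟨ae_Ioo_iff.1 h1, ⟨?_, h2⟩, h4⟩
    apply ContinuousOn.intervalIntegrable
    rw [uIcc_of_le zero_le_one]
    exact h4.continuousOn zero_le_one
  · rintro ⟨h1, h2, h3⟩
    exact ⟨ae_Ioo_iff.2 h1, h2.2, h3.2⟩

/-- Continuous functions equal almost everywhere are equal, and equal primitives have densities
equal almost everywhere; alternating the two facts descends from `f` to `f''`. Hence the choice made
in `h2Data` is harmless. -/
theorem IsH2Rep.unique {f : H} {φ φ' ψ ψ' : ℝ → ℝ} {w v : H} (h : IsH2Rep f φ φ' w)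
    (g : IsH2Rep f ψ ψ' v) : EqOn φ ψ (Icc 0 1) ∧ EqOn φ' ψ' (Icc 0 1) ∧ w = v := by
  rw [isH2Rep_iff] at h g
  have e1 : EqOn φ ψ (Icc 0 1) := by
    refine eqOn_Icc_of_ae_eq one_pos (h.2.1.continuousOn zero_le_one)
      (g.2.1.continuousOn zero_le_one) ?_
    filter_upwards [h.1, g.1] with x h1 h2 hx
    rw [← h1 hx, h2 hx]
  have e2 : EqOn φ' ψ' (Icc 0 1) :=
    eqOn_Icc_of_ae_eq one_pos (h.2.2.continuousOn zero_le_one)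
      (g.2.2.continuousOn zero_le_one) (h.2.1.ae_eq_of_eqOn g.2.1 zero_le_one e1)
  refine ⟨e1, e2, Lp.ext (ae_Ioo_iff.2 (h.2.2.ae_eq_of_eqOn g.2.2 zero_le_one e2))⟩

theorem IsH2Rep.add {f g : H} {φ φ' ψ ψ' : ℝ → ℝ} {w v : H} (h : IsH2Rep f φ φ' w)
    (h' : IsH2Rep g ψ ψ' v) :
    IsH2Rep (f + g) (fun x => φ x + ψ x) (fun x => φ' x + ψ' x) (w + v) := by
  rw [isH2Rep_iff] at *
  refine ⟨?_, h.2.1.add h'.2.1 zero_le_one, (h.2.2.add h'.2.2 zero_le_one).congr_right zero_le_one ?_⟩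
  · filter_upwards [h.1, h'.1, ae_Ioo_iff.1 (Lp.coeFn_add f g)] with x h1 h2 h3 hx
    rw [h3 hx, Pi.add_apply, h1 hx, h2 hx]
  · filter_upwards [ae_Ioo_iff.1 (Lp.coeFn_add w v)] with x h3 hx
    rw [h3 hx, Pi.add_apply]

theorem IsH2Rep.smul {f : H} {φ φ' : ℝ → ℝ} {w : H} (h : IsH2Rep f φ φ' w) (s : ℝ) :
    IsH2Rep (s • f) (fun x => s * φ x) (fun x => s * φ' x) (s • w) := by
  rw [isH2Rep_iff] at *
  refine ⟨?_, h.2.1.const_mul zero_le_one s, (h.2.2.const_mul zero_le_one s).congr_right zero_le_one ?_⟩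
  · filter_upwards [h.1, ae_Ioo_iff.1 (Lp.coeFn_smul s f)] with x h1 h3 hx
    rw [h3 hx, Pi.smul_apply, h1 hx, smul_eq_mul]
  · filter_upwards [ae_Ioo_iff.1 (Lp.coeFn_smul s w)] with x h3 hx
    rw [h3 hx, Pi.smul_apply, smul_eq_mul]

/-- Green's formula. -/
theorem IsH2Rep.green {f g : H} {φ φ' ψ ψ' : ℝ → ℝ} {w v : H} (h : IsH2Rep f φ φ' w)
    (h' : IsH2Rep g ψ ψ' v) :
    inner ℝ w g - inner ℝ f v =
      (φ' 1 * ψ 1 - φ 1 * ψ' 1) - (φ' 0 * ψ 0 - φ 0 * ψ' 0) := by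
  rw [isH2Rep_iff] at *
  have z := zero_le_one (α := ℝ)
  -- The function `φ' ψ - φ ψ'` has density `w ψ - φ v`, because the products `φ' ψ'` cancel.
  have P := (h.2.2.mul h'.2.1 z).add ((h.2.1.mul h'.2.2 z).const_mul z (-1)) z
  have e := P.2 1 ⟨z, le_rfl⟩
  have i1 : IntervalIntegrable (fun x => w x * g x) volume 0 1 := by
    rw [intervalIntegrable_iff_integrableOn_Ioo_of_le z]
    exact (Lp.memLp w).integrable_mul (Lp.memLp g)
  have i2 : IntervalIntegrable (fun x => f x * v x) volume 0 1 := by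
    rw [intervalIntegrable_iff_integrableOn_Ioo_of_le z]
    exact (Lp.memLp f).integrable_mul (Lp.memLp v)
  rw [inner_eq_integral, inner_eq_integral, ← intervalIntegral.integral_sub i1 i2]
  have : ∫ x in (0 : ℝ)..1, (w x * g x - f x * v x) =
      ∫ x in (0 : ℝ)..1, (w x * ψ x + φ' x * ψ' x + -1 * (φ' x * ψ' x + φ x * v x)) := by
    refine intervalIntegral.integral_congr_ae ?_
    filter_upwards [h.1, h'.1, compl_mem_ae_iff.2 (measure_singleton (1 : ℝ))] with x h1 h2 h3 hx
    rw [uIoc_of_le z] at hx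
    have hx' : x ∈ Ioo (0 : ℝ) 1 := ⟨hx.1, lt_of_le_of_ne hx.2 h3⟩
    rw [h1 hx', h2 hx']; ring
  rw [this]
  linarith

theorem h2Data_eq {f : H} {φ φ' : ℝ → ℝ} {w : H} (h : IsH2Rep f φ φ' w) :
    EqOn (h2Data f).1 φ (Icc 0 1) ∧ EqOn (h2Data f).2.1 φ' (Icc 0 1) ∧ (h2Data f).2.2 = w :=
  (h2Data_spec ⟨φ, φ', w, h⟩).unique h

theorem opA_eq (a b : ℝ) {f : H} {φ φ' : ℝ → ℝ} {w : H} (h : IsH2Rep f φ φ' w) :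
    opA a b f = a • w + b • f := by
  rw [opA, (h2Data_eq h).2.2]

/-- `f` belongs to the domain of `𝒜₀`, and its second derivative is `w`. -/
def HasLap (θ₁ θ₂ : ℝ) (f w : H) : Prop :=
  ∃ φ φ' : ℝ → ℝ, IsH2Rep f φ φ' w ∧ Real.cos θ₁ * φ 0 - Real.sin θ₁ * φ' 0 = 0 ∧
    Real.cos θ₂ * φ 1 + Real.sin θ₂ * φ' 1 = 0

theorem hasLap_iff {θ₁ θ₂ : ℝ} {f w : H} :
    HasLap θ₁ θ₂ f w ↔ f ∈ domA₀ θ₁ θ₂ ∧ (h2Data f).2.2 = w := by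
  have h0 : (0 : ℝ) ∈ Icc (0 : ℝ) 1 := by simp
  have h1 : (1 : ℝ) ∈ Icc (0 : ℝ) 1 := by simp
  have key : opB θ₁ θ₂ f = 0 ↔
      Real.cos θ₁ * (h2Data f).1 0 - Real.sin θ₁ * (h2Data f).2.1 0 = 0 ∧
      Real.cos θ₂ * (h2Data f).1 1 + Real.sin θ₂ * (h2Data f).2.1 1 = 0 := by
    constructor
    · intro h
      exact ⟨by simpa [opB] using congrArg (fun v : U => v 0) h,
        by simpa [opB] using congrArg (fun v : U => v 1) h⟩
    · rintro ⟨e0, e1⟩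
      ext i
      fin_cases i
      · simpa [opB] using e0
      · simpa [opB] using e1
  constructor
  · rintro ⟨φ, φ', h, b1, b2⟩
    obtain ⟨e1, e2, e3⟩ := h2Data_eq h
    refine ⟨⟨⟨φ, φ', w, h⟩, key.2 ?_⟩, e3⟩
    rw [e1 h0, e2 h0, e1 h1, e2 h1]
    exact ⟨b1, b2⟩
  · rintro ⟨⟨h, hb⟩, rfl⟩
    exact ⟨_, _, h2Data_spec h, (key.1 hb).1, (key.1 hb).2⟩

namespace HasLap

variable {θ₁ θ₂ : ℝ} {f g w v : H}

theorem unique (h : HasLap θ₁ θ₂ f w) (h' : HasLap θ₁ θ₂ f v) : w = v :=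
  (hasLap_iff.1 h).2.symm.trans (hasLap_iff.1 h').2

theorem add (h : HasLap θ₁ θ₂ f w) (h' : HasLap θ₁ θ₂ g v) : HasLap θ₁ θ₂ (f + g) (w + v) := by
  obtain ⟨φ, φ', h, b1, b2⟩ := h
  obtain ⟨ψ, ψ', h', c1, c2⟩ := h'
  exact ⟨_, _, h.add h', by linear_combination b1 + c1, by linear_combination b2 + c2⟩

theorem smul (h : HasLap θ₁ θ₂ f w) (s : ℝ) : HasLap θ₁ θ₂ (s • f) (s • w) := by
  obtain ⟨φ, φ', h, b1, b2⟩ := h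
  exact ⟨_, _, h.smul s, by linear_combination s * b1, by linear_combination s * b2⟩

/-- A vector orthogonal to `(p, -q)` is proportional to `(q, p)`, where `p² + q² = 1`. -/
theorem exists_eq_mul_of_boundary {θ x y : ℝ} (h : Real.cos θ * x - Real.sin θ * y = 0) :
    ∃ r, x = r * Real.sin θ ∧ y = r * Real.cos θ := by
  have h1 := Real.sin_sq_add_cos_sq θ
  refine ⟨x * Real.sin θ + y * Real.cos θ, ?_, ?_⟩
  · linear_combination (-x) * h1 + Real.cos θ * h
  · linear_combination (-y) * h1 - Real.sin θ * h

/-- The Dirichlet, Neumann or Robin Laplacian is symmetric. -/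
theorem symm (h : HasLap θ₁ θ₂ f w) (h' : HasLap θ₁ θ₂ g v) : inner ℝ w g = inner ℝ f v := by
  obtain ⟨φ, φ', h, b1, b2⟩ := h
  obtain ⟨ψ, ψ', h', c1, c2⟩ := h'
  have := h.green h'
  -- At each end the boundary condition makes the Cauchy data of both functions multiples of one
  -- fixed vector, so the boundary terms of Green's formula vanish. The sign of the derivative is
  -- reversed at `1`.
  obtain ⟨r, e1, e2⟩ := exists_eq_mul_of_boundary b1
  obtain ⟨s, e3, e4⟩ := exists_eq_mul_of_boundary c1
  obtain ⟨r', e1', e2'⟩ := exists_eq_mul_of_boundary (θ := θ₂) (x := φ 1) (y := - φ' 1) (by linarith)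
  obtain ⟨s', e3', e4'⟩ := exists_eq_mul_of_boundary (θ := θ₂) (x := ψ 1) (y := - ψ' 1) (by linarith)
  rw [e1, e2, e3, e4, e1', e3', show φ' 1 = -(r' * Real.cos θ₂) by linarith,
    show ψ' 1 = -(s' * Real.cos θ₂) by linarith] at this
  linarith

end HasLap

/-! ### The resolvent of the Laplacian with Robin boundary conditions -/

theorem toLp_congr {φ : ℝ → ℝ} (h : MemLp φ 2 (volume.restrict (Ioo (0 : ℝ) 1))) :
    ∀ᵐ x, x ∈ Ioo (0 : ℝ) 1 → (h.toLp φ : H) x = φ x := ae_Ioo_iff.1 h.coeFn_toLp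

theorem isH2Rep_of_hasDerivAt {f w : H} {φ φ' φ'' : ℝ → ℝ} (h : ∀ x, HasDerivAt φ (φ' x) x)
    (h' : ∀ x, HasDerivAt φ' (φ'' x) x) (hφ'' : Continuous φ'')
    (hf : ∀ᵐ x, x ∈ Ioo (0 : ℝ) 1 → f x = φ x) (hw : ∀ᵐ x, x ∈ Ioo (0 : ℝ) 1 → w x = φ'' x) :
    IsH2Rep f φ φ' w := by
  have hφ' : Continuous φ' := continuous_iff_continuousAt.2 fun x => (h' x).continuousAt
  refine isH2Rep_iff.2 ⟨hf, IsPrim.of_hasDerivAt h hφ',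
    (IsPrim.of_hasDerivAt h' hφ'').congr_right zero_le_one ?_⟩
  filter_upwards [hw] with x hx hxI using (hx hxI).symm

/-- A solution of `f'' = q f` with vanishing Cauchy data at `0` vanishes. -/
theorem IsH2Rep.eq_zero_of_cauchy {f : H} {φ φ' : ℝ → ℝ} {q : ℝ} (h : IsH2Rep f φ φ' (q • f))
    (h0 : φ 0 = 0) (h1 : φ' 0 = 0) : f = 0 := by
  rw [isH2Rep_iff] at h
  obtain ⟨hf, P, P'⟩ := h
  have z := zero_le_one (α := ℝ)
  have cφ := P.continuousOn z
  have cφ' := P'.continuousOn z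
  have P'' : IsPrim φ' (fun x => q * φ x) 1 := by
    refine P'.congr_right z ?_
    filter_upwards [hf, ae_Ioo_iff.1 (Lp.coeFn_smul q f)] with x e1 e2 hx
    rw [e2 hx, Pi.smul_apply, e1 hx, smul_eq_mul]
  -- The equation as a first-order linear system for `(φ, φ')`, compared below with the zero
  -- solution.
  let L : ℝ × ℝ →L[ℝ] ℝ × ℝ :=
    (ContinuousLinearMap.snd ℝ ℝ ℝ).prod (q • ContinuousLinearMap.fst ℝ ℝ ℝ)
  have key : EqOn (fun x => (φ x, φ' x)) (fun _ => (0 : ℝ × ℝ)) (Icc 0 1) := by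
    refine ODE_solution_unique_of_mem_Icc_right (v := fun _ => L) (s := fun _ => univ)
      (K := ‖L‖₊) (fun t _ => L.lipschitz.lipschitzOnWith) (cφ.prodMk cφ') (fun t ht => ?_)
      (fun _ _ => mem_univ _) continuousOn_const (fun t _ => ?_) (fun _ _ => mem_univ _) ?_
    · have d1 := P.hasDerivWithinAt_Ici cφ' ht
      have d2 := P''.hasDerivWithinAt_Ici (cφ.const_smul q) ht
      exact d1.prodMk d2
    · simpa using hasDerivWithinAt_const (x := t) (s := Ici t) (c := (0 : ℝ × ℝ))
    · simp [h0, h1]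
  refine Lp.ext (ae_Ioo_iff.2 ?_)
  filter_upwards [hf, ae_Ioo_iff.1 (Lp.coeFn_zero ℝ 2 (volume.restrict (Ioo (0 : ℝ) 1)))]
    with x e1 e2 hx
  rw [e1 hx, e2 hx]
  exact congrArg Prod.fst (key (Ioo_subset_Icc_self hx))

/-- Nonzero eigenfunctions have nonzero Cauchy data at `0`, compatible with the boundary
condition. -/
theorem exists_cauchy_data {θ₁ : ℝ} {f : H} {φ φ' : ℝ → ℝ} {q : ℝ}
    (h : IsH2Rep f φ φ' (q • f)) (hb : Real.cos θ₁ * φ 0 - Real.sin θ₁ * φ' 0 = 0) (hf : f ≠ 0) :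
    ∃ r, r ≠ 0 ∧ φ 0 = r * Real.sin θ₁ ∧ φ' 0 = r * Real.cos θ₁ := by
  obtain ⟨r, e1, e2⟩ := HasLap.exists_eq_mul_of_boundary hb
  refine ⟨r, ?_, e1, e2⟩
  rintro rfl
  exact hf (h.eq_zero_of_cauchy (by simpa using e1) (by simpa using e2))

/-- The eigenvalues are simple. -/
theorem HasLap.exists_eq_smul {θ₁ θ₂ q : ℝ} {f g : H} (hf : HasLap θ₁ θ₂ f (q • f))
    (hg : HasLap θ₁ θ₂ g (q • g)) (h0 : f ≠ 0) : ∃ r : ℝ, g = r • f := by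
  obtain ⟨φ, φ', h, b1, b2⟩ := hf
  obtain ⟨ψ, ψ', h', c1, c2⟩ := hg
  obtain ⟨r, hr, e1, e2⟩ := exists_cauchy_data h b1 h0
  obtain ⟨s, e3, e4⟩ := HasLap.exists_eq_mul_of_boundary c1
  -- The Cauchy data at `0` of `f` and `g` are `r` and `s` times the same vector, so `g - (s / r) f`
  -- has zero Cauchy data.
  refine ⟨s / r, sub_eq_zero.1 ?_⟩
  have H := h'.add (h.smul (-(s / r)))
  have e : ψ 0 + -(s / r) * φ 0 = 0 := by rw [e1, e3]; field_simp; ring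
  have e' : ψ' 0 + -(s / r) * φ' 0 = 0 := by rw [e2, e4]; field_simp; ring
  rw [sub_eq_add_neg, ← neg_smul]
  refine IsH2Rep.eq_zero_of_cauchy (q := q) (φ := fun x => ψ x + -(s / r) * φ x)
    (φ' := fun x => ψ' x + -(s / r) * φ' x) ?_ e e'
  convert H using 1
  rw [smul_add, smul_comm]

theorem abs_integral_mul_le {y : ℝ → ℝ} (hy : Continuous y) {M : ℝ}
    (hM : ∀ x ∈ Icc (0 : ℝ) 1, |y x| ≤ M) (f : H) {s t : ℝ} (hs : 0 ≤ s) (hst : s ≤ t)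
    (ht : t ≤ 1) : |∫ x in s..t, y x * f x| ≤ M * ‖f‖ := by
  have hM0 : 0 ≤ M := (abs_nonneg _).trans (hM 0 (by simp))
  have i1 : IntervalIntegrable (fun x => M * |f x|) volume 0 1 :=
    (intervalIntegrable_coe f).abs.const_mul M
  have i2 : IntervalIntegrable (fun x => |y x * f x|) volume 0 1 :=
    ((intervalIntegrable_coe f).continuousOn_mul hy.continuousOn).abs
  have sub : uIcc s t ⊆ uIcc 0 1 := by
    rw [uIcc_of_le hst, uIcc_of_le zero_le_one]; exact Icc_subset_Icc hs ht
  calc |∫ x in s..t, y x * f x| ≤ ∫ x in s..t, |y x * f x| :=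
        intervalIntegral.abs_integral_le_integral_abs hst
    _ ≤ ∫ x in s..t, M * |f x| := by
        refine intervalIntegral.integral_mono_on hst (i2.mono_set sub) (i1.mono_set sub) ?_
        intro x hx
        rw [abs_mul]
        exact mul_le_mul_of_nonneg_right (hM x ⟨hs.trans hx.1, hx.2.trans ht⟩) (abs_nonneg _)
    _ ≤ ∫ x in (0 : ℝ)..1, M * |f x| :=
        intervalIntegral.integral_mono_interval hs hst ht
          (ae_of_all _ fun x => mul_nonneg hM0 (abs_nonneg _)) i1
    _ = M * ∫ x in (0 : ℝ)..1, |f x| := by rw [intervalIntegral.integral_const_mul]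
    _ ≤ M * ‖f‖ := mul_le_mul_of_nonneg_left (integral_abs_le_norm f) hM0

/-- Solution of `q g - g'' = f` by a Green function built from two solutions of `y'' = q y`
with nonzero Wronskian. -/
theorem exists_green {q W : ℝ} {y₁ y₁' y₂ y₂' : ℝ → ℝ} (h₁ : ∀ x, HasDerivAt y₁ (y₁' x) x)
    (h₁' : ∀ x, HasDerivAt y₁' (q * y₁ x) x) (h₂ : ∀ x, HasDerivAt y₂ (y₂' x) x)
    (h₂' : ∀ x, HasDerivAt y₂' (q * y₂ x) x) (hW : ∀ x, y₁' x * y₂ x - y₁ x * y₂' x = W)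
    (hW0 : W ≠ 0) :
    ∃ C, 0 ≤ C ∧ ∀ f : H, ∃ (g : H) (φ φ' : ℝ → ℝ), IsH2Rep g φ φ' (q • g - f) ∧
      (∃ r, φ 0 = r * y₁ 0 ∧ φ' 0 = r * y₁' 0) ∧ (∃ r, φ 1 = r * y₂ 1 ∧ φ' 1 = r * y₂' 1) ∧
      ∀ x ∈ Icc (0 : ℝ) 1, |φ x| ≤ C * ‖f‖ ∧ |φ' x| ≤ C * ‖f‖ := by
  have z := zero_le_one (α := ℝ)
  have c₁ : Continuous y₁ := continuous_iff_continuousAt.2 fun x => (h₁ x).continuousAt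
  have c₁' : Continuous y₁' := continuous_iff_continuousAt.2 fun x => (h₁' x).continuousAt
  have c₂ : Continuous y₂ := continuous_iff_continuousAt.2 fun x => (h₂ x).continuousAt
  have c₂' : Continuous y₂' := continuous_iff_continuousAt.2 fun x => (h₂' x).continuousAt
  obtain ⟨M, hM⟩ : ∃ M, ∀ x ∈ Icc (0 : ℝ) 1, |y₁ x| ≤ M ∧ |y₁' x| ≤ M ∧ |y₂ x| ≤ M ∧ |y₂' x| ≤ M := by
    have hc : Continuous fun x => |y₁ x| + |y₁' x| + |y₂ x| + |y₂' x| := by fun_prop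
    obtain ⟨M, hM⟩ := isCompact_Icc.exists_bound_of_continuousOn (s := Icc (0 : ℝ) 1) hc.continuousOn
    refine ⟨M, fun x hx => ?_⟩
    have := (le_abs_self _).trans (hM x hx)
    have a1 := abs_nonneg (y₁ x)
    have a2 := abs_nonneg (y₁' x)
    have a3 := abs_nonneg (y₂ x)
    have a4 := abs_nonneg (y₂' x)
    exact ⟨by linarith, by linarith, by linarith, by linarith⟩
  have hM0 : 0 ≤ M := (abs_nonneg _).trans (hM 0 (by simp)).1
  refine ⟨|W⁻¹| * (M * M + M * M), by positivity, fun f => ?_⟩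
  have i1 : IntervalIntegrable (fun x => y₁ x * f x) volume 0 1 :=
    (intervalIntegrable_coe f).continuousOn_mul c₁.continuousOn
  have i2 : IntervalIntegrable (fun x => y₂ x * f x) volume 0 1 :=
    (intervalIntegrable_coe f).continuousOn_mul c₂.continuousOn
  set A : ℝ → ℝ := fun x => ∫ ξ in (0 : ℝ)..x, y₁ ξ * f ξ with hA
  set B : ℝ → ℝ := fun x => ∫ ξ in x..1, y₂ ξ * f ξ with hB
  have PA : IsPrim A (fun x => y₁ x * f x) 1 := IsPrim.integral i1
  have PB : IsPrim B (fun x => -1 * (y₂ x * f x)) 1 := by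
    refine ⟨i2.const_mul (-1), fun x hx => ?_⟩
    rw [intervalIntegral.integral_const_mul]
    have := intervalIntegral.integral_add_adjacent_intervals (a := 0) (b := x) (c := 1)
      (i2.mono_set (by rw [uIcc_of_le hx.1, uIcc_of_le z]; exact Icc_subset_Icc_right hx.2))
      (i2.mono_set (by rw [uIcc_of_le hx.2, uIcc_of_le z]; exact Icc_subset_Icc_left hx.1))
    simp only [hB]
    linarith
  have Py₁ : IsPrim y₁ y₁' 1 := IsPrim.of_hasDerivAt h₁ c₁'
  have Py₁' : IsPrim y₁' (fun x => q * y₁ x) 1 := IsPrim.of_hasDerivAt h₁' (by fun_prop)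
  have Py₂ : IsPrim y₂ y₂' 1 := IsPrim.of_hasDerivAt h₂ c₂'
  have Py₂' : IsPrim y₂' (fun x => q * y₂ x) 1 := IsPrim.of_hasDerivAt h₂' (by fun_prop)
  -- Variation of parameters: the derivatives of `A` and `B` cancel in the first derivative, and
  -- contribute `W⁻¹ (y₂' y₁ - y₁' y₂) f = -f` to the second.
  set φ : ℝ → ℝ := fun x => W⁻¹ * (y₂ x * A x + y₁ x * B x) with hφ
  set φ' : ℝ → ℝ := fun x => W⁻¹ * (y₂' x * A x + y₁' x * B x) with hφ'
  have P : IsPrim φ φ' 1 := by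
    refine (((Py₂.mul PA z).add (Py₁.mul PB z) z).const_mul z W⁻¹).congr_right z
      (ae_of_all _ fun x _ => ?_)
    simp only [hφ']; ring
  have P' : IsPrim φ' (fun x => q * φ x - f x) 1 := by
    refine (((Py₂'.mul PA z).add (Py₁'.mul PB z) z).const_mul z W⁻¹).congr_right z
      (ae_of_all _ fun x _ => ?_)
    have e : W⁻¹ * W = 1 := inv_mul_cancel₀ hW0
    simp only [hφ]
    linear_combination (-f x) * e - W⁻¹ * f x * hW x
  have cφ := P.continuousOn z
  let g : H := (memLp_of_continuousOn cφ).toLp φ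
  have hg : ∀ᵐ x, x ∈ Ioo (0 : ℝ) 1 → g x = φ x := toLp_congr _
  -- Since `A` vanishes at `0` and `B` at `1`, the Cauchy data of `φ` are multiples of those of `y₁`
  -- at `0` and of `y₂` at `1`.
  refine ⟨g, φ, φ', isH2Rep_iff.2 ⟨hg, P, P'.congr_right z ?_⟩,
    ⟨W⁻¹ * B 0, ?_, ?_⟩, ⟨W⁻¹ * A 1, ?_, ?_⟩, fun x hx => ?_⟩
  · filter_upwards [hg, ae_Ioo_iff.1 (Lp.coeFn_sub (q • g) f), ae_Ioo_iff.1 (Lp.coeFn_smul q g)]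
      with x e1 e2 e3 hx
    rw [e2 hx, Pi.sub_apply, e3 hx, Pi.smul_apply, e1 hx, smul_eq_mul]
  · simp [hφ, hA]; ring
  · simp [hφ', hA]; ring
  · simp [hφ, hB]; ring
  · simp [hφ', hB]; ring
  · have bA : |A x| ≤ M * ‖f‖ :=
      abs_integral_mul_le c₁ (fun x hx => (hM x hx).1) f le_rfl hx.1 hx.2
    have bB : |B x| ≤ M * ‖f‖ :=
      abs_integral_mul_le c₂ (fun x hx => (hM x hx).2.2.1) f hx.1 hx.2 le_rfl
    obtain ⟨m1, m2, m3, m4⟩ := hM x hx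
    have key : ∀ s t : ℝ, |s| ≤ M → |t| ≤ M →
        |W⁻¹ * (s * A x + t * B x)| ≤ |W⁻¹| * (M * M + M * M) * ‖f‖ := by
      intro s t hs ht
      rw [abs_mul, mul_assoc]
      refine mul_le_mul_of_nonneg_left ?_ (abs_nonneg _)
      calc |s * A x + t * B x| ≤ |s| * |A x| + |t| * |B x| := by
            rw [← abs_mul, ← abs_mul]; exact abs_add_le _ _
        _ ≤ M * (M * ‖f‖) + M * (M * ‖f‖) := by gcongr
        _ = (M * M + M * M) * ‖f‖ := by ring
    exact ⟨key _ _ m3 m1, key _ _ m4 m2⟩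

/-- The boundary condition at `1` of the solution of `y'' = ω² y` with the boundary condition
at `0`. -/
noncomputable def charFun (θ₁ θ₂ ω : ℝ) : ℝ :=
  Real.cos θ₂ * (Real.sin θ₁ * ω * Real.cosh ω + Real.cos θ₁ * Real.sinh ω) +
    Real.sin θ₂ * (Real.sin θ₁ * ω ^ 2 * Real.sinh ω + Real.cos θ₁ * ω * Real.cosh ω)

theorem tendsto_sinh_div_cosh : Tendsto (fun ω => Real.sinh ω / Real.cosh ω) atTop (𝓝 1) := by
  have h : ∀ ω : ℝ, Real.sinh ω / Real.cosh ω = 1 - 2 * (Real.exp (2 * ω) + 1)⁻¹ := by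
    intro ω
    have h1 := Real.exp_pos ω
    rw [Real.sinh_eq, Real.cosh_eq, Real.exp_neg, show 2 * ω = ω + ω by ring, Real.exp_add]
    field_simp
    ring
  simp_rw [h]
  have h2 : Tendsto (fun ω : ℝ => Real.exp (2 * ω) + 1) atTop atTop :=
    tendsto_atTop_add_const_right _ _
      (Real.tendsto_exp_atTop.comp (tendsto_id.const_mul_atTop two_pos))
  simpa using (h2.inv_tendsto_atTop.const_mul 2).const_sub 1

/-- After division by `cosh ω` this is a quadratic in `ω` with coefficients `s₁ s₂ τ`, `sin (θ₁ +
θ₂)` and `c₁ c₂ τ`, where `τ → 1`. The highest coefficient that does not tend to zero decides; all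
three limits cannot vanish because `s² + c² = 1` for each angle. This bounds the spectrum from
above. -/
theorem eventually_charFun_ne_zero (θ₁ θ₂ : ℝ) : ∀ᶠ ω in atTop, charFun θ₁ θ₂ ω ≠ 0 := by
  set s₁ := Real.sin θ₁ with hs₁
  set c₁ := Real.cos θ₁ with hc₁
  set s₂ := Real.sin θ₂ with hs₂
  set c₂ := Real.cos θ₂ with hc₂
  have p₁ : s₁ ^ 2 + c₁ ^ 2 = 1 := Real.sin_sq_add_cos_sq θ₁
  have p₂ : s₂ ^ 2 + c₂ ^ 2 = 1 := Real.sin_sq_add_cos_sq θ₂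
  set τ : ℝ → ℝ := fun ω => Real.sinh ω / Real.cosh ω with hτ
  have hτ1 : Tendsto τ atTop (𝓝 1) := tendsto_sinh_div_cosh
  have hinv : Tendsto (fun ω : ℝ => ω⁻¹) atTop (𝓝 0) := tendsto_inv_atTop_zero
  have e : ∀ ω, charFun θ₁ θ₂ ω =
      Real.cosh ω * (s₁ * s₂ * ω ^ 2 * τ ω + (c₂ * s₁ + s₂ * c₁) * ω + c₁ * c₂ * τ ω) := by
    intro ω
    have : Real.cosh ω ≠ 0 := (Real.cosh_pos ω).ne'
    simp only [charFun, hτ, ← hs₁, ← hc₁, ← hs₂, ← hc₂]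
    field_simp
    ring
  have key : ∀ᶠ ω in atTop,
      s₁ * s₂ * ω ^ 2 * τ ω + (c₂ * s₁ + s₂ * c₁) * ω + c₁ * c₂ * τ ω ≠ 0 := by
    by_cases h1 : s₁ * s₂ = 0
    · by_cases h2 : c₂ * s₁ + s₂ * c₁ = 0
      · have h3 : c₁ * c₂ ≠ 0 := by
          intro h3
          rcases mul_eq_zero.1 h1 with h | h
          · rcases mul_eq_zero.1 h3 with h' | h'
            · simp [h, h'] at p₁
            · have : s₂ ≠ 0 := by rintro h''; simp [h', h''] at p₂
              have : c₁ = 0 := by simpa [h, this] using h2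
              simp [h, this] at p₁
          · rcases mul_eq_zero.1 h3 with h' | h'
            · have : s₁ ≠ 0 := by rintro h''; simp [h', h''] at p₁
              have : c₂ = 0 := by simpa [h, this] using h2
              simp [h, this] at p₂
            · simp [h, h'] at p₂
        have t : Tendsto (fun ω => c₁ * c₂ * τ ω) atTop (𝓝 (c₁ * c₂ * 1)) := hτ1.const_mul _
        filter_upwards [t.eventually_ne (b₂ := 0) (by simpa using h3)] with ω hω
        simpa [h1, h2] using hω
      · have t : Tendsto (fun ω => (c₂ * s₁ + s₂ * c₁) + c₁ * c₂ * (τ ω * ω⁻¹)) atTop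
            (𝓝 ((c₂ * s₁ + s₂ * c₁) + c₁ * c₂ * (1 * 0))) :=
          ((hτ1.mul hinv).const_mul _).const_add _
        filter_upwards [t.eventually_ne (b₂ := 0) (by simpa using h2), eventually_gt_atTop 0] with ω hω h0
        rw [h1]
        intro h
        apply hω
        field_simp
        linear_combination h
    · have t : Tendsto (fun ω => s₁ * s₂ * τ ω + (c₂ * s₁ + s₂ * c₁) * ω⁻¹ +
          c₁ * c₂ * (τ ω * ω⁻¹ * ω⁻¹)) atTop
          (𝓝 (s₁ * s₂ * 1 + (c₂ * s₁ + s₂ * c₁) * 0 + c₁ * c₂ * (1 * 0 * 0))) :=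
        ((hτ1.const_mul _).add (hinv.const_mul _)).add (((hτ1.mul hinv).mul hinv).const_mul _)
      filter_upwards [t.eventually_ne (b₂ := 0) (by simpa using h1), eventually_gt_atTop 0] with ω hω h0
      intro h
      apply hω
      field_simp
      linear_combination h
  filter_upwards [key] with ω hω
  rw [e]
  exact mul_ne_zero (Real.cosh_pos ω).ne' hω

theorem hasDerivAt_cosh_mul (p r ω x : ℝ) :
    HasDerivAt (fun x => p * Real.cosh (ω * x) + r * Real.sinh (ω * x))
      (ω * r * Real.cosh (ω * x) + ω * p * Real.sinh (ω * x)) x := by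
  have h : HasDerivAt (fun x : ℝ => ω * x) ω x := by simpa using (hasDerivAt_id x).const_mul ω
  refine ((h.cosh.const_mul p).fun_add (h.sinh.const_mul r)).congr_deriv ?_
  ring

theorem hasDerivAt_cosh_mul_one_sub (p r ω x : ℝ) :
    HasDerivAt (fun x => p * Real.cosh (ω * (1 - x)) + r * Real.sinh (ω * (1 - x)))
      ((-ω * r) * Real.cosh (ω * (1 - x)) + (-ω * p) * Real.sinh (ω * (1 - x))) x := by
  have h : HasDerivAt (fun x : ℝ => ω * (1 - x)) (-ω) x := by
    simpa using ((hasDerivAt_id x).const_sub 1).const_mul ω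
  refine ((h.cosh.const_mul p).fun_add (h.sinh.const_mul r)).congr_deriv ?_
  ring

/-- By its Cauchy data at `0`, a nonzero eigenfunction would be `r / ω` times the explicit
hyperbolic solution `y`; its boundary condition at `1` then forces `charFun` to vanish. -/
theorem HasLap.eq_zero_of_charFun_ne_zero {θ₁ θ₂ ω : ℝ} (hω : 0 < ω)
    (hc : charFun θ₁ θ₂ ω ≠ 0) {f : H} (hf : HasLap θ₁ θ₂ f (ω ^ 2 • f)) : f = 0 := by
  obtain ⟨φ, φ', h, b1, b2⟩ := hf
  by_contra h0
  obtain ⟨r, hr, e1, e2⟩ := exists_cauchy_data h b1 h0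
  set y : ℝ → ℝ := fun x =>
    Real.sin θ₁ * ω * Real.cosh (ω * x) + Real.cos θ₁ * Real.sinh (ω * x) with hy
  set y' : ℝ → ℝ := fun x => ω * Real.cos θ₁ * Real.cosh (ω * x) +
    ω * (Real.sin θ₁ * ω) * Real.sinh (ω * x) with hy'
  have d : ∀ x, HasDerivAt y (y' x) x := fun x => hasDerivAt_cosh_mul _ _ _ _
  have d' : ∀ x, HasDerivAt y' (ω ^ 2 * y x) x := fun x => by
    convert hasDerivAt_cosh_mul (ω * Real.cos θ₁) (ω * (Real.sin θ₁ * ω)) ω x using 1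
    simp only [hy]; ring
  have cy : Continuous y := continuous_iff_continuousAt.2 fun x => (d x).continuousAt
  let g : H := (memLp_of_continuousOn cy.continuousOn).toLp y
  have hg : ∀ᵐ x, x ∈ Ioo (0 : ℝ) 1 → g x = y x := toLp_congr _
  have R : IsH2Rep g y y' (ω ^ 2 • g) := by
    refine isH2Rep_of_hasDerivAt d d' (by fun_prop) hg ?_
    filter_upwards [hg, ae_Ioo_iff.1 (Lp.coeFn_smul (ω ^ 2) g)] with x e1 e2 hx
    rw [e2 hx, Pi.smul_apply, e1 hx, smul_eq_mul]
  have z : f + (-(r / ω)) • g = 0 := by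
    have H := h.add (R.smul (-(r / ω)))
    refine IsH2Rep.eq_zero_of_cauchy (q := ω ^ 2) (φ := fun x => φ x + -(r / ω) * y x)
      (φ' := fun x => φ' x + -(r / ω) * y' x) ?_ ?_ ?_
    · convert H using 1
      rw [smul_add, smul_comm]
    · simp only [hy, e1]; field_simp; simp
    · simp only [hy', e2]; field_simp; simp
  have hf : f = (r / ω) • g := by
    rw [neg_smul, ← sub_eq_add_neg, sub_eq_zero] at z; exact z
  have R' := R.smul (r / ω)
  rw [← hf] at R'
  obtain ⟨u1, u2, -⟩ := h.unique R'
  rw [u1 (by simp), u2 (by simp)] at b2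
  have : r / ω * charFun θ₁ θ₂ ω = 0 := by
    simp only [hy, hy', mul_one] at b2
    rw [charFun]
    linear_combination b2
  exact (mul_ne_zero (div_ne_zero hr hω.ne') hc) this

/-- The Green function is built from a solution satisfying the left condition and one satisfying the
right condition. Their Wronskian is `ω` times `charFun`, by the addition formulas for `cosh` and
`sinh`. -/
theorem exists_resolvent_rep {θ₁ θ₂ ω : ℝ} (hω : 0 < ω) (hc : charFun θ₁ θ₂ ω ≠ 0) :
    ∃ C, 0 ≤ C ∧ ∀ f : H, ∃ (g : H) (φ φ' : ℝ → ℝ), IsH2Rep g φ φ' (ω ^ 2 • g - f) ∧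
      Real.cos θ₁ * φ 0 - Real.sin θ₁ * φ' 0 = 0 ∧ Real.cos θ₂ * φ 1 + Real.sin θ₂ * φ' 1 = 0 ∧
      ∀ x ∈ Icc (0 : ℝ) 1, |φ x| ≤ C * ‖f‖ ∧ |φ' x| ≤ C * ‖f‖ := by
  obtain ⟨C, hC, H⟩ := exists_green (q := ω ^ 2) (W := ω * charFun θ₁ θ₂ ω)
    (fun x => hasDerivAt_cosh_mul (Real.sin θ₁ * ω) (Real.cos θ₁) ω x)
    (fun x => by
      convert hasDerivAt_cosh_mul (ω * Real.cos θ₁) (ω * (Real.sin θ₁ * ω)) ω x using 1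
      ring)
    (fun x => hasDerivAt_cosh_mul_one_sub (Real.sin θ₂ * ω) (Real.cos θ₂) ω x)
    (fun x => by
      convert hasDerivAt_cosh_mul_one_sub (-ω * Real.cos θ₂) (-ω * (Real.sin θ₂ * ω)) ω x using 1
      ring)
    (fun x => by
      have e : ω = ω * x + ω * (1 - x) := by ring
      have e1 : Real.cosh ω = Real.cosh (ω * x) * Real.cosh (ω * (1 - x)) +
          Real.sinh (ω * x) * Real.sinh (ω * (1 - x)) := by rw [← Real.cosh_add, ← e]
      have e2 : Real.sinh ω = Real.sinh (ω * x) * Real.cosh (ω * (1 - x)) +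
          Real.cosh (ω * x) * Real.sinh (ω * (1 - x)) := by rw [← Real.sinh_add, ← e]
      rw [charFun, e1, e2]
      ring)
    (mul_ne_zero hω.ne' hc)
  refine ⟨C, hC, fun f => ?_⟩
  obtain ⟨g, φ, φ', R, ⟨r, r1, r2⟩, ⟨s, s1, s2⟩, bd⟩ := H f
  refine ⟨g, φ, φ', R, ?_, ?_, bd⟩
  · rw [r1, r2]; simp; ring
  · rw [s1, s2]; simp; ring

/-- Uniformly bounded, uniformly Lipschitz functions on `[0,1]` form a relatively compact subset
of `L²(0,1)`. -/
theorem exists_isCompact_of_lipschitz (C : NNReal) :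
    ∃ K : Set H, IsCompact K ∧ ∀ (g : H) (φ : ℝ → ℝ), (∀ᵐ x, x ∈ Ioo (0 : ℝ) 1 → g x = φ x) →
      (∀ x ∈ Icc (0 : ℝ) 1, |φ x| ≤ C) → LipschitzOnWith C φ (Icc 0 1) → g ∈ K := by
  let A : Set (BoundedContinuousFunction (Icc (0 : ℝ) 1) ℝ) :=
    {ψ | (∀ x, |ψ x| ≤ C) ∧ LipschitzWith C ψ}
  have hA : IsCompact (closure A) := by
    refine BoundedContinuousFunction.arzela_ascoli (Metric.closedBall 0 C)
      (isCompact_closedBall _ _) A (fun ψ x hψ => by simpa using hψ.1 x) ?_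
    exact (LipschitzWith.uniformEquicontinuous _ C fun ψ => ψ.2.2).equicontinuous
  let pr : C(ℝ, Icc (0 : ℝ) 1) := ⟨projIcc 0 1 zero_le_one, continuous_projIcc⟩
  -- Projection onto `[0,1]` extends a function to the line before its `L²` class is taken. The map
  -- is continuous, so it transports the compactness given by Arzelà–Ascoli to `L²`.
  let J : BoundedContinuousFunction (Icc (0 : ℝ) 1) ℝ → H := fun ψ =>
    BoundedContinuousFunction.toLp 2 (volume.restrict (Ioo (0 : ℝ) 1)) ℝ (ψ.compContinuous pr)
  have hJ : Continuous J :=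
    (BoundedContinuousFunction.toLp 2 (volume.restrict (Ioo (0 : ℝ) 1)) ℝ).continuous.comp
      (BoundedContinuousFunction.continuous_compContinuous pr)
  refine ⟨J '' closure A, hA.image hJ, fun g φ hg hb hl => ?_⟩
  let ψ : BoundedContinuousFunction (Icc (0 : ℝ) 1) ℝ :=
    BoundedContinuousFunction.mkOfCompact
      ⟨fun x => φ x, (hl.to_restrict).continuous⟩
  refine ⟨ψ, subset_closure ⟨fun x => hb x x.2, hl.to_restrict⟩, Lp.ext ?_⟩
  have e := BoundedContinuousFunction.coeFn_toLp 2 (volume.restrict (Ioo (0 : ℝ) 1)) ℝ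
    (ψ.compContinuous pr)
  filter_upwards [e, ae_Ioo_iff.2 hg, ae_restrict_mem measurableSet_Ioo] with x h1 h2 hx
  rw [h1, h2]
  simp only [BoundedContinuousFunction.compContinuous_apply, ψ, pr, ContinuousMap.coe_mk,
    BoundedContinuousFunction.mkOfCompact_apply, projIcc_of_mem zero_le_one (Ioo_subset_Icc_self hx)]
  rfl

theorem IsPrim.lipschitzOnWith {F q : ℝ → ℝ} {T : ℝ} (hF : IsPrim F q T) {C : NNReal}
    (hq : ∀ x ∈ Icc 0 T, |q x| ≤ C) : LipschitzOnWith C F (Icc 0 T) := by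
  have key : ∀ x ∈ Icc 0 T, ∀ y ∈ Icc 0 T, x ≤ y → |F y - F x| ≤ C * (y - x) := by
    intro x hx y hy hxy
    have i : ∀ s ∈ Icc 0 T, IntervalIntegrable q volume 0 s := fun s hs =>
      (hF.mono hs.1 hs.2).1
    rw [hF.2 y hy, hF.2 x hx, add_sub_add_left_eq_sub,
      intervalIntegral.integral_interval_sub_left (i y hy) (i x hx)]
    have := intervalIntegral.norm_integral_le_of_norm_le_const (a := x) (b := y) (f := q) (C := C)
      (fun s hs => by
        rw [uIoc_of_le hxy] at hs
        exact hq s ⟨hx.1.trans hs.1.le, hs.2.trans hy.2⟩)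
    rwa [abs_of_nonneg (sub_nonneg.2 hxy)] at this
  refine LipschitzOnWith.of_dist_le_mul fun x hx y hy => ?_
  rw [Real.dist_eq, Real.dist_eq]
  rcases le_total x y with h | h
  · rw [abs_sub_comm, abs_sub_comm x y, abs_of_nonneg (sub_nonneg.2 h)]
    exact key x hx y hy h
  · rw [abs_of_nonneg (sub_nonneg.2 h)]
    exact key y hy x hx h

/-- The resolvent is a compact operator. -/
theorem exists_resolvent {θ₁ θ₂ ω : ℝ} (hω : 0 < ω) (hc : charFun θ₁ θ₂ ω ≠ 0) :
    ∃ G : H →L[ℝ] H, IsCompactOperator G ∧ ∀ f g : H, HasLap θ₁ θ₂ g (ω ^ 2 • g - f) ↔ g = G f := by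
  obtain ⟨C, hC, ex⟩ := exists_resolvent_rep hω hc
  choose G φ φ' R b1 b2 bd using ex
  have hG : ∀ f, HasLap θ₁ θ₂ (G f) (ω ^ 2 • G f - f) := fun f => ⟨φ f, φ' f, R f, b1 f, b2 f⟩
  have uniq : ∀ f g, HasLap θ₁ θ₂ g (ω ^ 2 • g - f) → g = G f := by
    intro f g hg
    have := hg.add ((hG f).smul (-1))
    have h0 : g + (-1 : ℝ) • G f = 0 := by
      refine HasLap.eq_zero_of_charFun_ne_zero hω hc (θ₁ := θ₁) (θ₂ := θ₂) ?_
      convert this using 1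
      module
    rw [neg_one_smul, ← sub_eq_add_neg, sub_eq_zero] at h0
    exact h0
  have hb : ∀ f, ‖G f‖ ≤ C * ‖f‖ := fun f =>
    norm_le_of_ae_le (R f).1 (by positivity) fun x hx => (bd f x hx).1
  -- Linearity comes from uniqueness of the solution.
  let L : H →ₗ[ℝ] H :=
    { toFun := G
      map_add' := fun f g => (uniq _ _ (by
        convert (hG f).add (hG g) using 1
        module)).symm
      map_smul' := fun s f => (uniq _ _ (by
        rw [RingHom.id_apply]
        convert (hG f).smul s using 1
        rw [smul_sub, smul_comm])).symm }
  refine ⟨L.mkContinuous C hb, ?_, fun f g => ⟨uniq f g, ?_⟩⟩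
  · obtain ⟨K, hK, mem⟩ := exists_isCompact_of_lipschitz ⟨C, hC⟩
    refine ⟨K, hK, mem_of_superset (Metric.closedBall_mem_nhds 0 one_pos) fun f hf => ?_⟩
    have hf1 : C * ‖f‖ ≤ C := mul_le_of_le_one_right hC (by simpa using hf)
    obtain ⟨e1, e2, -⟩ := isH2Rep_iff.1 (R f)
    exact mem (G f) (φ f) e1 (fun x hx => ((bd f x hx).1).trans hf1)
      (e2.lipschitzOnWith fun x hx => ((bd f x hx).2).trans hf1)
  · rintro rfl
    exact hG f

/-! ### Spectral decomposition -/

/-- `G` is the compact inverse of `ω² - ∂²` on `D(𝒜₀)`, and `ω²` is larger than all the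
eigenvalues of `∂²`. -/
structure IsResolvent (θ₁ θ₂ ω : ℝ) (G : H →L[ℝ] H) : Prop where
  eq_zero : ∀ (q : ℝ) (f : H), ω ^ 2 ≤ q → HasLap θ₁ θ₂ f (q • f) → f = 0
  compact : IsCompactOperator G
  hasLap_iff : ∀ f g : H, HasLap θ₁ θ₂ g (ω ^ 2 • g - f) ↔ g = G f

/-- Take `ω` beyond all zeros of `charFun`: any `q ≥ ω²` is the square of `√q ≥ ω`, hence not an
eigenvalue. -/
theorem exists_isResolvent (θ₁ θ₂ : ℝ) : ∃ ω G, IsResolvent θ₁ θ₂ ω G := by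
  obtain ⟨ω, hω⟩ := eventually_atTop.1
    ((eventually_charFun_ne_zero θ₁ θ₂).and (eventually_gt_atTop 0))
  have hω0 : 0 < ω := (hω ω le_rfl).2
  obtain ⟨G, hG, hG'⟩ := exists_resolvent hω0 (hω ω le_rfl).1
  refine ⟨ω, G, ⟨fun q f hq hf => ?_, hG, hG'⟩⟩
  have h1 : ω ≤ √q := Real.le_sqrt_of_sq_le hq
  refine HasLap.eq_zero_of_charFun_ne_zero (hω0.trans_le h1) (hω _ h1).1 (θ₁ := θ₁) (θ₂ := θ₂) ?_
  rwa [Real.sq_sqrt ((sq_nonneg ω).trans hq)]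

/-- The eigenvalues of the Laplacian with domain `D(𝒜₀)`. -/
def eigSet (θ₁ θ₂ : ℝ) : Set ℝ := {q | ∃ f : H, f ≠ 0 ∧ HasLap θ₁ θ₂ f (q • f)}

theorem HasLap.inner_eq_zero {θ₁ θ₂ q r : ℝ} {f g : H} (hf : HasLap θ₁ θ₂ f (q • f))
    (hg : HasLap θ₁ θ₂ g (r • g)) (h : q ≠ r) : inner ℝ f g = 0 := by
  have := hf.symm hg
  rw [real_inner_smul_left, real_inner_smul_right] at this
  have h2 : (q - r) * inner ℝ f g = 0 := by linarith
  exact (mul_eq_zero.1 h2).resolve_left (sub_ne_zero.2 h)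

/-- The eigenvalues of a compact operator along an orthonormal sequence of eigenvectors are not
bounded away from zero. -/
theorem exists_abs_lt_of_orthonormal {E : Type*} [NormedAddCommGroup E] [InnerProductSpace ℝ E]
    {G : E →L[ℝ] E} (hG : IsCompactOperator G) {f : ℕ → E} (hf : Orthonormal ℝ f) {γ : ℕ → ℝ}
    (h : ∀ n, G (f n) = γ n • f n) {ε : ℝ} (hε : 0 < ε) : ∃ n, |γ n| < ε := by
  by_contra! hcon
  obtain ⟨K, hK, hsub⟩ := IsCompactOperator.image_closedBall_subset_compact (f := (G : E →ₗ[ℝ] E))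
    hG 1
  have hmem : ∀ n, G (f n) ∈ K := fun n => hsub ⟨f n, by simp [hf.1 n], rfl⟩
  obtain ⟨x, -, σ, hσ, hx⟩ := hK.tendsto_subseq hmem
  obtain ⟨N, hN⟩ := Metric.cauchySeq_iff'.1 hx.cauchySeq ε hε
  have h1 := hN (N + 1) (by simp)
  have hne : σ (N + 1) ≠ σ N := (hσ (Nat.lt_succ_self N)).ne'
  rw [dist_eq_norm] at h1
  -- By Pythagoras the images stay at distance at least `ε` from each other, so no subsequence is
  -- Cauchy.
  have h2 : ‖G (f (σ (N + 1))) - G (f (σ N))‖ ^ 2 = γ (σ (N + 1)) ^ 2 + γ (σ N) ^ 2 := by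
    rw [h, h, norm_sub_sq_real, real_inner_smul_left, real_inner_smul_right, hf.2 hne, norm_smul,
      norm_smul, hf.1, hf.1]
    simp
  have h3 : ε ^ 2 ≤ γ (σ (N + 1)) ^ 2 := by
    rw [← sq_abs (γ _)]
    exact pow_le_pow_left₀ hε.le (hcon _) 2
  have h4 : ‖G (f (σ (N + 1))) - G (f (σ N))‖ ^ 2 < ε ^ 2 := by
    have := h1
    simp only [Function.comp_apply] at this
    exact pow_lt_pow_left₀ this (norm_nonneg _) two_ne_zero
  nlinarith [sq_nonneg (γ (σ N))]

namespace IsResolvent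

variable {θ₁ θ₂ ω : ℝ} {G : H →L[ℝ] H}

theorem hasLap (hG : IsResolvent θ₁ θ₂ ω G)
    (f : H) : HasLap θ₁ θ₂ (G f) (ω ^ 2 • G f - f) := (hG.hasLap_iff f _).2 rfl

theorem apply_of_hasLap (hG : IsResolvent θ₁ θ₂ ω G)
    {g w : H} (h : HasLap θ₁ θ₂ g w) : G (ω ^ 2 • g - w) = g :=
  ((hG.hasLap_iff _ _).1 (by convert h using 1; abel)).symm

theorem isSymmetric (hG : IsResolvent θ₁ θ₂ ω G) : G.IsSymmetric := by
  intro f g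
  have := (hG.hasLap f).symm (hG.hasLap g)
  rw [inner_sub_left, inner_sub_right, real_inner_smul_left, real_inner_smul_right] at this
  have h : inner ℝ f (G g) = inner ℝ (G f) g := by linarith
  exact h.symm

theorem injective (hG : IsResolvent θ₁ θ₂ ω G) {f : H} (h : G f = 0) : f = 0 := by
  have h1 := hG.hasLap f
  have h2 := (hG.hasLap f).smul 0
  rw [h] at h1
  rw [zero_smul, zero_smul] at h2
  simpa using h1.unique h2

theorem lt_sq (hG : IsResolvent θ₁ θ₂ ω G)
    {q : ℝ} {f : H} (hf : HasLap θ₁ θ₂ f (q • f)) (h0 : f ≠ 0) : q < ω ^ 2 := by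
  by_contra! h
  exact h0 (hG.eq_zero q f h hf)

theorem apply_eigenvector (hG : IsResolvent θ₁ θ₂ ω G)
    {q : ℝ} {f : H} (hf : HasLap θ₁ θ₂ f (q • f)) (hq : q < ω ^ 2) :
    G f = (ω ^ 2 - q)⁻¹ • f := by
  have h := hG.apply_of_hasLap hf
  rw [← sub_smul, map_smul] at h
  nth_rewrite 2 [← h]
  rw [smul_smul, inv_mul_cancel₀ (sub_pos.2 hq).ne', one_smul]

theorem hasLap_of_apply_eq (hG : IsResolvent θ₁ θ₂ ω G)
    {γ : ℝ} {f : H} (hf : G f = γ • f) (h0 : f ≠ 0) :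
    HasLap θ₁ θ₂ f ((ω ^ 2 - γ⁻¹) • f) := by
  have hγ : γ ≠ 0 := by
    rintro rfl
    exact h0 (hG.injective (by simpa using hf))
  have := (hG.hasLap f).smul γ⁻¹
  rw [hf] at this
  convert this using 1
  · rw [smul_smul, inv_mul_cancel₀ hγ, one_smul]
  · rw [smul_sub, smul_comm, smul_smul γ⁻¹ γ, inv_mul_cancel₀ hγ, one_smul, sub_smul]

/-- Eigenvalues `q n ≥ t` would keep the eigenvalues `(ω² - q n)⁻¹` of the compact operator `G`
above `(ω² - t)⁻¹ > 0` along an orthonormal sequence. -/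
theorem exists_lt_of_orthonormal (hG : IsResolvent θ₁ θ₂ ω G)
    {f : ℕ → H} (hf : Orthonormal ℝ f) {q : ℕ → ℝ}
    (h : ∀ n, HasLap θ₁ θ₂ (f n) (q n • f n)) (t : ℝ) : ∃ n, q n < t := by
  by_contra! hcon
  have hlt : ∀ n, q n < ω ^ 2 := fun n => hG.lt_sq (h n) (hf.ne_zero n)
  have hpos : 0 < ω ^ 2 - t := by linarith [hcon 0, hlt 0]
  obtain ⟨n, hn⟩ := exists_abs_lt_of_orthonormal hG.compact hf
    (fun n => hG.apply_eigenvector (h n) (hlt n)) (inv_pos.2 hpos)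
  have h1 : 0 < ω ^ 2 - q n := by linarith [hlt n]
  rw [abs_of_pos (inv_pos.2 h1), inv_lt_inv₀ h1 hpos] at hn
  linarith [hcon n]

theorem finite_eigSet_inter (hG : IsResolvent θ₁ θ₂ ω G)
    (t : ℝ) : (eigSet θ₁ θ₂ ∩ Ici t).Finite := by
  by_contra hinf
  let q := Set.Infinite.natEmbedding _ hinf
  choose f h0 hf using fun n => (q n).2.1
  have hn : ∀ n, HasLap θ₁ θ₂ (‖f n‖⁻¹ • f n) ((q n : ℝ) • ‖f n‖⁻¹ • f n) := fun n => by
    rw [smul_comm]; exact (hf n).smul _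
  have ho : Orthonormal ℝ (fun n => ‖f n‖⁻¹ • f n) := by
    refine ⟨fun n => by rw [norm_smul, norm_inv, norm_norm, inv_mul_cancel₀ (norm_ne_zero_iff.2 (h0 n))],
      fun n m hnm => (hn n).inner_eq_zero (hn m) ?_⟩
    exact fun h => hnm (q.injective (Subtype.ext h))
  obtain ⟨n, hlt⟩ := hG.exists_lt_of_orthonormal ho hn t
  exact absurd (q n).2.2 (not_le.2 hlt)

/-- Completeness, from the spectral theorem for the compact symmetric operator `G`: each of its
eigenvectors is an eigenfunction of the Laplacian. -/
theorem orthogonal_eq_bot (hG : IsResolvent θ₁ θ₂ ω G) {M : Submodule ℝ H}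
    (hM : ∀ (q : ℝ) (f : H), f ≠ 0 → HasLap θ₁ θ₂ f (q • f) → f ∈ M) : Mᗮ = ⊥ := by
  rw [eq_bot_iff, ← ContinuousLinearMap.orthogonalComplement_iSup_eigenspaces_eq_bot hG.compact
    hG.isSymmetric]
  refine Submodule.orthogonal_le (iSup_le fun γ f hf => ?_)
  by_cases h0 : f = 0
  · rw [h0]; exact M.zero_mem
  · exact hM _ f h0 (hG.hasLap_of_apply_eq (Module.End.mem_eigenspace_iff.1 hf) h0)

/-- If there were finitely many eigenvalues, simplicity and completeness would make `H` the
finite-dimensional span of eigenfunctions, and every element would satisfy the boundary condition at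
`0`. The affine function with Cauchy data `(cos θ₁, -sin θ₁)` does not: its boundary value is `cos²
θ₁ + sin² θ₁`. -/
theorem infinite_eigSet (hG : IsResolvent θ₁ θ₂ ω G) : (eigSet θ₁ θ₂).Infinite := by
  intro hfin
  choose! f h0 hf using fun (q : ℝ) (hq : q ∈ eigSet θ₁ θ₂) => hq
  let M : Submodule ℝ H := Submodule.span ℝ (f '' eigSet θ₁ θ₂)
  have : FiniteDimensional ℝ M := FiniteDimensional.span_of_finite ℝ (hfin.image f)
  have hM : Mᗮ = ⊥ := hG.orthogonal_eq_bot fun q g hg hl => by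
    have hq : q ∈ eigSet θ₁ θ₂ := ⟨g, hg, hl⟩
    obtain ⟨r, rfl⟩ := (hf q hq).exists_eq_smul hl (h0 q hq)
    exact M.smul_mem r (Submodule.subset_span ⟨q, hq, rfl⟩)
  rw [Submodule.orthogonal_eq_bot_iff] at hM
  have hdom : ∀ g ∈ M, ∃ w, HasLap θ₁ θ₂ g w := by
    intro g hg
    induction hg using Submodule.span_induction with
    | mem x hx => obtain ⟨q, hq, rfl⟩ := hx; exact ⟨_, hf q hq⟩
    | zero => exact ⟨0, by simpa using (hG.hasLap 0).smul 0⟩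
    | add x y _ _ hx hy =>
      obtain ⟨w, hw⟩ := hx
      obtain ⟨v, hv⟩ := hy
      exact ⟨_, hw.add hv⟩
    | smul s x _ hx =>
      obtain ⟨w, hw⟩ := hx
      exact ⟨_, hw.smul s⟩
  let y : ℝ → ℝ := fun x => Real.cos θ₁ - Real.sin θ₁ * x
  have cy : Continuous y := by fun_prop
  let g : H := (memLp_of_continuousOn cy.continuousOn).toLp y
  have R : IsH2Rep g y (fun _ => -Real.sin θ₁) 0 := by
    refine isH2Rep_of_hasDerivAt (φ'' := fun _ => 0) (fun x => ?_) (fun x => hasDerivAt_const _ _)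
      continuous_const (toLp_congr _) (ae_Ioo_iff.1 (Lp.coeFn_zero ℝ 2 _))
    simpa using ((hasDerivAt_id x).const_mul (Real.sin θ₁)).const_sub (Real.cos θ₁)
  obtain ⟨w, φ, φ', R', b1, -⟩ := hdom g (by rw [hM]; trivial)
  obtain ⟨e1, e2, -⟩ := R'.unique R
  rw [e1 (by simp), e2 (by simp)] at b1
  have := Real.sin_sq_add_cos_sq θ₁
  simp only [y] at b1
  nlinarith

end IsResolvent

/-- An infinite set of reals with finitely many elements above each level is the range of a
strictly decreasing sequence. -/
theorem exists_strictAnti_range_eq {E : Set ℝ} (hE : E.Infinite)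
    (hfin : ∀ t, (E ∩ Ici t).Finite) : ∃ q : ℕ → ℝ, StrictAnti q ∧ range q = E := by
  classical
  obtain ⟨m, hm⟩ : ∃ m : E, ∀ y : E, (y : ℝ) ≤ m := by
    obtain ⟨x, hx⟩ := hE.nonempty
    obtain ⟨m, hm, hmax⟩ := Set.exists_max_image _ id (hfin x) ⟨x, hx, le_refl x⟩
    refine ⟨⟨m, hm.1⟩, fun y => ?_⟩
    rcases le_total x y with h | h
    · exact hmax y ⟨y.2, h⟩
    · exact h.trans hm.2
  -- With reversed order `E` has a least element, finite intervals and no greatest element, so it is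
  -- order isomorphic to `ℕ`.
  let : OrderBot (E)ᵒᵈ := { bot := OrderDual.toDual m, bot_le := fun y => hm (OrderDual.ofDual y) }
  let : LocallyFiniteOrder (E)ᵒᵈ := LocallyFiniteOrder.ofFiniteIcc fun s t => by
    have := (hfin (OrderDual.ofDual t : E)).preimage
      (f := fun y : (E)ᵒᵈ => ((OrderDual.ofDual y : E) : ℝ))
      (fun x _ y _ h => OrderDual.ofDual.injective (Subtype.ext h))
    exact this.subset fun y hy => ⟨(OrderDual.ofDual y).2, hy.2⟩
  let : SuccOrder (E)ᵒᵈ := LinearLocallyFiniteOrder.succOrder _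
  let : PredOrder (E)ᵒᵈ := LinearLocallyFiniteOrder.predOrder _
  have : NoMaxOrder (E)ᵒᵈ := ⟨fun s => by
    by_contra! h
    refine hE ((hfin (OrderDual.ofDual s : E)).subset fun y hy => ⟨hy, ?_⟩)
    exact h (OrderDual.toDual ⟨y, hy⟩)⟩
  let iso : (E)ᵒᵈ ≃o ℕ := orderIsoNatOfLinearSuccPredArch
  refine ⟨fun n => ((OrderDual.ofDual (iso.symm n) : E) : ℝ), fun n m hnm => ?_, ?_⟩
  · exact iso.symm.strictMono hnm
  · ext x
    constructor
    · rintro ⟨n, rfl⟩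
      exact (OrderDual.ofDual (iso.symm n)).2
    · intro hx
      exact ⟨iso (OrderDual.toDual ⟨x, hx⟩), by simp⟩

/-! ### The eigensystem of `𝒜₀ + c I` as a Hilbert basis -/

theorem hasLap_smul_iff {a b c θ₁ θ₂ : ℝ} (ha : 0 < a) {q : ℝ} {f : H} :
    HasLap θ₁ θ₂ f (q • f) ↔
      f ∈ domA₀ θ₁ θ₂ ∧ opA a b f + c • f = (a * q + b + c) • f := by
  rw [hasLap_iff]
  refine and_congr_right fun _ => ⟨fun h => ?_, fun h => ?_⟩
  · rw [opA, h]; module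
  · have : a • ((h2Data f).2.2 - q • f) = 0 := by
      rw [opA] at h
      have h' := sub_eq_zero.2 h
      rw [← h']; module
    rcases smul_eq_zero.1 this with h | h
    · exact absurd h ha.ne'
    · exact sub_eq_zero.1 h

theorem exists_isEigensystem (a b c θ₁ θ₂ : ℝ) (ha : 0 < a) :
    ∃ lam e, IsEigensystem a b c θ₁ θ₂ lam e := by
  obtain ⟨ω, G, hG⟩ := exists_isResolvent θ₁ θ₂
  obtain ⟨q, hq, hrange⟩ := exists_strictAnti_range_eq hG.infinite_eigSet hG.finite_eigSet_inter
  have hmem : ∀ n, q n ∈ eigSet θ₁ θ₂ := fun n => hrange ▸ mem_range_self n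
  choose f h0 hf using hmem
  have hn : ∀ n, HasLap θ₁ θ₂ (‖f n‖⁻¹ • f n) (q n • ‖f n‖⁻¹ • f n) := fun n => by
    rw [smul_comm]; exact (hf n).smul _
  refine ⟨fun n => a * q n + b + c, fun n => ‖f n‖⁻¹ • f n, ⟨fun n m hnm => ?_,
    fun n => ((hasLap_smul_iff (b := b) (c := c) ha).1 (hn n)).1, fun n => ?_,
    fun n => ((hasLap_smul_iff (b := b) (c := c) ha).1 (hn n)).2, fun μ g hg hg0 he => ?_⟩⟩
  · have := mul_lt_mul_of_pos_left (hq hnm) ha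
    show a * q m + b + c < a * q n + b + c
    linarith
  · rw [norm_smul, norm_inv, norm_norm, inv_mul_cancel₀ (norm_ne_zero_iff.2 (h0 n))]
  · have hμ : μ = a * ((μ - b - c) / a) + b + c := by field_simp; ring
    have : (μ - b - c) / a ∈ eigSet θ₁ θ₂ := by
      refine ⟨g, hg0, (hasLap_smul_iff (b := b) (c := c) ha).2 ⟨hg, ?_⟩⟩
      rw [he, ← hμ]
    rw [← hrange] at this
    obtain ⟨n, hn⟩ := this
    exact ⟨n, by simp only [hn]; exact hμ⟩

namespace IsEigensystem

variable {a b c θ₁ θ₂ : ℝ} {lam : ℕ → ℝ} {e : ℕ → H}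

theorem hasLap (he : IsEigensystem a b c θ₁ θ₂ lam e) (ha : 0 < a)
    (n : ℕ) : HasLap θ₁ θ₂ (e n) (((lam n - b - c) / a) • e n) := by
  refine (hasLap_smul_iff (b := b) (c := c) ha).2 ⟨he.mem_dom n, ?_⟩
  rw [he.eigen n]
  congr 1
  field_simp
  ring

theorem orthonormal (he : IsEigensystem a b c θ₁ θ₂ lam e) (ha : 0 < a) : Orthonormal ℝ e := by
  refine ⟨he.norm_eq_one, fun n m hnm => (he.hasLap ha n).inner_eq_zero (he.hasLap ha m) ?_⟩
  intro h
  apply hnm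
  apply he.strictAnti.injective
  field_simp at h
  linarith

theorem orthogonal_span_eq_bot (he : IsEigensystem a b c θ₁ θ₂ lam e) (ha : 0 < a)
    : (Submodule.span ℝ (range e))ᗮ = ⊥ := by
  obtain ⟨ω, G, hG⟩ := exists_isResolvent θ₁ θ₂
  refine hG.orthogonal_eq_bot fun q f h0 hf => ?_
  obtain ⟨h1, h2⟩ := (hasLap_smul_iff (b := b) (c := c) ha).1 hf
  obtain ⟨n, hn⟩ := he.exhaustive _ f h1 h0 h2
  have h3 := he.hasLap ha n
  have : (lam n - b - c) / a = q := by rw [← hn]; field_simp; ring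
  rw [this] at h3
  obtain ⟨r, rfl⟩ := h3.exists_eq_smul hf ((he.orthonormal ha).ne_zero n)
  exact Submodule.smul_mem _ r (Submodule.subset_span (mem_range_self n))

theorem exists_hilbertBasis (he : IsEigensystem a b c θ₁ θ₂ lam e) (ha : 0 < a)
    : ∃ B : HilbertBasis ℕ ℝ H, ⇑B = e :=
  ⟨HilbertBasis.mkOfOrthogonalEqBot (he.orthonormal ha) (he.orthogonal_span_eq_bot ha),
    HilbertBasis.coe_mkOfOrthogonalEqBot _ _⟩

/-- This is why an arbitrary decay rate is attainable with finitely many controlled modes. -/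
theorem exists_lam_lt (he : IsEigensystem a b c θ₁ θ₂ lam e) (ha : 0 < a)
    (t : ℝ) : ∃ n, lam n < t := by
  obtain ⟨ω, G, hG⟩ := exists_isResolvent θ₁ θ₂
  obtain ⟨n, hn⟩ := hG.exists_lt_of_orthonormal (he.orthonormal ha) (he.hasLap ha) ((t - b - c) / a)
  refine ⟨n, ?_⟩
  rw [div_lt_div_iff_of_pos_right ha] at hn
  linarith

end IsEigensystem

/-! ### Diagonal semigroups -/

section Diagonal

variable {E : Type*} [NormedAddCommGroup E] [InnerProductSpace ℝ E] (B : HilbertBasis ℕ ℝ E)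

theorem hilbertBasis_ext {x y : E} (h : ∀ n, inner ℝ (B n) x = inner ℝ (B n) y) : x = y := by
  apply B.repr.injective
  ext n
  rw [B.repr_apply_apply, B.repr_apply_apply, h]

theorem hasSum_sq_inner (x : E) : HasSum (fun n => inner ℝ (B n) x ^ 2) (‖x‖ ^ 2) := by
  have := B.hasSum_inner_mul_inner x x
  rw [real_inner_self_eq_norm_sq] at this
  have h : (fun n => inner ℝ (B n) x ^ 2) = fun n => inner ℝ x (B n) * inner ℝ (B n) x := by
    funext n
    rw [real_inner_comm (B n) x, sq]
  rw [h]
  exact this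

theorem exists_inner_eq {y : ℕ → ℝ} (hy : Summable fun n => y n ^ 2) :
    ∃ x : E, ∀ n, inner ℝ (B n) x = y n := by
  have hm : Memℓp y 2 := by
    refine (memℓp_gen_iff (by norm_num)).2 ?_
    simpa using hy
  refine ⟨B.repr.symm ⟨y, hm⟩, fun n => ?_⟩
  rw [← B.repr_apply_apply, LinearIsometryEquiv.apply_symm_apply]

/-- Bounded multipliers define bounded operators. -/
theorem exists_diagonal {m : ℕ → ℝ} {C : ℝ} (hC : ∀ n, |m n| ≤ C) :
    ∃ T : E →L[ℝ] E, (∀ x n, inner ℝ (B n) (T x) = m n * inner ℝ (B n) x) ∧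
      ∀ x, ‖T x‖ ≤ C * ‖x‖ := by
  have hC0 : 0 ≤ C := (abs_nonneg _).trans (hC 0)
  have bd : ∀ x n, (m n * inner ℝ (B n) x) ^ 2 ≤ C ^ 2 * inner ℝ (B n) x ^ 2 := fun x n => by
    rw [mul_pow]
    refine mul_le_mul_of_nonneg_right ?_ (sq_nonneg _)
    rw [← sq_abs (m n)]
    exact pow_le_pow_left₀ (abs_nonneg _) (hC n) 2
  have hs : ∀ x, Summable fun n => (m n * inner ℝ (B n) x) ^ 2 := fun x =>
    ((hasSum_sq_inner B x).summable.mul_left (C ^ 2)).of_nonneg_of_le (fun n => sq_nonneg _) (bd x)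
  choose T hT using fun x => exists_inner_eq B (hs x)
  have hb : ∀ x, ‖T x‖ ≤ C * ‖x‖ := fun x => by
    refine abs_le_of_sq_le_sq' ?_ (by positivity) |>.2
    rw [mul_pow]
    refine hasSum_le (fun n => ?_) (hasSum_sq_inner B (T x)) ((hasSum_sq_inner B x).mul_left (C ^ 2))
    rw [hT]
    exact bd x n
  let L : E →ₗ[ℝ] E :=
    { toFun := T
      map_add' := fun x y => hilbertBasis_ext B fun n => by
        rw [inner_add_right, hT, hT, hT, inner_add_right]; ring
      map_smul' := fun s x => hilbertBasis_ext B fun n => by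
        rw [RingHom.id_apply, inner_smul_right, hT, hT, inner_smul_right]; ring }
  exact ⟨L.mkContinuous C hb, hT, hb⟩

/-- `D t` acts on the `n`-th coordinate as multiplication by `exp (ν n * t)` for `t ≥ 0`, and
`D t = 1` for `t ≤ 0`. -/
structure IsDiagSemigroup (ν : ℕ → ℝ) (w : ℝ) (D : ℝ → E →L[ℝ] E) : Prop where
  inner_apply : ∀ t x n, inner ℝ (B n) (D t x) = Real.exp (ν n * max t 0) * inner ℝ (B n) x
  norm_apply_le : ∀ t x, ‖D t x‖ ≤ Real.exp (w * max t 0) * ‖x‖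

theorem exists_isDiagSemigroup {ν : ℕ → ℝ} {w : ℝ} (h : ∀ n, ν n ≤ w) :
    ∃ D, IsDiagSemigroup B ν w D := by
  have : ∀ t : ℝ, ∀ n, |Real.exp (ν n * max t 0)| ≤ Real.exp (w * max t 0) := fun t n => by
    rw [abs_of_pos (Real.exp_pos _)]
    gcongr
    exact h n
  choose D h1 h2 using fun t => exists_diagonal B (this t)
  exact ⟨D, ⟨h1, h2⟩⟩

namespace IsDiagSemigroup

variable {B} {ν : ℕ → ℝ} {w : ℝ} {D : ℝ → E →L[ℝ] E}

/-- Parseval's identity and dominated convergence for series: the multipliers are bounded uniformly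
in `n` for `t` near `t₀` because the rates are bounded above. -/
theorem continuous_apply (hD : IsDiagSemigroup B ν w D)
    (h : ∀ n, ν n ≤ w) (x : E) : Continuous fun t => D t x := by
  refine continuous_iff_continuousAt.2 fun t₀ => ?_
  rw [ContinuousAt, tendsto_iff_norm_sub_tendsto_zero]
  set M : ℝ := Real.exp (|w| * (|t₀| + 1)) with hM
  have hMb : ∀ t, |t| ≤ |t₀| + 1 → ∀ n, Real.exp (ν n * max t 0) ≤ M := fun t ht n => by
    refine Real.exp_le_exp.2 ?_
    have h1 : max t 0 ≤ |t₀| + 1 := max_le ((le_abs_self t).trans ht) (by positivity)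
    calc ν n * max t 0 ≤ |w| * max t 0 := by
          gcongr
          exact (h n).trans (le_abs_self w)
      _ ≤ |w| * (|t₀| + 1) := by gcongr
  have key : Tendsto (fun t => ‖D t x - D t₀ x‖ ^ 2) (𝓝 t₀) (𝓝 0) := by
    have e : ∀ t, ‖D t x - D t₀ x‖ ^ 2 = ∑' n,
        ((Real.exp (ν n * max t 0) - Real.exp (ν n * max t₀ 0)) * inner ℝ (B n) x) ^ 2 := fun t => by
      rw [← (hasSum_sq_inner B _).tsum_eq]
      refine tsum_congr fun n => ?_
      rw [inner_sub_right, hD.inner_apply, hD.inner_apply]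
      ring
    simp_rw [e]
    have := tendsto_tsum_of_dominated_convergence (𝓕 := 𝓝 t₀) (g := fun _ : ℕ => (0 : ℝ))
      (f := fun t n =>
        ((Real.exp (ν n * max t 0) - Real.exp (ν n * max t₀ 0)) * inner ℝ (B n) x) ^ 2)
      (bound := fun n => M ^ 2 * inner ℝ (B n) x ^ 2)
      ((hasSum_sq_inner B x).summable.mul_left _) (fun n => ?_) ?_
    · simpa using this
    · have hc : Continuous fun t : ℝ =>
          ((Real.exp (ν n * max t 0) - Real.exp (ν n * max t₀ 0)) * inner ℝ (B n) x) ^ 2 := by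
        fun_prop
      simpa using hc.tendsto t₀
    · filter_upwards [Metric.ball_mem_nhds t₀ one_pos] with t ht n
      have ht' : |t| ≤ |t₀| + 1 := by
        rw [Metric.mem_ball, Real.dist_eq] at ht
        have := abs_add_le (t - t₀) t₀
        rw [sub_add_cancel] at this
        linarith
      rw [Real.norm_of_nonneg (sq_nonneg _), mul_pow]
      refine mul_le_mul_of_nonneg_right (sq_le_sq' ?_ ?_) (sq_nonneg _)
      · linarith [hMb t₀ (by linarith) n, Real.exp_pos (ν n * max t 0)]
      · linarith [hMb t ht' n, Real.exp_pos (ν n * max t₀ 0)]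
  have h2 := key.sqrt
  simpa using h2

/-- Joint continuity makes `s ↦ D (t - s) (F s)` measurable in Duhamel's integral. -/
theorem continuous_uncurry (hD : IsDiagSemigroup B ν w D)
    (h : ∀ n, ν n ≤ w) : Continuous fun p : ℝ × E => D p.1 p.2 := by
  refine continuous_iff_continuousAt.2 fun ⟨t₀, x₀⟩ => ?_
  rw [ContinuousAt, tendsto_iff_norm_sub_tendsto_zero]
  have h1 : Tendsto (fun p : ℝ × E => Real.exp (w * max p.1 0) * ‖p.2 - x₀‖ +
      ‖D p.1 x₀ - D t₀ x₀‖) (𝓝 (t₀, x₀)) (𝓝 0) := by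
    have c1 : Continuous fun p : ℝ × E => Real.exp (w * max p.1 0) * ‖p.2 - x₀‖ +
        ‖D p.1 x₀ - D t₀ x₀‖ := by
      have h2 : Continuous fun p : ℝ × E => D p.1 x₀ :=
        (hD.continuous_apply h x₀).comp continuous_fst
      exact (by fun_prop : Continuous fun p : ℝ × E => Real.exp (w * max p.1 0) * ‖p.2 - x₀‖).add
        (h2.sub continuous_const).norm
    simpa using c1.tendsto (t₀, x₀)
  refine squeeze_zero (fun _ => norm_nonneg _) (fun p => ?_) h1
  calc ‖D p.1 p.2 - D t₀ x₀‖ = ‖D p.1 (p.2 - x₀) + (D p.1 x₀ - D t₀ x₀)‖ := by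
        rw [map_sub]; congr 1; abel
    _ ≤ _ := (norm_add_le _ _).trans (by gcongr; exact hD.norm_apply_le _ _)

theorem zero (hD : IsDiagSemigroup B ν w D) : D 0 = ContinuousLinearMap.id ℝ E := by
  ext x
  refine hilbertBasis_ext B fun n => ?_
  rw [hD.inner_apply]
  simp

theorem add (hD : IsDiagSemigroup B ν w D)
    {s t : ℝ} (hs : 0 ≤ s) (ht : 0 ≤ t) : D (s + t) = (D s).comp (D t) := by
  ext x
  refine hilbertBasis_ext B fun n => ?_
  rw [ContinuousLinearMap.comp_apply, hD.inner_apply, hD.inner_apply, hD.inner_apply,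
    max_eq_left hs, max_eq_left ht, max_eq_left (add_nonneg hs ht), mul_add, Real.exp_add]
  ring

theorem apply_basis (hD : IsDiagSemigroup B ν w D)
    {t : ℝ} (ht : 0 ≤ t) (n : ℕ) : D t (B n) = Real.exp (ν n * t) • B n := by
  refine hilbertBasis_ext B fun m => ?_
  rw [hD.inner_apply, inner_smul_right, max_eq_left ht]
  by_cases h : m = n
  · rw [h]
  · rw [B.orthonormal.2 h]; simp

/-- The generator of a diagonal semigroup acts diagonally. -/
theorem tendsto_generator_iff (hD : IsDiagSemigroup B ν w D)
    [CompleteSpace E] (h : ∀ n, ν n ≤ w) (f g : E) :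
    Tendsto (fun t : ℝ => t⁻¹ • (D t f - f)) (𝓝[>] 0) (𝓝 g) ↔
      ∀ n, inner ℝ (B n) g = ν n * inner ℝ (B n) f := by
  have hexp : ∀ (r t : ℝ), HasDerivAt (fun s => Real.exp (r * s)) (r * Real.exp (r * t)) t :=
    fun r t => by
      have : HasDerivAt (fun s : ℝ => r * s) r t := by simpa using (hasDerivAt_id t).const_mul r
      simpa [mul_comm] using this.exp
  constructor
  · intro hlim n
    have h1 : Tendsto (fun t : ℝ => inner ℝ (B n) (t⁻¹ • (D t f - f))) (𝓝[>] 0)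
        (𝓝 (inner ℝ (B n) g)) := tendsto_const_nhds.inner hlim
    have h2 : Tendsto (fun t : ℝ => inner ℝ (B n) (t⁻¹ • (D t f - f))) (𝓝[>] 0)
        (𝓝 (ν n * inner ℝ (B n) f)) := by
      have hd := (hexp (ν n) 0).hasDerivWithinAt (s := Ioi 0)
      rw [hasDerivWithinAt_iff_tendsto_slope' (by simp)] at hd
      simp only [mul_zero, Real.exp_zero, mul_one] at hd
      refine (hd.mul_const (inner ℝ (B n) f)).congr' ?_
      filter_upwards [self_mem_nhdsWithin] with t ht
      rw [inner_smul_right, inner_sub_right, hD.inner_apply, max_eq_left (le_of_lt ht), slope_def_field]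
      simp
      ring
    exact tendsto_nhds_unique h1 h2
  · intro hfg
    have hc := hD.continuous_apply h g
    -- The identity is checked coordinate by coordinate; the fundamental theorem of calculus then
    -- gives the limit of the difference quotients.
    have e : ∀ t, 0 < t → D t f - f = ∫ s in (0 : ℝ)..t, D s g := by
      intro t ht
      refine hilbertBasis_ext B fun n => ?_
      have := (innerSL ℝ (B n)).intervalIntegral_comp_comm (hc.intervalIntegrable (μ := volume) 0 t)
      simp only [innerSL_apply_apply] at this
      rw [← this, inner_sub_right, hD.inner_apply, max_eq_left ht.le]
      have e2 : ∫ s in (0 : ℝ)..t, inner ℝ (B n) (D s g) =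
          ∫ s in (0 : ℝ)..t, (ν n * Real.exp (ν n * s)) * inner ℝ (B n) f := by
        refine intervalIntegral.integral_congr fun s hs => ?_
        rw [uIcc_of_le ht.le] at hs
        simp only [hD.inner_apply, max_eq_left hs.1, hfg n]
        ring
      rw [e2, intervalIntegral.integral_mul_const,
        intervalIntegral.integral_eq_sub_of_hasDerivAt (fun s _ => hexp (ν n) s)
          (Continuous.intervalIntegrable (by fun_prop) _ _)]
      simp
      ring
    have hd := ((hc.integral_hasStrictDerivAt 0 0).hasDerivAt).hasDerivWithinAt (s := Ioi 0)
    rw [hasDerivWithinAt_iff_tendsto_slope' (by simp), hD.zero] at hd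
    refine Tendsto.congr' ?_ hd
    filter_upwards [self_mem_nhdsWithin] with t ht
    rw [e t ht]
    simp [slope]

end IsDiagSemigroup

end Diagonal

/-! ### The semigroup generated by `𝒜₀` -/

namespace IsEigensystem

variable {a b c θ₁ θ₂ : ℝ} {lam : ℕ → ℝ} {e : ℕ → H}

theorem sub_le (he : IsEigensystem a b c θ₁ θ₂ lam e) (n : ℕ) : lam n - c ≤ lam 0 - c :=
  sub_le_sub_right (he.strictAnti.antitone (Nat.zero_le n)) c

/-- Symmetry gives the coordinates of `𝒜₀ f`. Conversely, comparing coordinates shows `f = G (ω² f -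
v)`, and the range of the resolvent lies in the domain. The diagonal operator thus has exactly the
domain of `𝒜₀`. -/
theorem hasLap_iff (he : IsEigensystem a b c θ₁ θ₂ lam e) (ha : 0 < a)
    {B : HilbertBasis ℕ ℝ H} (hB : ⇑B = e) (f g : H) :
    (f ∈ domA₀ θ₁ θ₂ ∧ g = opA a b f) ↔
      ∀ n, inner ℝ (B n) g = (lam n - c) * inner ℝ (B n) f := by
  obtain ⟨ω, G, hG⟩ := exists_isResolvent θ₁ θ₂
  rw [hB]
  constructor
  · rintro ⟨h1, rfl⟩ n
    have h2 : HasLap θ₁ θ₂ f (h2Data f).2.2 := DelayRD.hasLap_iff.2 ⟨h1, rfl⟩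
    have h3 := (he.hasLap ha n).symm h2
    rw [opA, inner_add_right, inner_smul_right, inner_smul_right, ← h3, real_inner_smul_left]
    field_simp
    ring
  · intro h
    set v : H := a⁻¹ • (g - b • f) with hv
    have hv' : ∀ n, inner ℝ (e n) v = (lam n - b - c) / a * inner ℝ (e n) f := fun n => by
      rw [hv, inner_smul_right, inner_sub_right, inner_smul_right, h n]
      field_simp
      ring
    have hf : f = G (ω ^ 2 • f - v) := by
      refine hilbertBasis_ext B fun n => ?_
      have hlt := hG.lt_sq (he.hasLap ha n) ((he.orthonormal ha).ne_zero n)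
      have h1 := hG.isSymmetric (e n) (ω ^ 2 • f - v)
      have h2 := hG.apply_eigenvector (he.hasLap ha n) hlt
      rw [hB]
      simp only [ContinuousLinearMap.coe_coe] at h1
      rw [← h1, h2, real_inner_smul_left, inner_sub_right, inner_smul_right, hv', ← sub_mul,
        ← mul_assoc, inv_mul_cancel₀ (sub_pos.2 hlt).ne', one_mul]
    have hl : HasLap θ₁ θ₂ f v := by
      have := (hG.hasLap_iff (ω ^ 2 • f - v) f).2 hf
      rwa [sub_sub_cancel] at this
    obtain ⟨h1, h2⟩ := DelayRD.hasLap_iff.1 hl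
    refine ⟨h1, ?_⟩
    rw [opA, h2, hv, smul_smul, mul_inv_cancel₀ ha.ne', one_smul, sub_add_cancel]

theorem isGeneratedByA₀ (he : IsEigensystem a b c θ₁ θ₂ lam e) (ha : 0 < a)
    {B : HilbertBasis ℕ ℝ H} (hB : ⇑B = e) {D : ℝ → H →L[ℝ] H}
    (hD : IsDiagSemigroup B (fun n => lam n - c) (lam 0 - c) D) :
    IsGeneratedByA₀ a b θ₁ θ₂ D := by
  refine ⟨⟨hD.zero, fun s t hs ht => hD.add hs ht, fun x => ?_⟩, fun f g => ?_⟩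
  · have := (hD.continuous_apply he.sub_le x).tendsto 0
    rw [hD.zero] at this
    exact this.mono_left nhdsWithin_le_nhds
  · rw [hD.tendsto_generator_iff he.sub_le, he.hasLap_iff ha hB]

end IsEigensystem

/-! ### Continuity of orbits and identification of the semigroup -/

theorem IsC0Semigroup.tendsto_nhdsGE {S : ℝ → H →L[ℝ] H} (hS : IsC0Semigroup S) (x : H) :
    Tendsto (fun s => S s x) (𝓝[≥] 0) (𝓝 x) := by
  have h1 : ContinuousWithinAt (fun s => S s x) (Ioi 0) 0 := by
    have := hS.strongly_continuous x
    rw [ContinuousWithinAt, hS.zero]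
    exact this
  have := continuousWithinAt_insert_self.2 h1
  rw [Ioi_insert, ContinuousWithinAt, hS.zero] at this
  exact this

/-- A `C₀`-semigroup is bounded near `0`. -/
theorem IsC0Semigroup.exists_norm_le {S : ℝ → H →L[ℝ] H} (hS : IsC0Semigroup S) :
    ∃ δ > 0, ∃ M, ∀ t ∈ Icc 0 δ, ‖S t‖ ≤ M := by
  by_contra! hcon
  choose t ht hbig using fun n : ℕ => hcon (1 / ((n : ℝ) + 1)) (by positivity) n
  have hlim : Tendsto t atTop (𝓝[≥] 0) := by
    refine tendsto_nhdsWithin_iff.2 ⟨squeeze_zero (fun n => (ht n).1) (fun n => (ht n).2)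
      tendsto_one_div_add_atTop_nhds_zero_nat, Eventually.of_forall fun n => (ht n).1⟩
  obtain ⟨C, hC⟩ := banach_steinhaus (g := fun n => S (t n)) fun x => by
    obtain ⟨C, hC⟩ := ((hS.tendsto_nhdsGE x).comp hlim).norm.bddAbove_range
    exact ⟨C, fun n => hC ⟨n, rfl⟩⟩
  obtain ⟨n, hn⟩ := exists_nat_gt C
  linarith [hC n, hbig n]

/-- The orbits of a `C₀`-semigroup are continuous. -/
theorem IsC0Semigroup.continuousOn {S : ℝ → H →L[ℝ] H} (hS : IsC0Semigroup S) (x : H) :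
    ContinuousOn (fun t => S t x) (Ici 0) := by
  obtain ⟨δ, hδ, M, hM⟩ := hS.exists_norm_le
  intro t ht
  rw [mem_Ici] at ht
  -- For left limits the norms just before `t` must be bounded; factor out `S (t - δ)`. Both
  -- one-sided differences are then `S (min s t)` applied to `S |s - t| x - x`, up to sign.
  obtain ⟨C, hC⟩ : ∃ C, ∀ s, 0 ≤ s → s ≤ t → t - δ ≤ s → ‖S s‖ ≤ C := by
    by_cases htδ : t ≤ δ
    · exact ⟨M, fun s h0 h1 _ => hM s ⟨h0, h1.trans htδ⟩⟩
    · push Not at htδ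
      refine ⟨‖S (t - δ)‖ * M, fun s h0 h1 h2 => ?_⟩
      have : S s = (S (t - δ)).comp (S (s - (t - δ))) := by
        rw [← hS.add _ _ (by linarith) (by linarith)]
        congr 1; ring
      rw [this]
      refine (ContinuousLinearMap.opNorm_comp_le _ _).trans ?_
      gcongr
      exact hM _ ⟨by linarith, by linarith⟩
  have hC0 : 0 ≤ C := (norm_nonneg _).trans (hC t ht le_rfl (by linarith))
  rw [ContinuousWithinAt, tendsto_iff_norm_sub_tendsto_zero]
  have habs : Tendsto (fun s => |s - t|) (𝓝[Ici 0] t) (𝓝[≥] 0) := by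
    refine tendsto_nhdsWithin_iff.2 ⟨?_, Eventually.of_forall fun s => mem_Ici.2 (abs_nonneg _)⟩
    have : Continuous fun s : ℝ => |s - t| := by fun_prop
    simpa using (this.tendsto t).mono_left nhdsWithin_le_nhds
  have hlim : Tendsto (fun s => C * ‖S |s - t| x - x‖) (𝓝[Ici 0] t) (𝓝 0) := by
    simpa using (tendsto_iff_norm_sub_tendsto_zero.1 ((hS.tendsto_nhdsGE x).comp habs)).const_mul C
  refine squeeze_zero' (Eventually.of_forall fun _ => norm_nonneg _) ?_ hlim
  filter_upwards [self_mem_nhdsWithin, nhdsWithin_le_nhds (Ioi_mem_nhds (sub_lt_self t hδ))]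
    with s hs hs'
  have hs : 0 ≤ s := hs
  have hs' : t - δ < s := hs'
  rcases le_total s t with h | h
  · have e : S t x = S s (S |s - t| x) := by
      rw [abs_sub_comm, abs_of_nonneg (sub_nonneg.2 h), ← ContinuousLinearMap.comp_apply,
        ← hS.add _ _ hs (by linarith)]
      congr 2; ring
    rw [norm_sub_rev, e, ← map_sub]
    exact (S s).le_of_opNorm_le (hC s hs h hs'.le) _
  · have e : S s x = S t (S |s - t| x) := by
      rw [abs_of_nonneg (sub_nonneg.2 h), ← ContinuousLinearMap.comp_apply,
        ← hS.add _ _ ht (by linarith)]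
      congr 2; ring
    rw [e, ← map_sub]
    exact (S t).le_of_opNorm_le (hC t ht le_rfl (by linarith)) _

/-- On eigenvectors, the semigroup acts by exponentials. -/
theorem IsGeneratedByA₀.apply_eigenvector {a b θ₁ θ₂ : ℝ} {S : ℝ → H →L[ℝ] H}
    (hS : IsGeneratedByA₀ a b θ₁ θ₂ S) {f : H} (hf : f ∈ domA₀ θ₁ θ₂) {r : ℝ}
    (hr : opA a b f = r • f) {t : ℝ} (ht : 0 ≤ t) : S t f = Real.exp (r * t) • f := by
  have hlim := (hS.2 f (r • f)).2 ⟨hf, hr.symm⟩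
  have hexp : ∀ s : ℝ, HasDerivAt (fun s => Real.exp (r * s) • f) (r • Real.exp (r * s) • f) s :=
    fun s => by
      have : HasDerivAt (fun s : ℝ => r * s) r s := by simpa using (hasDerivAt_id s).const_mul r
      refine (this.exp.smul_const f).congr_deriv ?_
      rw [smul_smul, mul_comm]
  -- Both curves solve `x' = r x` from `f`. For the orbit, the right derivative is the generator's
  -- limit at `0` pushed through `S s`.
  have key : EqOn (fun s => S s f) (fun s => Real.exp (r * s) • f) (Icc 0 t) := by
    refine ODE_solution_unique_of_mem_Icc_right (v := fun _ x => r • x) (s := fun _ => univ)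
      (K := ‖r‖₊) (fun s _ => (lipschitzWith_smul r).lipschitzOnWith)
      ((hS.1.continuousOn f).mono Icc_subset_Ici_self) (fun s hs => ?_)
      (fun _ _ => mem_univ _)
      (fun s _ => (hexp s).continuousAt.continuousWithinAt)
      (fun s _ => (hexp s).hasDerivWithinAt) (fun _ _ => mem_univ _) ?_
    · rw [← hasDerivWithinAt_Ioi_iff_Ici, hasDerivWithinAt_iff_tendsto_slope' (by simp)]
      have h1 : Tendsto (fun x => x - s) (𝓝[>] s) (𝓝[>] 0) := by
        refine tendsto_nhdsWithin_iff.2 ⟨?_, ?_⟩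
        · have : Continuous fun x : ℝ => x - s := by fun_prop
          simpa using (this.tendsto s).mono_left nhdsWithin_le_nhds
        · filter_upwards [self_mem_nhdsWithin] with x hx using mem_Ioi.2 (sub_pos.2 (mem_Ioi.1 hx))
      have h2 := ((S s).continuous.tendsto (r • f)).comp (hlim.comp h1)
      rw [map_smul] at h2
      refine h2.congr' ?_
      filter_upwards [self_mem_nhdsWithin] with x hx
      have hx : s < x := hx
      have e : S x f = S s (S (x - s) f) := by
        rw [← ContinuousLinearMap.comp_apply, ← hS.1.add _ _ hs.1 (by linarith)]
        congr 2; ring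
      simp only [Function.comp_apply, map_smul, map_sub, slope, vsub_eq_sub, e]
    · simp [hS.1.zero]
  exact key ⟨ht, le_rfl⟩

/-- Bounded operators that agree on a Hilbert basis coincide, so any semigroup generated by `𝒜₀` may
be replaced by the diagonal one. -/
theorem IsGeneratedByA₀.eq_diagonal {a b c θ₁ θ₂ : ℝ} {S : ℝ → H →L[ℝ] H}
    (hS : IsGeneratedByA₀ a b θ₁ θ₂ S) {lam : ℕ → ℝ} {e : ℕ → H}
    (he : IsEigensystem a b c θ₁ θ₂ lam e) {B : HilbertBasis ℕ ℝ H} (hB : ⇑B = e) {w : ℝ}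
    {D : ℝ → H →L[ℝ] H} (hD : IsDiagSemigroup B (fun n => lam n - c) w D) {t : ℝ} (ht : 0 ≤ t) :
    S t = D t := by
  refine ContinuousLinearMap.ext_on (s := range B)
    (Submodule.dense_iff_topologicalClosure_eq_top.2 B.dense_span) ?_
  rintro _ ⟨n, rfl⟩
  rw [hD.apply_basis ht, hB]
  refine hS.apply_eigenvector (he.mem_dom n) ?_ ht
  rw [sub_smul, ← he.eigen n, add_sub_cancel_right]

/-! ### Variation of constants -/

theorem IsPrim.exp_mul {y q : ℝ → ℝ} {T : ℝ} (hy : IsPrim y q T) (hT : 0 ≤ T) (r : ℝ) :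
    IsPrim (fun t => Real.exp (r * t) * y t)
      (fun t => r * Real.exp (r * t) * y t + Real.exp (r * t) * q t) T := by
  refine IsPrim.mul (IsPrim.of_hasDerivAt (fun x => ?_) (by fun_prop)) hy hT
  have : HasDerivAt (fun s : ℝ => r * s) r x := by simpa using (hasDerivAt_id x).const_mul r
  simpa [mul_comm] using this.exp

theorem exp_mul_integral (r t : ℝ) (g : ℝ → ℝ) :
    ∫ s in (0 : ℝ)..t, Real.exp (r * (t - s)) * g s =
      Real.exp (r * t) * ∫ s in (0 : ℝ)..t, Real.exp (-r * s) * g s := by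
  rw [← intervalIntegral.integral_const_mul]
  refine intervalIntegral.integral_congr fun s _ => ?_
  rw [← mul_assoc, ← Real.exp_add]
  congr 2
  ring

/-- Variation of constants for a scalar linear equation. -/
theorem duhamel_iff_isPrim {y g : ℝ → ℝ} {r T : ℝ} (hT : 0 ≤ T)
    (hg : IntervalIntegrable g volume 0 T) :
    (∀ t ∈ Icc 0 T, y t = Real.exp (r * t) * y 0 + ∫ s in (0 : ℝ)..t, Real.exp (r * (t - s)) * g s) ↔
      IsPrim y (fun s => r * y s + g s) T := by
  have e0 : ∀ t, Real.exp (r * t) * Real.exp (-r * t) = 1 := fun t => by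
    rw [← Real.exp_add]; simp
  constructor
  · intro h
    -- Integrating factor.
    have hw : IsPrim (fun t => Real.exp (-r * t) * y t) (fun s => Real.exp (-r * s) * g s) T := by
      refine ⟨hg.continuousOn_mul (by fun_prop), fun t ht => ?_⟩
      simp only [mul_zero, Real.exp_zero, one_mul]
      rw [h t ht, exp_mul_integral, mul_add, ← mul_assoc, ← mul_assoc, mul_comm (Real.exp (-r * t)),
        e0, one_mul, one_mul]
    have h2 := ((hw.exp_mul hT r).congr_left (G := y) fun t _ => ?_).congr_right hT
      (r := fun s => r * y s + g s) (ae_of_all _ fun t _ => ?_)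
    · exact h2
    · rw [← mul_assoc, e0, one_mul]
    · linear_combination (r * y t + g t) * e0 t
  · intro h t ht
    have hw := (h.exp_mul hT (-r)).congr_right hT (r := fun s => Real.exp (-r * s) * g s)
      (ae_of_all _ fun t _ => by ring)
    have h2 := hw.2 t ht
    simp only [mul_zero, Real.exp_zero, one_mul] at h2
    rw [exp_mul_integral, ← mul_add, ← h2, ← mul_assoc, e0, one_mul]

section Mild

variable {E : Type*} [NormedAddCommGroup E] [InnerProductSpace ℝ E]
  {B : HilbertBasis ℕ ℝ E} {ν : ℕ → ℝ} {w : ℝ} {D : ℝ → E →L[ℝ] E}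

theorem IsDiagSemigroup.norm_apply_le_of_le (hD : IsDiagSemigroup B ν w D) {s T : ℝ} (hs : s ≤ T)
    (hT : 0 ≤ T) (x : E) : ‖D s x‖ ≤ Real.exp (|w| * T) * ‖x‖ := by
  refine (hD.norm_apply_le s x).trans ?_
  gcongr
  · exact le_abs_self w
  · exact max_le hs hT

theorem IsDiagSemigroup.aestronglyMeasurable (hD : IsDiagSemigroup B ν w D) (hν : ∀ n, ν n ≤ w)
    {F : ℝ → E} {μ : Measure ℝ} (hF : AEStronglyMeasurable F μ) (t : ℝ) :
    AEStronglyMeasurable (fun s => D (t - s) (F s)) μ :=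
  (hD.continuous_uncurry hν).comp_aestronglyMeasurable
    ((by fun_prop : Continuous fun s : ℝ => t - s).aestronglyMeasurable.prodMk hF)

theorem IsDiagSemigroup.intervalIntegrable (hD : IsDiagSemigroup B ν w D) (hν : ∀ n, ν n ≤ w)
    {F : ℝ → E} {t : ℝ} (ht : 0 ≤ t) (hF : IntervalIntegrable F volume 0 t) :
    IntervalIntegrable (fun s => D (t - s) (F s)) volume 0 t := by
  refine (hF.norm.const_mul (Real.exp (|w| * t))).mono_fun
    (hD.aestronglyMeasurable hν hF.def'.aestronglyMeasurable t) ?_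
  refine (ae_restrict_iff' measurableSet_uIoc).2 (ae_of_all _ fun s hs => ?_)
  rw [uIoc_of_le ht] at hs
  have : ‖Real.exp (|w| * t) * ‖F s‖‖ = Real.exp (|w| * t) * ‖F s‖ :=
    Real.norm_of_nonneg (by positivity)
  simp only [this]
  exact hD.norm_apply_le_of_le (by linarith [hs.1]) ht _

theorem intervalIntegrable_inner {F : ℝ → E} {s t : ℝ} (hF : IntervalIntegrable F volume s t)
    (x : E) : IntervalIntegrable (fun s => inner ℝ x (F s)) volume s t :=
  ⟨hF.1.const_inner x, hF.2.const_inner x⟩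

/-- Over a fixed interval, with the upper limit moved into an indicator, dominated convergence
applies; the integrand is continuous in `t` at `t₀` except for `s = t₀`, a null set. -/
theorem IsDiagSemigroup.continuousOn_duhamel (hD : IsDiagSemigroup B ν w D) (hν : ∀ n, ν n ≤ w)
    {F : ℝ → E} (hF : ∀ T, 0 ≤ T → IntervalIntegrable F volume 0 T) :
    ContinuousOn (fun t => ∫ s in (0 : ℝ)..t, D (t - s) (F s)) (Ici 0) := by
  have key : ∀ T, 0 ≤ T → ContinuousOn (fun t => ∫ s in (0 : ℝ)..t, D (t - s) (F s)) (Icc 0 T) := by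
    intro T hT
    have hFT := hF T hT
    have e : EqOn (fun t => ∫ s in (0 : ℝ)..t, D (t - s) (F s))
        (fun t => ∫ s in Ioc 0 T, (Iic t).indicator (fun s => D (t - s) (F s)) s) (Icc 0 T) := by
      intro t ht
      simp only []
      rw [intervalIntegral.integral_of_le ht.1, setIntegral_indicator measurableSet_Iic]
      congr 2
      ext s
      simp only [mem_Ioc, mem_inter_iff, mem_Iic]
      exact ⟨fun h => ⟨⟨h.1, h.2.trans ht.2⟩, h.2⟩, fun h => ⟨h.1.1, h.2⟩⟩
    refine ContinuousOn.congr ?_ e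
    intro t₀ ht₀
    have hFm : AEStronglyMeasurable F (volume.restrict (Ioc 0 T)) := by
      have := hFT.def'.aestronglyMeasurable
      rwa [uIoc_of_le hT] at this
    refine continuousWithinAt_of_dominated (bound := fun s => Real.exp (|w| * T) * ‖F s‖) ?_ ?_ ?_ ?_
    · exact Eventually.of_forall fun t =>
        (hD.aestronglyMeasurable hν hFm t).indicator measurableSet_Iic
    · filter_upwards [self_mem_nhdsWithin] with t ht
      refine (ae_restrict_iff' measurableSet_Ioc).2 (ae_of_all _ fun s hs => ?_)
      refine (norm_indicator_le_norm_self _ _).trans ?_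
      exact hD.norm_apply_le_of_le (by linarith [hs.1, ht.2]) hT _
    · rw [intervalIntegrable_iff_integrableOn_Ioc_of_le hT] at hFT
      exact hFT.norm.const_mul _
    · filter_upwards [ae_restrict_of_ae (compl_mem_ae_iff.2 (measure_singleton t₀))] with s hs
      have hc : Continuous fun t : ℝ => D (t - s) (F s) :=
        (hD.continuous_apply hν (F s)).comp (by fun_prop)
      rcases lt_or_gt_of_ne (show s ≠ t₀ from hs) with h | h
      · refine (hc.continuousAt.congr ?_).continuousWithinAt
        filter_upwards [Ioi_mem_nhds h] with t ht
        exact (indicator_of_mem (mem_Iic.2 (mem_Ioi.1 ht).le) (fun s => D (t - s) (F s))).symm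
      · refine ((continuousAt_const (y := (0 : E))).congr ?_).continuousWithinAt
        filter_upwards [Iio_mem_nhds h] with t ht
        exact (indicator_of_notMem (s := Iic t) (a := s)
          (fun h' => absurd (mem_Iic.1 h') (not_le.2 (mem_Iio.1 ht))) (fun s => D (t - s) (F s))).symm
  intro t ht
  have ht : 0 ≤ t := ht
  refine ((key (t + 1) (by linarith)) t ⟨ht, by linarith⟩).mono_of_mem_nhdsWithin ?_
  filter_upwards [self_mem_nhdsWithin, nhdsWithin_le_nhds (Iio_mem_nhds (lt_add_one t))] with s h1 h2
  exact ⟨h1, le_of_lt h2⟩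

variable [CompleteSpace E]

theorem IsDiagSemigroup.inner_duhamel (hD : IsDiagSemigroup B ν w D) (hν : ∀ n, ν n ≤ w)
    {F : ℝ → E} {t : ℝ} (ht : 0 ≤ t) (hF : IntervalIntegrable F volume 0 t) (x : E) (n : ℕ) :
    inner ℝ (B n) (D t x + ∫ s in (0 : ℝ)..t, D (t - s) (F s)) =
      Real.exp (ν n * t) * inner ℝ (B n) x +
        ∫ s in (0 : ℝ)..t, Real.exp (ν n * (t - s)) * inner ℝ (B n) (F s) := by
  have := (innerSL ℝ (B n)).intervalIntegral_comp_comm (hD.intervalIntegrable hν ht hF)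
  simp only [innerSL_apply_apply] at this
  rw [inner_add_right, hD.inner_apply, max_eq_left ht, ← this]
  congr 1
  refine intervalIntegral.integral_congr fun s hs => ?_
  rw [uIcc_of_le ht] at hs
  simp only [hD.inner_apply, max_eq_left (sub_nonneg.2 hs.2)]

/-- The mild formulation of a diagonal evolution equation, coordinate by coordinate. -/
theorem IsDiagSemigroup.mild_iff (hD : IsDiagSemigroup B ν w D) (hν : ∀ n, ν n ≤ w)
    {F y : ℝ → E} {T : ℝ} (hT : 0 ≤ T) (hF : IntervalIntegrable F volume 0 T) :
    (∀ t ∈ Icc 0 T, y t = D t (y 0) + ∫ s in (0 : ℝ)..t, D (t - s) (F s)) ↔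
      ∀ n, IsPrim (fun t => inner ℝ (B n) (y t))
        (fun s => ν n * inner ℝ (B n) (y s) + inner ℝ (B n) (F s)) T := by
  have hFt : ∀ t ∈ Icc 0 T, IntervalIntegrable F volume 0 t := fun t ht =>
    hF.mono_set (by rw [uIcc_of_le ht.1, uIcc_of_le hT]; exact Icc_subset_Icc_right ht.2)
  constructor
  · intro h n
    refine (duhamel_iff_isPrim hT (intervalIntegrable_inner hF (B n))).1 fun t ht => ?_
    conv_lhs => rw [h t ht]
    exact hD.inner_duhamel hν ht.1 (hFt t ht) _ n
  · intro h t ht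
    refine hilbertBasis_ext B fun n => ?_
    rw [hD.inner_duhamel hν ht.1 (hFt t ht)]
    exact (duhamel_iff_isPrim hT (intervalIntegrable_inner hF (B n))).2 (h n) t ht

end Mild

/-! ### A delayed evolution equation -/

theorem continuousOn_delayed {X : Type*} [TopologicalSpace X] {hm hM : ℝ} {h : ℝ → ℝ} {ξ : ℝ → X}
    (hξ : ContinuousOn ξ (Ici (-hM))) (hh : ContinuousOn h (Ici 0))
    (hhb : ∀ t, 0 ≤ t → hm ≤ h t ∧ h t ≤ hM) :
    ContinuousOn (fun s => ξ (s - h s)) (Ici 0) :=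
  hξ.comp (continuousOn_id.sub hh) fun s hs => by
    have hs : 0 ≤ s := hs
    rw [mem_Ici]
    linarith [(hhb s hs).2]

section Delay

variable {E : Type*} [NormedAddCommGroup E] [InnerProductSpace ℝ E]
  {B : HilbertBasis ℕ ℝ E} {ν : ℕ → ℝ} {w : ℝ} {D : ℝ → E →L[ℝ] E}

/-- `ξ` is a mild solution of `ξ'(t) = A ξ(t) + c ξ(t - h(t)) + q(t)`, where `A` generates `D`, with
initial condition `ξ = Φ` on `[-h_M, 0]`. -/
structure IsDelaySolution (D : ℝ → E →L[ℝ] E) (c hM : ℝ) (h : ℝ → ℝ) (Φ q ξ : ℝ → E) : Prop where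
  continuousOn : ContinuousOn ξ (Ici (-hM))
  initial : ∀ τ ∈ Icc (-hM) 0, ξ τ = Φ τ
  duhamel : ∀ t, 0 ≤ t →
    ξ t = D t (Φ 0) + ∫ s in (0 : ℝ)..t, D (t - s) (c • ξ (s - h s) + q s)

variable {c hm hM : ℝ} {h : ℝ → ℝ} {Φ q : ℝ → E}

theorem intervalIntegrable_delayed {ξ : ℝ → E} (hξ : ContinuousOn ξ (Ici (-hM)))
    (hh : ContinuousOn h (Ici 0)) (hhb : ∀ t, 0 ≤ t → hm ≤ h t ∧ h t ≤ hM)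
    (hq : ∀ T, 0 ≤ T → IntervalIntegrable q volume 0 T) (T : ℝ) (hT : 0 ≤ T) :
    IntervalIntegrable (fun s => c • ξ (s - h s) + q s) volume 0 T := by
  refine IntervalIntegrable.add ?_ (hq T hT)
  refine ContinuousOn.intervalIntegrable ?_
  rw [uIcc_of_le hT]
  exact ((continuousOn_delayed hξ hh hhb).mono Icc_subset_Ici_self).const_smul c

/-- Up to time `t` the delayed argument never exceeds `t - hm`. This gain of `hm` drives the method
of steps. -/
theorem integral_delayed_congr {ξ ξ' : ℝ → E} {t : ℝ} (ht : 0 ≤ t)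
    (hhb : ∀ t, 0 ≤ t → hm ≤ h t ∧ h t ≤ hM) (he : EqOn ξ ξ' (Icc (-hM) (t - hm))) :
    ∫ s in (0 : ℝ)..t, D (t - s) (c • ξ (s - h s) + q s) =
      ∫ s in (0 : ℝ)..t, D (t - s) (c • ξ' (s - h s) + q s) := by
  refine intervalIntegral.integral_congr fun s hs => ?_
  rw [uIcc_of_le ht] at hs
  have := hhb s hs.1
  rw [he ⟨by linarith [hs.1], by linarith [hs.2]⟩]

/-- Uniqueness, by the method of steps. -/
theorem IsDelaySolution.eqOn {ξ ξ' : ℝ → E} (hm_pos : 0 < hm)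
    (hhb : ∀ t, 0 ≤ t → hm ≤ h t ∧ h t ≤ hM)
    (hξ : IsDelaySolution D c hM h Φ q ξ) (hξ' : IsDelaySolution D c hM h Φ q ξ') :
    EqOn ξ ξ' (Ici (-hM)) := by
  have key : ∀ n : ℕ, EqOn ξ ξ' (Icc (-hM) (n * hm)) := by
    intro n
    induction n with
    | zero =>
      intro t ht
      simp only [Nat.cast_zero, zero_mul] at ht
      rw [hξ.initial t ht, hξ'.initial t ht]
    | succ n ih =>
      intro t ht
      rcases le_total t 0 with h0 | h0
      · rw [hξ.initial t ⟨ht.1, h0⟩, hξ'.initial t ⟨ht.1, h0⟩]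
      · rw [hξ.duhamel t h0, hξ'.duhamel t h0]
        congr 1
        refine integral_delayed_congr h0 hhb (ih.mono (Icc_subset_Icc_right ?_))
        have := ht.2
        push_cast at this
        linarith
  intro t ht
  obtain ⟨n, hn⟩ := exists_nat_ge (t / hm)
  exact key n ⟨ht, (div_le_iff₀ hm_pos).1 hn⟩

/-- Existence, by the method of steps. -/
theorem IsDiagSemigroup.exists_isDelaySolution (hD : IsDiagSemigroup B ν w D) (hν : ∀ n, ν n ≤ w)
    (hm_pos : 0 < hm) (hmM : hm ≤ hM) (hh : ContinuousOn h (Ici 0))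
    (hhb : ∀ t, 0 ≤ t → hm ≤ h t ∧ h t ≤ hM) (hΦ : ContinuousOn Φ (Icc (-hM) 0))
    (hq : ∀ T, 0 ≤ T → IntervalIntegrable q volume 0 T) :
    ∃ ξ, IsDelaySolution D c hM h Φ q ξ := by
  let conv : (ℝ → E) → ℝ → E := fun y t =>
    D t (Φ 0) + ∫ s in (0 : ℝ)..t, D (t - s) (c • y (s - h s) + q s)
  have hM0 : 0 < hM := hm_pos.trans_le hmM
  have hΦmin : ContinuousOn (fun t => Φ (min t 0)) (Ici (-hM)) := by
    refine hΦ.comp (by fun_prop) fun t ht => ⟨le_min ht (by linarith), min_le_right _ _⟩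
  have hconv0 : ∀ y, conv y 0 = Φ 0 := fun y => by simp [conv, hD.zero]
  have hconv : ∀ y, ContinuousOn y (Ici (-hM)) → ContinuousOn (conv y) (Ici 0) := fun y hy =>
    (hD.continuous_apply hν _).continuousOn.add
      (hD.continuousOn_duhamel hν (intervalIntegrable_delayed hy hh hhb hq))
  -- Picard iterates, the `n`-th being exact up to time `n * hm`. The terms with `min` and `max`
  -- glue the history to the Duhamel formula continuously, since `conv y 0 = Φ 0`.
  let x : ℕ → ℝ → E := fun n => Nat.rec (fun t => Φ (min t 0))
    (fun _ y t => Φ (min t 0) - Φ 0 + conv y (max t 0)) n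
  have x0 : x 0 = fun t => Φ (min t 0) := rfl
  have xs : ∀ n, x (n + 1) = fun t => Φ (min t 0) - Φ 0 + conv (x n) (max t 0) := fun n => rfl
  have xc : ∀ n, ContinuousOn (x n) (Ici (-hM)) := by
    intro n
    induction n with
    | zero => rw [x0]; exact hΦmin
    | succ n ih =>
      rw [xs]
      refine (hΦmin.sub continuousOn_const).add ((hconv _ ih).comp (by fun_prop) fun t _ => ?_)
      exact mem_Ici.2 (le_max_right t 0)
  have xneg : ∀ n t, t ≤ 0 → x n t = Φ t := by
    intro n t ht
    cases n with
    | zero => simp [x0, min_eq_left ht]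
    | succ n => simp [xs, min_eq_left ht, max_eq_right ht, hconv0]
  have xpos : ∀ n t, 0 ≤ t → x (n + 1) t = conv (x n) t := by
    intro n t ht
    simp [xs, min_eq_right ht, max_eq_left ht]
  have xstep : ∀ n : ℕ, ∀ t, t ≤ n * hm → x (n + 1) t = x n t := by
    intro n
    induction n with
    | zero =>
      intro t ht
      simp only [Nat.cast_zero, zero_mul] at ht
      rw [xneg (0 + 1) _ ht, xneg 0 _ ht]
    | succ n ih =>
      intro t ht
      rcases le_total t 0 with h0 | h0
      · rw [xneg (n + 1 + 1) _ h0, xneg (n + 1) _ h0]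
      · rw [xpos (n + 1) _ h0, xpos n _ h0]
        show D t (Φ 0) + _ = D t (Φ 0) + _
        congr 1
        refine integral_delayed_congr h0 hhb fun s hs => ih s ?_
        push_cast at ht
        linarith [hs.2]
  have xle : ∀ n m : ℕ, n ≤ m → ∀ t, t ≤ n * hm → x m t = x n t := by
    intro n m hnm
    induction m, hnm using Nat.le_induction with
    | base => intro t _; rfl
    | succ m hnm ih =>
      intro t ht
      rw [xstep m t (ht.trans (by gcongr)), ih t ht]
  -- The iterates are stationary at `t` from this index on.
  let ξ : ℝ → E := fun t => x ⌈t / hm⌉₊ t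
  have hξ : ∀ m : ℕ, ∀ t, t ≤ m * hm → ξ t = x m t := fun m t ht =>
    (xle _ m (Nat.ceil_le.2 ((div_le_iff₀ hm_pos).2 ht)) t
      ((div_le_iff₀ hm_pos).1 (Nat.le_ceil _))).symm
  refine ⟨ξ, ⟨fun t ht => ?_, fun τ hτ => xneg _ _ hτ.2, fun t ht => ?_⟩⟩
  · obtain ⟨m, hm'⟩ := exists_nat_gt (t / hm)
    rw [div_lt_iff₀ hm_pos] at hm'
    refine (xc m t ht).congr_of_eventuallyEq ?_ (hξ m t hm'.le)
    filter_upwards [nhdsWithin_le_nhds (Iio_mem_nhds hm')] with s hs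
    exact hξ m s (le_of_lt hs)
  · obtain ⟨m, hm'⟩ := exists_nat_gt (t / hm)
    rw [div_lt_iff₀ hm_pos] at hm'
    rw [hξ (m + 1) t (by push_cast; linarith), xpos m t ht]
    show D t (Φ 0) + _ = D t (Φ 0) + _
    congr 1
    refine integral_delayed_congr ht hhb fun s hs => (hξ m s ?_).symm
    linarith [hs.2]

theorem integral_exp_le {r t : ℝ} (hr : 0 < r) :
    ∫ s in (0 : ℝ)..t, Real.exp (-r * (t - s)) ≤ r⁻¹ := by
  have hd : ∀ s : ℝ, HasDerivAt (fun s => r⁻¹ * Real.exp (-r * (t - s))) (Real.exp (-r * (t - s))) s := by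
    intro s
    have : HasDerivAt (fun s : ℝ => -r * (t - s)) r s := by
      simpa using ((hasDerivAt_id s).const_sub t).const_mul (-r)
    refine (this.exp.const_mul r⁻¹).congr_deriv ?_
    field_simp
  rw [intervalIntegral.integral_eq_sub_of_hasDerivAt (fun s _ => hd s)
    (Continuous.intervalIntegrable (by fun_prop) _ _)]
  simp only [sub_self, mul_zero, Real.exp_zero, mul_one]
  have : 0 < r⁻¹ * Real.exp (-r * (t - 0)) := by positivity
  linarith

/-- If the semigroup decays fast enough, the delayed equation decays at the prescribed rate. -/
theorem IsDelaySolution.exp_mul_norm_le {κ σ : ℝ} (hD : IsDiagSemigroup B ν (-σ) D)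
    (hκ : 0 < κ) (hσ : 1 + 2 * (|c| * Real.exp (κ * hM)) ≤ σ - κ)
    (hm_pos : 0 < hm) (hmM : hm ≤ hM)
    (hhb : ∀ t, 0 ≤ t → hm ≤ h t ∧ h t ≤ hM) {ξ : ℝ → E}
    (hξ : IsDelaySolution D c hM h Φ q ξ) {MΦ P t : ℝ} (ht : 0 ≤ t)
    (hΦ : ∀ τ ∈ Icc (-hM) 0, ‖Φ τ‖ ≤ MΦ) (hP : 0 ≤ P)
    (hq : ∀ᵐ s, s ∈ Ioc 0 t → Real.exp (κ * s) * ‖q s‖ ≤ P) :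
    Real.exp (κ * t) * ‖ξ t‖ ≤ 2 * MΦ + 2 * P := by
  have hM0 : 0 < hM := hm_pos.trans_le hmM
  have hMΦ : 0 ≤ MΦ := (norm_nonneg _).trans (hΦ 0 ⟨by linarith, le_rfl⟩)
  set m : ℝ → ℝ := fun s => Real.exp (κ * s) * ‖ξ s‖ with hm_def
  have hcont : ContinuousOn m (Icc (-hM) t) :=
    (by fun_prop : Continuous fun s : ℝ => Real.exp (κ * s)).continuousOn.mul
      (hξ.continuousOn.mono Icc_subset_Ici_self).norm
  -- The weighted norm is bounded at its maximum over `[-hM, t]`: by the history if `s₀ ≤ 0`, by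
  -- Duhamel's formula otherwise. Continuity of `ξ` suffices, whatever the regularity of the delay.
  obtain ⟨s₀, hs₀, hmax⟩ := isCompact_Icc.exists_isMaxOn
    (⟨t, by linarith, le_rfl⟩ : (Icc (-hM) t).Nonempty) hcont
  have hle : m t ≤ m s₀ := hmax (show t ∈ Icc (-hM) t from ⟨by linarith, le_rfl⟩)
  refine hle.trans ?_
  have hm0 : 0 ≤ m s₀ := by positivity
  rcases le_total s₀ 0 with h0 | h0
  · have h1 : m s₀ ≤ 1 * MΦ := by
      have := hξ.initial s₀ ⟨hs₀.1, h0⟩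
      simp only [hm_def, this]
      gcongr
      · exact Real.exp_le_one_iff.2 (mul_nonpos_of_nonneg_of_nonpos hκ.le h0)
      · exact hΦ s₀ ⟨hs₀.1, h0⟩
    linarith
  · set A : ℝ := |c| * Real.exp (κ * hM) * m s₀ + P with hA
    have hA0 : 0 ≤ A := by positivity
    have hr : 0 < σ - κ := by
      have : 0 ≤ |c| * Real.exp (κ * hM) := by positivity
      linarith
    have h_int : ‖∫ s in (0 : ℝ)..s₀, D (s₀ - s) (c • ξ (s - h s) + q s)‖ ≤
        ∫ s in (0 : ℝ)..s₀, Real.exp (-κ * s₀) * A * Real.exp (-(σ - κ) * (s₀ - s)) := by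
      refine intervalIntegral.norm_integral_le_of_norm_le h0 ?_
        (Continuous.intervalIntegrable (by fun_prop) _ _)
      filter_upwards [hq] with s hqs hs
      have hqs := hqs ⟨hs.1, hs.2.trans hs₀.2⟩
      have hb := hhb s hs.1.le
      have hd : m (s - h s) ≤ m s₀ :=
        hmax (show s - h s ∈ Icc (-hM) t from ⟨by linarith [hs.1], by linarith [hs.2, hs₀.2]⟩)
      -- Moving the weight from `s - h s` to `s` costs at most `e^{κ hM}`.
      have n1 : ‖ξ (s - h s)‖ ≤ Real.exp (-κ * s) * (Real.exp (κ * hM) * m s₀) := by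
        have e1 : ‖ξ (s - h s)‖ = Real.exp (-(κ * (s - h s))) * m (s - h s) := by
          simp only [hm_def]
          rw [← mul_assoc, ← Real.exp_add]
          simp
        have e2 : Real.exp (-κ * s) * (Real.exp (κ * hM) * m s₀) =
            Real.exp (-κ * s + κ * hM) * m s₀ := by rw [Real.exp_add, mul_assoc]
        rw [e1, e2]
        have : 0 ≤ m (s - h s) := by positivity
        refine mul_le_mul (Real.exp_le_exp.2 ?_) hd this (Real.exp_pos _).le
        nlinarith [hb.2]
      have n2 : ‖q s‖ ≤ Real.exp (-κ * s) * P := by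
        have e1 : ‖q s‖ = Real.exp (-κ * s) * (Real.exp (κ * s) * ‖q s‖) := by
          rw [← mul_assoc, ← Real.exp_add]
          simp
        rw [e1]
        gcongr
      have n3 : ‖c • ξ (s - h s) + q s‖ ≤ Real.exp (-κ * s) * A := by
        refine (norm_add_le _ _).trans ?_
        rw [norm_smul, Real.norm_eq_abs]
        calc |c| * ‖ξ (s - h s)‖ + ‖q s‖
            ≤ |c| * (Real.exp (-κ * s) * (Real.exp (κ * hM) * m s₀)) + Real.exp (-κ * s) * P := by
              gcongr
          _ = _ := by rw [hA]; ring
      refine (hD.norm_apply_le _ _).trans ?_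
      rw [max_eq_left (by linarith [hs.2])]
      calc Real.exp (-σ * (s₀ - s)) * ‖c • ξ (s - h s) + q s‖
          ≤ Real.exp (-σ * (s₀ - s)) * (Real.exp (-κ * s) * A) := by gcongr
        _ = Real.exp (-κ * s₀) * A * Real.exp (-(σ - κ) * (s₀ - s)) := by
            rw [← mul_assoc, ← Real.exp_add, mul_right_comm, ← Real.exp_add]
            congr 2
            ring
    rw [intervalIntegral.integral_const_mul] at h_int
    have hI : ‖∫ s in (0 : ℝ)..s₀, D (s₀ - s) (c • ξ (s - h s) + q s)‖ ≤
        Real.exp (-κ * s₀) * A * (σ - κ)⁻¹ :=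
      h_int.trans (by gcongr; exact integral_exp_le hr)
    have hD0 : ‖D s₀ (Φ 0)‖ ≤ Real.exp (-κ * s₀) * MΦ := by
      refine (hD.norm_apply_le _ _).trans ?_
      rw [max_eq_left h0]
      gcongr
      · linarith
      · exact hΦ 0 ⟨by linarith, le_rfl⟩
    have hn : ‖ξ s₀‖ ≤ Real.exp (-κ * s₀) * (MΦ + A * (σ - κ)⁻¹) := by
      rw [hξ.duhamel s₀ h0]
      refine (norm_add_le _ _).trans ?_
      rw [mul_add, ← mul_assoc]
      exact add_le_add hD0 hI
    have hms : m s₀ ≤ MΦ + A * (σ - κ)⁻¹ := by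
      calc m s₀ ≤ Real.exp (κ * s₀) * (Real.exp (-κ * s₀) * (MΦ + A * (σ - κ)⁻¹)) := by
            simp only [hm_def]; gcongr
        _ = _ := by rw [← mul_assoc, ← Real.exp_add]; simp
    -- The gap `σ - κ` is at least twice the delay coefficient and at least `1`; half of the maximum
    -- is then absorbed on the left.
    have hA2 : A * (σ - κ)⁻¹ ≤ m s₀ / 2 + P := by
      rw [mul_inv_le_iff₀ hr, hA]
      have h1 : |c| * Real.exp (κ * hM) * m s₀ ≤ m s₀ / 2 * (σ - κ) := by nlinarith
      have h2 : P ≤ P * (σ - κ) := by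
        have : 0 ≤ |c| * Real.exp (κ * hM) := by positivity
        nlinarith
      linarith
    linarith

end Delay

/-! ### Pole placement -/

/-- Cauchy matrices are injective. -/
theorem cauchy_eq_zero {N : ℕ} {x y : Fin N → ℝ} (hx : Function.Injective x)
    (hy : Function.Injective y) (hxy : ∀ j i, y j ≠ x i) {z : Fin N → ℝ}
    (h : ∀ i, ∑ j, z j / (y j - x i) = 0) : z = 0 := by
  classical
  -- The numerator of `∑ z j / (y j - t)` over a common denominator, up to sign. It has degree below
  -- `N` and `N` zeros `x i`, so it vanishes; its value at `y j` isolates `z j`.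
  let P : Polynomial ℝ := ∑ j, Polynomial.C (z j) *
    ∏ l ∈ Finset.univ.erase j, (Polynomial.X - Polynomial.C (y l))
  have hev : ∀ t, P.eval t = ∑ j, z j * ∏ l ∈ Finset.univ.erase j, (t - y l) := fun t => by
    simp [P, Polynomial.eval_finsetSum, Polynomial.eval_prod]
  have hP : P = 0 := by
    refine Polynomial.eq_zero_of_degree_lt_of_eval_index_eq_zero Finset.univ hx.injOn ?_ ?_
    · rw [Finset.card_univ, Fintype.card_fin]
      refine (Polynomial.degree_sum_le _ _).trans_lt ?_
      refine (Finset.sup_lt_iff (WithBot.bot_lt_coe N)).2 fun j _ => ?_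
      rw [← Polynomial.smul_eq_C_mul]
      refine (Polynomial.degree_smul_le _ _).trans_lt ?_
      rw [Polynomial.degree_prod]
      simp only [Polynomial.degree_X_sub_C, Finset.sum_const, Finset.card_erase_of_mem
        (Finset.mem_univ j), Finset.card_univ, Fintype.card_fin, nsmul_eq_mul, mul_one]
      exact WithBot.coe_lt_coe.2 (Nat.sub_lt (Fin.pos j) one_pos)
    · intro i _
      have key : P.eval (x i) = -(∏ l, (x i - y l)) * ∑ j, z j / (y j - x i) := by
        rw [hev, Finset.mul_sum]
        refine Finset.sum_congr rfl fun j _ => ?_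
        rw [← Finset.mul_prod_erase _ _ (Finset.mem_univ j)]
        have : y j - x i ≠ 0 := sub_ne_zero.2 (hxy j i)
        field_simp
        ring
      rw [key, h i, mul_zero]
  funext j
  have h1 : P.eval (y j) = z j * ∏ l ∈ Finset.univ.erase j, (y j - y l) := by
    rw [hev]
    refine Finset.sum_eq_single j (fun i _ hij => ?_) (by simp)
    rw [Finset.prod_eq_zero (Finset.mem_erase.2 ⟨hij.symm, Finset.mem_univ j⟩) (sub_self _), mul_zero]
  rw [hP, Polynomial.eval_zero] at h1
  refine (mul_eq_zero.1 h1.symm).resolve_right ?_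
  refine Finset.prod_ne_zero_iff.2 fun l hl => sub_ne_zero.2 fun he => ?_
  exact (Finset.mem_erase.1 hl).1 (hy he).symm

/-- The eigenvectors of the controlled modes: the rank one perturbation `diag(x) + b kᵀ` has the
eigenvalues `y j`, with eigenvectors the columns of `V`. -/
theorem exists_pole_placement {N : ℕ} {x y b : Fin N → ℝ} (hx : Function.Injective x)
    (hy : Function.Injective y) (hxy : ∀ j i, y j ≠ x i) (hb : ∀ i, b i ≠ 0) :
    ∃ (W : Matrix (Fin N) (Fin N) ℝ) (k : Fin N → ℝ),
      W * Matrix.of (fun i j => b i / (y j - x i)) = 1 ∧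
      Matrix.of (fun i j => b i / (y j - x i)) * W = 1 ∧
      ∀ j, ∑ i, k i * (b i / (y j - x i)) = 1 := by
  set V : Matrix (Fin N) (Fin N) ℝ := Matrix.of (fun i j => b i / (y j - x i)) with hV
  have hinj : Function.Injective V.mulVec := by
    intro z z' hz
    rw [← sub_eq_zero]
    refine cauchy_eq_zero hx hy hxy fun i => ?_
    have h1 : V.mulVec (z - z') i = 0 := by rw [Matrix.mulVec_sub, sub_eq_zero.2 hz]; rfl
    have h2 : V.mulVec (z - z') i = b i * ∑ j, (z - z') j / (y j - x i) := by
      rw [Matrix.mulVec, dotProduct, Finset.mul_sum]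
      refine Finset.sum_congr rfl fun j _ => ?_
      simp only [hV, Matrix.of_apply]
      ring
    rw [h2] at h1
    exact (mul_eq_zero.1 h1).resolve_left (hb i)
  have hu : IsUnit V.det := (Matrix.isUnit_iff_isUnit_det V).1 (Matrix.mulVec_injective_iff_isUnit.1 hinj)
  -- The gain solves `kᵀ V = (1, …, 1)`. Each column `v` of `V` then satisfies `x_i v_i + b_i (k ·
  -- v) = y_j v_i`.
  refine ⟨V⁻¹, Matrix.vecMul 1 V⁻¹, Matrix.nonsing_inv_mul V hu, Matrix.mul_nonsing_inv V hu,
    fun j => ?_⟩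
  have : Matrix.vecMul (Matrix.vecMul 1 V⁻¹) V j = 1 := by
    rw [Matrix.vecMul_vecMul, Matrix.nonsing_inv_mul V hu, Matrix.vecMul_one]; rfl
  rw [← this]
  rfl

theorem IsPrim.sum {ι : Type*} (s : Finset ι) {F q : ι → ℝ → ℝ} {T : ℝ} (hT : 0 ≤ T)
    (h : ∀ i ∈ s, IsPrim (F i) (q i) T) :
    IsPrim (fun x => ∑ i ∈ s, F i x) (fun x => ∑ i ∈ s, q i x) T := by
  classical
  induction s using Finset.induction_on with
  | empty => exact ⟨by simp, fun x _ => by simp⟩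
  | insert i s hi ih =>
    simp only [Finset.sum_insert hi]
    exact (h i (Finset.mem_insert_self i s)).add
      (ih fun j hj => h j (Finset.mem_insert_of_mem hj)) hT

/-- The spectrum of the closed loop: the first `N` values are replaced by `μ`. -/
noncomputable def closedLoopRate {N : ℕ} (r : ℕ → ℝ) (μ : Fin N → ℝ) (n : ℕ) : ℝ :=
  if h : n < N then μ ⟨n, h⟩ else r n

/-- The modes of the closed loop in the coordinates `ξ` given by its eigenvectors: the equations
`x_n' = r_n x_n + β_n u + F_n` with `u = ∑ ξ_j` decouple. -/
theorem isPrim_modes_iff {N : ℕ} {r β : ℕ → ℝ} {μ : Fin N → ℝ} (hμ : ∀ j n, μ j ≠ r n)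
    {W : Matrix (Fin N) (Fin N) ℝ}
    (hW : W * Matrix.of (fun i j : Fin N => β i / (μ j - r i)) = 1) {ξ f x F : ℕ → ℝ → ℝ}
    (hx : ∀ n t, x n t = ∑ j : Fin N, ξ j t * (β n / (μ j - r n)) + if n < N then 0 else ξ n t)
    (hF : ∀ n t, F n t = ∑ j : Fin N, f j t * (β n / (μ j - r n)) + if n < N then 0 else f n t)
    {T : ℝ} (hT : 0 ≤ T) :
    (∀ n, IsPrim (ξ n) (fun s => closedLoopRate r μ n * ξ n s + f n s) T) ↔
      ∀ n, IsPrim (x n) (fun s => r n * x n s + (β n * ∑ j : Fin N, ξ j s + F n s)) T := by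
  have hrate : ∀ j : Fin N, closedLoopRate r μ j = μ j := fun j => by
    simp [closedLoopRate]
  have hrate' : ∀ n, ¬ n < N → closedLoopRate r μ n = r n := fun n hn => by
    simp [closedLoopRate, hn]
  -- The eigenvector equation of the closed loop, `r_n v_n + β_n = μ_j v_n`, valid for all modes and
  -- not only the first `N`.
  have hcol : ∀ n (j : Fin N), (μ j - r n) * (β n / (μ j - r n)) = β n := fun n j =>
    mul_div_cancel₀ _ (sub_ne_zero.2 (hμ j n))
  have halg : ∀ n s, ∑ j : Fin N, (μ j * ξ j s + f j s) * (β n / (μ j - r n)) =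
      r n * ∑ j : Fin N, ξ j s * (β n / (μ j - r n)) + β n * ∑ j : Fin N, ξ j s +
        ∑ j : Fin N, f j s * (β n / (μ j - r n)) := fun n s => by
    rw [Finset.mul_sum, Finset.mul_sum, ← Finset.sum_add_distrib, ← Finset.sum_add_distrib]
    refine Finset.sum_congr rfl fun j _ => ?_
    linear_combination ξ j s * hcol n j
  have hlow : ∀ n, (∀ j : Fin N, IsPrim (ξ j) (fun s => μ j * ξ j s + f j s) T) →
      IsPrim (fun t => ∑ j : Fin N, ξ j t * (β n / (μ j - r n)))
        (fun s => ∑ j : Fin N, (μ j * ξ j s + f j s) * (β n / (μ j - r n))) T := fun n h => by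
    refine IsPrim.sum _ hT fun j _ => ?_
    have := (h j).const_mul hT (β n / (μ j - r n))
    simpa only [mul_comm] using this
  constructor
  · intro h n
    have h1 := hlow n fun j => by simpa only [hrate] using h j
    by_cases hn : n < N
    · refine (h1.congr_left fun t _ => ?_).congr_right hT (ae_of_all _ fun s _ => ?_)
      · simp [hx n t, hn]
      · simp only [halg, hx n s, hF n s, hn, if_true]
        ring
    · refine ((h1.add (h n) hT).congr_left fun t _ => ?_).congr_right hT (ae_of_all _ fun s _ => ?_)
      · simp [hx n t, hn]
      · simp only [halg, hx n s, hF n s, hn, if_false, hrate' n hn]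
        ring
  -- Conversely, `W` recovers the first `N` coordinates of `ξ` from the first `N` modes; the others
  -- follow by subtracting the contribution of those coordinates.
  · intro h
    have hxl : ∀ (i : Fin N) t, x i t = ∑ j : Fin N, ξ j t * (β i / (μ j - r i)) := fun i t => by
      simp [hx i t]
    have hWs : ∀ (j : Fin N) (z : Fin N → ℝ),
        ∑ i : Fin N, W j i * ∑ l : Fin N, z l * (β i / (μ l - r i)) = z j := fun j z => by
      have h1 := congrFun (congrArg (fun M => Matrix.mulVec M z) hW) j
      simp only [Matrix.one_mulVec, ← Matrix.mulVec_mulVec] at h1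
      rw [← h1]
      simp only [Matrix.mulVec, dotProduct, Matrix.of_apply]
      refine Finset.sum_congr rfl fun i _ => ?_
      congr 1
      exact Finset.sum_congr rfl fun l _ => mul_comm _ _
    have hj : ∀ j : Fin N, IsPrim (ξ j) (fun s => μ j * ξ j s + f j s) T := by
      intro j
      have h1 := IsPrim.sum Finset.univ hT fun (i : Fin N) _ => (h i).const_mul hT (W j i)
      refine (h1.congr_left fun t _ => ?_).congr_right hT (ae_of_all _ fun s _ => ?_)
      · simp only [hxl]
        exact hWs j fun l => ξ l t
      · rw [← hWs j fun l => μ l * ξ l s + f l s]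
        refine Finset.sum_congr rfl fun i _ => ?_
        rw [halg, hxl, hF, if_pos i.2, add_zero, add_assoc]
    intro n
    by_cases hn : n < N
    · have := hj ⟨n, hn⟩
      simpa only [closedLoopRate, hn, dif_pos] using this
    · refine (((h n).add ((hlow n hj).const_mul hT (-1)) hT).congr_left fun t _ => ?_).congr_right hT
        (ae_of_all _ fun s _ => ?_)
      · simp [hx n t, hn]
      · simp only [halg, hx n s, hF n s, hn, if_false, hrate' n hn]
        ring

/-- The change of coordinates to the eigenvectors of the closed loop. -/
theorem exists_transform {E : Type*} [NormedAddCommGroup E] [InnerProductSpace ℝ E]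
    (B : HilbertBasis ℕ ℝ E) {N : ℕ} {V W : Matrix (Fin N) (Fin N) ℝ} (hVW : V * W = 1)
    {v : Fin N → E} (hv : ∀ i j : Fin N, inner ℝ (B i) (v j) = V i j) :
    ∃ R Q : E →L[ℝ] E, (∀ x, R (Q x) = x) ∧
      ∀ ξ n, inner ℝ (B n) (R ξ) = ∑ j : Fin N, inner ℝ (B j) ξ * inner ℝ (B n) (v j) +
        if n < N then 0 else inner ℝ (B n) ξ := by
  classical
  -- `R` sends `B j` to `v j` for `j < N` and fixes the other basis vectors. `Q` has first
  -- coordinates `W` times those of `x`, so it subtracts exactly the multiples of `v j - B j` that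
  -- `R` adds back.
  let R : E →L[ℝ] E := ContinuousLinearMap.id ℝ E +
    ∑ j : Fin N, (innerSL ℝ (B j)).smulRight (v j - B j)
  let Q : E →L[ℝ] E := ContinuousLinearMap.id ℝ E -
    ∑ j : Fin N, (∑ i : Fin N, W j i • innerSL ℝ (B i)).smulRight (v j - B j)
  have hR : ∀ ξ, R ξ = ξ + ∑ j : Fin N, inner ℝ (B j) ξ • (v j - B j) := fun ξ => by
    simp [R]
  have hQ : ∀ x, Q x = x - ∑ j : Fin N, (∑ i : Fin N, W j i * inner ℝ (B i) x) • (v j - B j) :=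
    fun x => by simp [Q]
  have hB : ∀ n m : ℕ, inner ℝ (B n) (B m) = if n = m then (1 : ℝ) else 0 :=
    orthonormal_iff_ite.1 B.orthonormal
  have hQj : ∀ x (l : Fin N), inner ℝ (B l) (Q x) = ∑ i : Fin N, W l i * inner ℝ (B i) x := by
    intro x l
    have h1 : ∑ j : Fin N, (∑ i : Fin N, W j i * inner ℝ (B i) x) * V l j = inner ℝ (B l) x := by
      have h2 := congrFun (congrArg (fun M => Matrix.mulVec M fun i : Fin N => inner ℝ (B i) x) hVW) l
      simp only [Matrix.one_mulVec, ← Matrix.mulVec_mulVec] at h2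
      rw [← h2]
      simp only [Matrix.mulVec, dotProduct]
      exact Finset.sum_congr rfl fun j _ => mul_comm _ _
    rw [hQ, inner_sub_right, inner_sum]
    simp only [inner_smul_right, inner_sub_right, hv, hB, mul_sub, Finset.sum_sub_distrib, h1,
      Fin.val_inj, mul_ite, mul_one, mul_zero, Finset.sum_ite_eq, Finset.mem_univ, if_true]
    ring
  refine ⟨R, Q, fun x => ?_, fun ξ n => ?_⟩
  · rw [hR]
    simp only [hQj]
    rw [hQ]
    abel
  · rw [hR, inner_add_right, inner_sum]
    simp only [inner_smul_right, inner_sub_right, hB, mul_sub, Finset.sum_sub_distrib, mul_ite,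
      mul_one, mul_zero]
    by_cases hn : n < N
    · have : ∑ j : Fin N, (if n = (j : ℕ) then inner ℝ (B j) ξ else 0) = inner ℝ (B n) ξ := by
        rw [Finset.sum_eq_single (⟨n, hn⟩ : Fin N)]
        · simp
        · intro j _ hj
          rw [if_neg]
          rintro rfl
          exact hj rfl
        · simp
      rw [this, if_pos hn]
      ring
    · have : ∑ j : Fin N, (if n = (j : ℕ) then inner ℝ (B j) ξ else 0) = 0 :=
        Finset.sum_eq_zero fun j _ => if_neg (by rintro rfl; exact hn j.2)
      rw [this, if_neg hn]
      ring

/-! ### The boundary control -/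

/-- The first control channel. -/
noncomputable def ctrlDir : U := !₂[1, 0]

theorem lift_smul (θ₁ θ₂ : ℝ) (k : ℕ) (s : ℝ) (u : U) :
    lift θ₁ θ₂ k (s • u) = s • lift θ₁ θ₂ k u := by
  rw [lift, lift, ← MemLp.toLp_const_smul]
  refine MemLp.toLp_congr _ _ (ae_of_all _ fun x => ?_)
  simp only [liftFun, PiLp.smul_apply, smul_eq_mul, Pi.smul_apply]
  ring

theorem exists_isH2Rep_lift (θ₁ θ₂ : ℝ) (k : ℕ) :
    ∃ w, IsH2Rep (lift θ₁ θ₂ k ctrlDir)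
      (fun x => (Real.cos θ₁ + k * Real.sin θ₁)⁻¹ * (1 - x) ^ k)
      (fun x => (Real.cos θ₁ + k * Real.sin θ₁)⁻¹ * -(k * (1 - x) ^ (k - 1))) w := by
  set d := (Real.cos θ₁ + k * Real.sin θ₁)⁻¹ with hd
  have hpow : ∀ (m : ℕ) (x : ℝ), HasDerivAt (fun x : ℝ => (1 - x) ^ m) (-(m * (1 - x) ^ (m - 1))) x :=
    fun m x => by
      have : HasDerivAt (fun x : ℝ => 1 - x) (-1) x := by simpa using (hasDerivAt_id x).const_sub 1
      refine (this.pow m).congr_deriv ?_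
      ring
  have c2 : Continuous fun x : ℝ =>
      d * -(k * -(((k - 1 : ℕ) : ℝ) * (1 - x) ^ (k - 1 - 1))) := by fun_prop
  refine ⟨(memLp_of_continuousOn c2.continuousOn).toLp _, ?_⟩
  refine isH2Rep_of_hasDerivAt (fun x => (hpow k x).const_mul d)
    (fun x => (((hpow (k - 1) x).const_mul (k : ℝ)).neg).const_mul d) c2 ?_ (toLp_congr _)
  filter_upwards [toLp_congr (memLp_liftFun θ₁ θ₂ k ctrlDir)] with x hx hxI
  rw [lift, hx hxI, liftFun]
  simp [ctrlDir, hd, div_eq_inv_mul]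

theorem opA_smul (a b : ℝ) {f : H} (hf : MemH2 f) (s : ℝ) : opA a b (s • f) = s • opA a b f := by
  obtain ⟨φ, φ', w, h⟩ := hf
  rw [opA_eq a b h, opA_eq a b (h.smul s)]
  module

/-- The coefficients of the input in the modal equations. -/
noncomputable def inputCoeff (a b c θ₁ θ₂ : ℝ) (k : ℕ) (lam : ℕ → ℝ) (e : ℕ → H) (n : ℕ) : ℝ :=
  inner ℝ (e n) (opA a b (lift θ₁ θ₂ k ctrlDir)) -
    (lam n - c) * inner ℝ (e n) (lift θ₁ θ₂ k ctrlDir)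

/-- All modes are controllable from the first channel. -/
theorem IsEigensystem.inputCoeff_ne_zero {a b c θ₁ θ₂ : ℝ} {lam : ℕ → ℝ} {e : ℕ → H}
    (he : IsEigensystem a b c θ₁ θ₂ lam e) (ha : 0 < a) {k : ℕ} (hk : 2 ≤ k)
    (hk₁ : Real.cos θ₁ + k * Real.sin θ₁ ≠ 0) (n : ℕ) :
    inputCoeff a b c θ₁ θ₂ k lam e n ≠ 0 := by
  obtain ⟨w, hw⟩ := exists_isH2Rep_lift θ₁ θ₂ k
  obtain ⟨ψ, ψ', R, b1, -⟩ := he.hasLap ha n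
  obtain ⟨r, hr, e1, e2⟩ := exists_cauchy_data R b1 ((he.orthonormal ha).ne_zero n)
  have hg := hw.green R
  -- Since `k ≥ 2`, the lift and its derivative vanish at `1`, and Green's formula keeps only the
  -- boundary term at `0`.
  have hk0 : k ≠ 0 := by omega
  have hk1 : k - 1 ≠ 0 := by omega
  simp only [sub_self, sub_zero, one_pow, zero_pow hk0, zero_pow hk1, mul_zero, neg_zero, zero_mul,
    mul_one, e1, e2, zero_sub] at hg
  rw [real_inner_smul_right, real_inner_comm (e n) w, real_inner_comm (e n) (lift θ₁ θ₂ k ctrlDir)] at hg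
  -- The normalisation of the lift gives it boundary value one at `0`, so what remains is the
  -- amplitude `r` of the eigenfunction.
  have : inputCoeff a b c θ₁ θ₂ k lam e n = a * r := by
    rw [inputCoeff, opA_eq a b hw, inner_add_right, inner_smul_right, inner_smul_right]
    have h1 : (lam n - c) = a * ((lam n - b - c) / a) + b := by field_simp; ring
    have h2 : (Real.cos θ₁ + k * Real.sin θ₁)⁻¹ * (Real.cos θ₁ + k * Real.sin θ₁) = 1 :=
      inv_mul_cancel₀ hk₁
    rw [h1]
    linear_combination a * hg + a * r * h2
  rw [this]
  exact mul_ne_zero ha.ne' hr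

/-- Feedback through the first channel. -/
theorem feedback_eq (e : ℕ → H) {N : ℕ} (g : Fin N → ℝ) (X : ℝ → H) (t : ℝ) :
    feedback e (Matrix.of ![g, 0]) X t = (∑ i : Fin N, g i * inner ℝ (e i) (X t)) • ctrlDir := by
  ext i
  fin_cases i <;>
    simp [feedback, modes, ctrlDir, Matrix.toEuclideanLin, dotProduct,
      real_inner_comm]

theorem absolutelyContinuousOnInterval_smul_ctrlDir_iff {q : ℝ → ℝ} {s t : ℝ} :
    AbsolutelyContinuousOnInterval (fun t => q t • ctrlDir) s t ↔
      AbsolutelyContinuousOnInterval q s t := by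
  have h1 : ∀ x y, dist (q x • ctrlDir) (q y • ctrlDir) = dist (q x) (q y) := fun x y => by
    have : ‖ctrlDir‖ = 1 := by simp [ctrlDir, EuclideanSpace.norm_eq]
    rw [dist_eq_norm, ← sub_smul, norm_smul, this, mul_one, Real.dist_eq, Real.norm_eq_abs]
  simp only [absolutelyContinuousOnInterval_iff, h1]

/-- The modal form of the mild formulation of the boundary control system. -/
theorem mild_iff_modes {a b c θ₁ θ₂ : ℝ} {k : ℕ} {S : ℝ → H →L[ℝ] H}
    (hS : IsGeneratedByA₀ a b θ₁ θ₂ S) {lam : ℕ → ℝ} {e : ℕ → H}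
    (he : IsEigensystem a b c θ₁ θ₂ lam e) {B : HilbertBasis ℕ ℝ H} (hB : ⇑B = e)
    {X g : ℝ → H} (hg : ∀ T, 0 ≤ T → IntervalIntegrable g volume 0 T)
    {q : ℝ → ℝ} (hq : ∀ T, 0 ≤ T → AbsolutelyContinuousOnInterval q 0 T) :
    (∀ t, 0 ≤ t → X t = S t (X 0 - lift θ₁ θ₂ k (q 0 • ctrlDir)) + lift θ₁ θ₂ k (q t • ctrlDir) +
      ∫ s in (0 : ℝ)..t, S (t - s) (opA a b (lift θ₁ θ₂ k (q s • ctrlDir)) -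
        lift θ₁ θ₂ k (deriv (fun t => q t • ctrlDir) s) + g s)) ↔
    ∀ T, 0 ≤ T → ∀ n, IsPrim (fun t => inner ℝ (B n) (X t)) (fun s => (lam n - c) * inner ℝ (B n) (X s) +
      (inputCoeff a b c θ₁ θ₂ k lam e n * q s + inner ℝ (B n) (g s))) T := by
  obtain ⟨D, hD⟩ := exists_isDiagSemigroup B he.sub_le
  set ℓ := lift θ₁ θ₂ k ctrlDir with hℓ
  set α := opA a b ℓ with hα
  obtain ⟨w, hw⟩ := exists_isH2Rep_lift θ₁ θ₂ k
  have hmem : MemH2 ℓ := ⟨_, _, w, hw⟩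
  set F : ℝ → H := fun s => q s • α - deriv q s • ℓ + g s with hF
  -- Subtracting the lift turns the boundary input into the distributed source `q α - q' ℓ`.
  set y : ℝ → H := fun t => X t - q t • ℓ with hy
  have hP : ∀ T, 0 ≤ T → IsPrim q (deriv q) T := fun T hT => IsPrim.of_ac (hq T hT)
  have hFi : ∀ T, 0 ≤ T → IntervalIntegrable F volume 0 T := by
    intro T hT
    have h1 : IntervalIntegrable (fun s => q s • α) volume 0 T := by
      refine ContinuousOn.intervalIntegrable ?_
      exact (hq T hT).continuousOn.smul continuousOn_const
    have h2 : IntervalIntegrable (fun s => deriv q s • ℓ) volume 0 T :=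
      ⟨(hP T hT).1.1.smul_const ℓ, (hP T hT).1.2.smul_const ℓ⟩
    exact (h1.sub h2).add (hg T hT)
  have h_int : ∀ t, 0 ≤ t → ∫ s in (0 : ℝ)..t, S (t - s) (opA a b (lift θ₁ θ₂ k (q s • ctrlDir)) -
        lift θ₁ θ₂ k (deriv (fun t => q t • ctrlDir) s) + g s) =
      ∫ s in (0 : ℝ)..t, D (t - s) (F s) := by
    intro t ht
    refine intervalIntegral.integral_congr_ae ?_
    filter_upwards [(hq t ht).ae_differentiableAt] with s hs hst
    have hs := hs (uIoc_subset_uIcc hst)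
    rw [uIoc_of_le ht] at hst
    rw [hS.eq_diagonal he hB hD (sub_nonneg.2 hst.2), deriv_smul_const hs, lift_smul, lift_smul,
      ← hℓ, opA_smul a b hmem]
  have h1 : (∀ t, 0 ≤ t → X t = S t (X 0 - lift θ₁ θ₂ k (q 0 • ctrlDir)) +
      lift θ₁ θ₂ k (q t • ctrlDir) +
      ∫ s in (0 : ℝ)..t, S (t - s) (opA a b (lift θ₁ θ₂ k (q s • ctrlDir)) -
        lift θ₁ θ₂ k (deriv (fun t => q t • ctrlDir) s) + g s)) ↔
      ∀ T, 0 ≤ T → ∀ t ∈ Icc 0 T, y t = D t (y 0) + ∫ s in (0 : ℝ)..t, D (t - s) (F s) := by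
    have h2 : (∀ T : ℝ, 0 ≤ T → ∀ t ∈ Icc 0 T, y t = D t (y 0) + ∫ s in (0 : ℝ)..t, D (t - s) (F s)) ↔
        ∀ t, 0 ≤ t → y t = D t (y 0) + ∫ s in (0 : ℝ)..t, D (t - s) (F s) :=
      ⟨fun h t ht => h t ht t ⟨ht, le_rfl⟩, fun h T _ t ht => h t ht.1⟩
    rw [h2]
    refine forall_congr' fun t => forall_congr' fun ht => ?_
    rw [h_int t ht, lift_smul, lift_smul, ← hℓ, hS.eq_diagonal he hB hD ht, add_right_comm,
      ← sub_eq_iff_eq_add]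
  rw [h1]
  refine forall_congr' fun T => forall_congr' fun hT => ?_
  rw [hD.mild_iff he.sub_le hT (hFi T hT)]
  refine forall_congr' fun n => ?_
  -- Adding `q ℓ` back to each coordinate removes `q'` from the equation and leaves `q` with
  -- coefficient `⟨α, e_n⟩ - (lam n - c) ⟨ℓ, e_n⟩`.
  have hqn := (hP T hT).const_mul hT (inner ℝ (B n) ℓ)
  have hin : inputCoeff a b c θ₁ θ₂ k lam e n =
      inner ℝ (B n) α - (lam n - c) * inner ℝ (B n) ℓ := by rw [hB]; rfl
  constructor
  · intro h
    refine ((h.add hqn hT).congr_left fun t _ => ?_).congr_right hT (ae_of_all _ fun s _ => ?_)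
    · simp only [hy, inner_sub_right, inner_smul_right]
      ring
    · simp only [hy, hF, inner_sub_right, inner_add_right, inner_smul_right, hin]
      ring
  · intro h
    refine ((h.add (hqn.const_mul hT (-1)) hT).congr_left fun t _ => ?_).congr_right hT
      (ae_of_all _ fun s _ => ?_)
    · simp only [hy, inner_sub_right, inner_smul_right]
      ring
    · simp only [hy, hF, inner_sub_right, inner_add_right, inner_smul_right, hin]
      ring

/-! ### The closed loop -/

/-- Separated poles between two consecutive eigenvalues. -/
theorem exists_poles {r : ℕ → ℝ} (hr : StrictAnti r) (m : ℕ) :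
    ∃ μ : Fin (m + 1) → ℝ, Function.Injective μ ∧ (∀ j, μ j ≤ r m) ∧
      ∀ j, ∃ C, ∀ n, μ j ≠ r n ∧ |(μ j - r n)⁻¹| ≤ C := by
  have hlt : 0 < r m - r (m + 1) := sub_pos.2 (hr (Nat.lt_succ_self m))
  have hd : (0 : ℝ) < m + 2 := by positivity
  -- Equally spaced interior points of the gap between `r (m + 1)` and `r m`. No rate lies inside
  -- the gap, so the distance from a pole to all rates is at least its distance to the ends.
  let t : Fin (m + 1) → ℝ := fun j => ((j : ℕ) + 1) / ((m : ℝ) + 2)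
  have ht0 : ∀ j, 0 < t j := fun j => by positivity
  have ht1 : ∀ j, t j < 1 := fun j => by
    rw [div_lt_one hd]
    have : ((j : ℕ) : ℝ) < (m + 1 : ℕ) := Nat.cast_lt.2 j.2
    push_cast at this
    linarith
  let μ : Fin (m + 1) → ℝ := fun j => r (m + 1) + (r m - r (m + 1)) * t j
  have hl : ∀ j, r (m + 1) < μ j := fun j => by
    have := mul_pos hlt (ht0 j)
    simp only [μ]; linarith
  have hu : ∀ j, μ j < r m := fun j => by
    have := mul_lt_mul_of_pos_left (ht1 j) hlt
    simp only [μ]; linarith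
  refine ⟨μ, fun i j hij => ?_, fun j => (hu j).le, fun j => ?_⟩
  · simp only [μ, t, add_right_inj] at hij
    have h1 := mul_left_cancel₀ hlt.ne' hij
    rw [div_left_inj' hd.ne'] at h1
    exact Fin.ext (by exact_mod_cast add_right_cancel h1)
  · have key : ∀ n, min (μ j - r (m + 1)) (r m - μ j) ≤ |μ j - r n| := fun n => by
      rcases Nat.lt_or_ge m n with h | h
      · have h1 : r n ≤ r (m + 1) := hr.antitone h
        exact (min_le_left _ _).trans ((by linarith : _ ≤ μ j - r n).trans (le_abs_self _))
      · have h1 : r m ≤ r n := hr.antitone h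
        exact (min_le_right _ _).trans ((by linarith : _ ≤ -(μ j - r n)).trans (neg_le_abs _))
    have hpos : 0 < min (μ j - r (m + 1)) (r m - μ j) :=
      lt_min (sub_pos.2 (hl j)) (sub_pos.2 (hu j))
    refine ⟨(min (μ j - r (m + 1)) (r m - μ j))⁻¹, fun n => ⟨fun h => ?_, ?_⟩⟩
    · have := key n
      rw [h, sub_self, abs_zero, ← h] at this
      linarith
    · rw [abs_inv]
      exact inv_anti₀ hpos (key n)

/-- Modal feedback moving the closed loop spectrum to the left of `-σ`, together with coordinates in
which the closed loop is diagonal. -/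
theorem exists_closedLoop {E : Type*} [NormedAddCommGroup E] [InnerProductSpace ℝ E]
    (B : HilbertBasis ℕ ℝ E) {r β : ℕ → ℝ} (hr : StrictAnti r) {ℓ α : E}
    (hβ : ∀ n, β n = inner ℝ (B n) α - r n * inner ℝ (B n) ℓ) (hβ0 : ∀ n, β n ≠ 0) {σ : ℝ} {m : ℕ}
    (hm : r m ≤ -σ) :
    ∃ (g : Fin (m + 1) → ℝ) (ν : ℕ → ℝ) (R Q : E →L[ℝ] E), (∀ n, ν n ≤ -σ) ∧ (∀ x, R (Q x) = x) ∧
      ∀ (ξ f : ℝ → E) (T : ℝ), 0 ≤ T →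
        ((∀ n, IsPrim (fun t => inner ℝ (B n) (ξ t))
          (fun s => ν n * inner ℝ (B n) (ξ s) + inner ℝ (B n) (f s)) T) ↔
        ∀ n, IsPrim (fun t => inner ℝ (B n) (R (ξ t))) (fun s => r n * inner ℝ (B n) (R (ξ s)) +
          (β n * ∑ i : Fin (m + 1), g i * inner ℝ (B i) (R (ξ s)) + inner ℝ (B n) (R (f s)))) T) := by
  obtain ⟨μ, hμinj, hμle, hμ⟩ := exists_poles hr m
  choose C hC using hμ
  choose Td hTd _ using fun j => exists_diagonal B fun n => (hC j n).2
  -- Here `Td j` is the resolvent at `μ j`. Dividing `β` directly would require its square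
  -- summability over `μ j - r n`; writing the vector through the lift shows that it lies in the
  -- space.
  let v : Fin (m + 1) → E := fun j => ℓ + Td j (α - μ j • ℓ)
  have hv : ∀ n j, inner ℝ (B n) (v j) = β n / (μ j - r n) := fun n j => by
    have h0 : μ j - r n ≠ 0 := sub_ne_zero.2 (hC j n).1
    simp only [v, inner_add_right, hTd, inner_sub_right, inner_smul_right, hβ]
    field_simp
    ring
  obtain ⟨W, g, hWV, hVW, hg⟩ := exists_pole_placement (x := fun i : Fin (m + 1) => r i) (y := μ)
    (b := fun i => β i) (fun i j h => Fin.ext (hr.injective h)) hμinj (fun j i => (hC j i).1)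
    (fun i => hβ0 i)
  obtain ⟨R, Q, hRQ, hR⟩ := exists_transform B hVW (v := v) fun i j => by rw [hv]; rfl
  simp only [hv] at hR
  refine ⟨g, closedLoopRate r μ, R, Q, fun n => ?_, hRQ, fun ξ f T hT => ?_⟩
  · unfold closedLoopRate
    split_ifs with h
    · exact (hμle _).trans hm
    · exact (hr.antitone (by omega)).trans hm
  -- The gain equals one on each closed loop eigenvector, so the feedback is the sum of the first
  -- coordinates of `ξ`.
  · have hu : ∀ s, ∑ i : Fin (m + 1), g i * inner ℝ (B i) (R (ξ s)) =
        ∑ j : Fin (m + 1), inner ℝ (B j) (ξ s) := fun s => by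
      simp only [hR, Fin.is_lt, if_true, add_zero, Finset.mul_sum]
      rw [Finset.sum_comm]
      refine Finset.sum_congr rfl fun j _ => ?_
      have := hg j
      calc ∑ i : Fin (m + 1), g i * (inner ℝ (B j) (ξ s) * (β i / (μ j - r i)))
          = inner ℝ (B j) (ξ s) * ∑ i : Fin (m + 1), g i * (β i / (μ j - r i)) := by
            rw [Finset.mul_sum]
            exact Finset.sum_congr rfl fun i _ => by ring
        _ = _ := by rw [this, mul_one]
    simp only [hu]
    exact isPrim_modes_iff (fun j n => (hC j n).1) hWV (ξ := fun n t => inner ℝ (B n) (ξ t))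
      (f := fun n t => inner ℝ (B n) (f t)) (x := fun n t => inner ℝ (B n) (R (ξ t)))
      (F := fun n t => inner ℝ (B n) (R (f t))) (fun n t => hR _ _) (fun n t => hR _ _) hT

theorem MemLinftyLoc.intervalIntegrable {p : ℝ → H} (hp : MemLinftyLoc p) (T : ℝ) (hT : 0 ≤ T) :
    IntervalIntegrable p volume 0 T := by
  rw [intervalIntegrable_iff_integrableOn_Icc_of_le hT]
  exact (hp T hT).integrable le_top

/-- The fading memory term bounds the disturbance. -/
theorem MemLinftyLoc.essSup_bound {p : ℝ → H} (hp : MemLinftyLoc p) {κ t : ℝ} (hκ : 0 < κ)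
    (ht : 0 ≤ t) :
    0 ≤ essSup (fun τ => Real.exp (-κ * (t - τ)) * ‖p τ‖) (volume.restrict (Icc 0 t)) ∧
    ∀ᵐ s, s ∈ Ioc 0 t → Real.exp (κ * s) * ‖p s‖ ≤ Real.exp (κ * t) *
      essSup (fun τ => Real.exp (-κ * (t - τ)) * ‖p τ‖) (volume.restrict (Icc 0 t)) := by
  set f : ℝ → ℝ := fun τ => Real.exp (-κ * (t - τ)) * ‖p τ‖ with hf
  -- A real-valued essential supremum dominates the function only once essential boundedness is
  -- known.
  have hbd : IsBoundedUnder (· ≤ ·) (ae (volume.restrict (Icc 0 t))) f := by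
    have hlt : eLpNormEssSup p (volume.restrict (Icc 0 t)) < ⊤ := by
      have := (hp t ht).2
      rwa [eLpNorm_exponent_top] at this
    refine isBoundedUnder_of_eventually_le
      (a := (eLpNormEssSup p (volume.restrict (Icc 0 t))).toReal) ?_
    filter_upwards [ae_le_eLpNormEssSup (f := p) (μ := volume.restrict (Icc 0 t)),
      ae_restrict_mem measurableSet_Icc] with τ h1 h2
    have h3 : ‖p τ‖ ≤ (eLpNormEssSup p (volume.restrict (Icc 0 t))).toReal := by
      rw [← toReal_enorm]
      exact ENNReal.toReal_mono hlt.ne h1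
    have h4 : Real.exp (-κ * (t - τ)) ≤ 1 := by
      refine Real.exp_le_one_iff.2 ?_
      nlinarith [h2.2]
    calc f τ ≤ 1 * ‖p τ‖ := by simp only [hf]; gcongr
      _ ≤ _ := by rw [one_mul]; exact h3
  have hae := ae_le_essSup hbd
  refine ⟨?_, ?_⟩
  · rcases ht.eq_or_lt with rfl | htp
    -- At `t = 0` the measure is zero, and the essential supremum is the default value `0` of `sInf
    -- univ`.
    · have : volume.restrict (Icc (0 : ℝ) 0) = 0 := by simp
      rw [this]
      simp [essSup, limsup, limsSup]
    · have : NeZero (volume.restrict (Icc 0 t)) := ⟨by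
        rw [Ne, Measure.restrict_eq_zero, Real.volume_Icc]
        simpa using htp⟩
      obtain ⟨τ, hτ⟩ := hae.exists
      exact le_trans (by positivity) hτ
  · filter_upwards [(ae_restrict_iff' measurableSet_Icc).1 hae] with s hs hst
    have h1 := hs (Ioc_subset_Icc_self hst)
    calc Real.exp (κ * s) * ‖p s‖ = Real.exp (κ * t) * f s := by
          simp only [hf]
          rw [← mul_assoc, ← Real.exp_add]
          congr 2
          ring
      _ ≤ _ := by gcongr

theorem norm_le_iSup_of_continuousOn {Φ : ℝ → H} {s t : ℝ} (hΦ : ContinuousOn Φ (Icc s t)) :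
    ∀ τ ∈ Icc s t, ‖Φ τ‖ ≤ ⨆ τ : Icc s t, ‖Φ τ‖ := by
  obtain ⟨C, hC⟩ := isCompact_Icc.exists_bound_of_continuousOn hΦ
  intro τ hτ
  exact le_ciSup (f := fun τ : Icc s t => ‖Φ τ‖) ⟨C, by rintro _ ⟨x, rfl⟩; exact hC x x.2⟩ ⟨τ, hτ⟩

/-- Decay of the closed loop, from the decay in diagonal coordinates. -/
theorem norm_apply_le_fadingBound {B : HilbertBasis ℕ ℝ H} {ν : ℕ → ℝ} {D : ℝ → H →L[ℝ] H}
    {c hm hM κ σ : ℝ} (hD : IsDiagSemigroup B ν (-σ) D) (hκ : 0 < κ)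
    (hσ : 1 + 2 * (|c| * Real.exp (κ * hM)) ≤ σ - κ) (hm_pos : 0 < hm) (hmM : hm ≤ hM)
    {h : ℝ → ℝ} (hhb : ∀ t, 0 ≤ t → hm ≤ h t ∧ h t ≤ hM) {Φ p : ℝ → H}
    (hΦ : ContinuousOn Φ (Icc (-hM) 0)) (hp : MemLinftyLoc p) (R Q : H →L[ℝ] H) {ξ : ℝ → H}
    (hξ : IsDelaySolution D c hM h (fun t => Q (Φ t)) (fun t => Q (p t)) ξ) {t : ℝ} (ht : 0 ≤ t) :
    ‖R (ξ t)‖ ≤ fadingBound hM κ (2 * ‖R‖ * ‖Q‖ + 1) (2 * ‖R‖ * ‖Q‖ + 1) Φ p t := by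
  obtain ⟨hE0, hE⟩ := hp.essSup_bound hκ ht
  unfold fadingBound
  set M := ⨆ τ : Icc (-hM) 0, ‖Φ τ‖ with hM_def
  set L := essSup (fun τ => Real.exp (-κ * (t - τ)) * ‖p τ‖) (volume.restrict (Icc 0 t)) with hL
  have hΦM := norm_le_iSup_of_continuousOn hΦ
  have hM0 : 0 ≤ M := (norm_nonneg _).trans (hΦM 0 ⟨by linarith, le_rfl⟩)
  -- The factor `e^{κt}` in `P` converts the fading weight `e^{-κ(t - τ)}` into `e^{κτ}`.
  have key := hξ.exp_mul_norm_le hD hκ hσ hm_pos hmM hhb (MΦ := ‖Q‖ * M)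
    (P := ‖Q‖ * (Real.exp (κ * t) * L)) ht
    (fun τ hτ => (Q.le_opNorm _).trans (by gcongr; exact hΦM τ hτ)) (by positivity) (by
      filter_upwards [hE] with s hs hst
      calc Real.exp (κ * s) * ‖Q (p s)‖ ≤ Real.exp (κ * s) * (‖Q‖ * ‖p s‖) := by
            gcongr; exact Q.le_opNorm _
        _ = ‖Q‖ * (Real.exp (κ * s) * ‖p s‖) := by ring
        _ ≤ _ := mul_le_mul_of_nonneg_left (hs hst) (norm_nonneg _))
  have e0 : Real.exp (-κ * t) * Real.exp (κ * t) = 1 := by rw [← Real.exp_add]; simp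
  have h1 : ‖ξ t‖ ≤ 2 * ‖Q‖ * (Real.exp (-κ * t) * M) + 2 * ‖Q‖ * L := by
    calc ‖ξ t‖ = Real.exp (-κ * t) * (Real.exp (κ * t) * ‖ξ t‖) := by
          rw [← mul_assoc, e0, one_mul]
      _ ≤ Real.exp (-κ * t) * (2 * (‖Q‖ * M) + 2 * (‖Q‖ * (Real.exp (κ * t) * L))) := by gcongr
      _ = _ := by linear_combination (2 * ‖Q‖ * L) * e0
  calc ‖R (ξ t)‖ ≤ ‖R‖ * ‖ξ t‖ := R.le_opNorm _
    _ ≤ ‖R‖ * (2 * ‖Q‖ * (Real.exp (-κ * t) * M) + 2 * ‖Q‖ * L) := by gcongr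
    _ = 2 * ‖R‖ * ‖Q‖ * (Real.exp (-κ * t) * M) + 2 * ‖R‖ * ‖Q‖ * L := by ring
    _ ≤ (2 * ‖R‖ * ‖Q‖ + 1) * (Real.exp (-κ * t) * M) + (2 * ‖R‖ * ‖Q‖ + 1) * L := by
        gcongr <;> linarith
    _ = _ := by ring

/-- Bessel's inequality; the bound on the input therefore costs exactly `‖K‖`. -/
theorem norm_modes_le {e : ℕ → H} (he : Orthonormal ℝ e) (N : ℕ) (x : H) : ‖modes e N x‖ ≤ ‖x‖ := by
  have he' : Orthonormal ℝ fun i : Fin N => e i := he.comp _ Fin.val_injective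
  refine abs_le_of_sq_le_sq' ?_ (norm_nonneg _) |>.2
  have h1 := he'.sum_inner_products_le x (s := Finset.univ)
  rw [EuclideanSpace.norm_sq_eq]
  simpa [modes, real_inner_comm] using h1

theorem norm_feedback_le {e : ℕ → H} (he : Orthonormal ℝ e) {N : ℕ} (K : Matrix (Fin 2) (Fin N) ℝ)
    (X : ℝ → H) (t : ℝ) : ‖feedback e K X t‖ ≤ matNorm K * ‖X t‖ := by
  refine ((LinearMap.toContinuousLinearMap (Matrix.toEuclideanLin K)).le_opNorm _).trans ?_
  exact mul_le_mul_of_nonneg_left (norm_modes_le he N (X t)) (norm_nonneg _)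

theorem mul_fadingBound (hM κ C₀ C₁ s : ℝ) (Φ p : ℝ → H) (t : ℝ) :
    s * fadingBound hM κ C₀ C₁ Φ p t = fadingBound hM κ (C₀ * s) (C₁ * s) Φ p t := by
  simp only [fadingBound]
  ring

/-- A mild solution of the boundary control system is continuous on `[-h_M, ∞)`. -/
theorem continuousOn_of_initial {X Φ : ℝ → H} {hM : ℝ} (hM0 : 0 ≤ hM)
    (hX : ContinuousOn X (Ici 0)) (hΦ : ContinuousOn Φ (Icc (-hM) 0))
    (hi : ∀ τ ∈ Icc (-hM) 0, X τ = Φ τ) : ContinuousOn X (Ici (-hM)) := by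
  have h1 : ContinuousOn (fun t => Φ (min t 0) - Φ 0 + X (max t 0)) (Ici (-hM)) := by
    refine ((hΦ.comp (by fun_prop) fun t ht => ⟨le_min ht (by linarith), min_le_right _ _⟩).sub
      continuousOn_const).add (hX.comp (by fun_prop) fun t _ => mem_Ici.2 (le_max_right t 0))
  refine h1.congr fun t ht => ?_
  have h0 : X 0 = Φ 0 := hi 0 ⟨by linarith, le_rfl⟩
  rcases le_total t 0 with h | h
  · simp [min_eq_left h, max_eq_right h, h0, hi t ⟨ht, h⟩]
  · simp [min_eq_right h, max_eq_left h]

end DelayRD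

/-! ### The main theorem -/

theorem mainTheorem2 (a b c θ₁ θ₂ : ℝ) (ha : 0 < a) (hc : c ≠ 0)
    (hθ₁ : θ₁ ∈ Ico 0 (2 * Real.pi)) (hθ₂ : θ₂ ∈ Ico 0 (2 * Real.pi))
    (k : ℕ) (hk : 2 ≤ k) (hk₁ : Real.cos θ₁ + k * Real.sin θ₁ ≠ 0)
    (hk₂ : Real.cos θ₂ + k * Real.sin θ₂ ≠ 0)
    (hm hM κ : ℝ) (hm_pos : 0 < hm) (hm_lt : hm < hM) (hκ : 0 < κ) :
    (∃ S, IsGeneratedByA₀ a b θ₁ θ₂ S) ∧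
    (∃ lam e, IsEigensystem a b c θ₁ θ₂ lam e) ∧
    ∀ S, IsGeneratedByA₀ a b θ₁ θ₂ S →
    ∀ lam e, IsEigensystem a b c θ₁ θ₂ lam e →
      ∃ N₀ : ℕ, 1 ≤ N₀ ∧ ∃ (K : Matrix (Fin 2) (Fin N₀) ℝ) (C₀ C₁ : ℝ), 0 < C₀ ∧ 0 < C₁ ∧
        ∀ (Φ p : ℝ → H) (h : ℝ → ℝ), ContinuousOn Φ (Icc (-hM) 0) → MemLinftyLoc p →
          ContinuousOn h (Ici 0) → (∀ t, 0 ≤ t → hm ≤ h t ∧ h t ≤ hM) →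
          ∃ X : ℝ → H,
            IsMildSolution a b c θ₁ θ₂ k S hM Φ p h (feedback e K X) X ∧
            (∀ X' : ℝ → H, IsMildSolution a b c θ₁ θ₂ k S hM Φ p h (feedback e K X') X' →
              EqOn X' X (Ici (-hM))) ∧
            ∀ t : ℝ, 0 ≤ t →
              ‖X t‖ ≤ fadingBound hM κ C₀ C₁ Φ p t ∧
              ‖feedback e K X t‖ ≤
                fadingBound hM κ (C₀ * matNorm K) (C₁ * matNorm K) Φ p t := by
  obtain ⟨lam₀, e₀, he₀⟩ := exists_isEigensystem a b c θ₁ θ₂ ha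
  refine ⟨?_, ⟨lam₀, e₀, he₀⟩, ?_⟩
  · obtain ⟨B, hB⟩ := he₀.exists_hilbertBasis ha
    obtain ⟨D, hD⟩ := exists_isDiagSemigroup B he₀.sub_le
    exact ⟨D, he₀.isGeneratedByA₀ ha hB hD⟩
  intro S hS lam e he
  obtain ⟨B, hB⟩ := he.exists_hilbertBasis ha
  have hM0 : 0 ≤ hM := (hm_pos.trans hm_lt).le
  -- The smallest decay rate that satisfies the absorption condition of
  -- `IsDelaySolution.exp_mul_norm_le`.
  set σ : ℝ := κ + (1 + 2 * (|c| * Real.exp (κ * hM))) with hσ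
  obtain ⟨m, hm'⟩ := he.exists_lam_lt ha (c - σ)
  obtain ⟨g, ν, R, Q, hν, hRQ, hmodes⟩ := exists_closedLoop B (r := fun n => lam n - c)
    (β := inputCoeff a b c θ₁ θ₂ k lam e) (ℓ := lift θ₁ θ₂ k ctrlDir)
    (α := opA a b (lift θ₁ θ₂ k ctrlDir)) (σ := σ) (m := m)
    (fun i j hij => sub_lt_sub_right (he.strictAnti hij) c) (fun n => by rw [hB]; rfl)
    (he.inputCoeff_ne_zero ha hk hk₁) (by linarith)
  obtain ⟨D, hD⟩ := exists_isDiagSemigroup B hν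
  -- Modes are indexed from `0`, so `0, …, m` are `m + 1` modes. The summand `1` in the constants
  -- makes their positivity immediate.
  refine ⟨m + 1, by omega, Matrix.of ![g, 0], 2 * ‖R‖ * ‖Q‖ + 1, 2 * ‖R‖ * ‖Q‖ + 1, by positivity,
    by positivity, fun Φ p h hΦ hp hh hhb => ?_⟩
  set K : Matrix (Fin 2) (Fin (m + 1)) ℝ := Matrix.of ![g, 0] with hK
  have hfb : ∀ X : ℝ → H, feedback e K X =
      fun t => (∑ i : Fin (m + 1), g i * inner ℝ (B i) (X t)) • ctrlDir := fun X => by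
    funext t
    rw [feedback_eq, hB]
  have hpi := hp.intervalIntegrable
  have hQp : ∀ T, 0 ≤ T → IntervalIntegrable (fun t => Q (p t)) volume 0 T := fun T hT =>
    ⟨Q.integrable_comp (hpi T hT).1, Q.integrable_comp (hpi T hT).2⟩
  have hQΦ : ContinuousOn (fun t => Q (Φ t)) (Icc (-hM) 0) := Q.continuous.comp_continuousOn hΦ
  have hforce : ∀ ξ : ℝ → H, ∀ s,
      R (c • ξ (s - h s) + Q (p s)) = c • R (ξ (s - h s)) + p s := fun ξ s => by
    rw [map_add, map_smul, hRQ]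
  have h0mem : (0 : ℝ) ∈ Icc (-hM) 0 := ⟨by linarith, le_rfl⟩
  -- Every mild solution becomes, under `Q`, a solution of the diagonal delay equation; uniqueness
  -- follows from `R Q = 1`.
  have hmild : ∀ X : ℝ → H, IsMildSolution a b c θ₁ θ₂ k S hM Φ p h (feedback e K X) X →
      IsDelaySolution D c hM h (fun t => Q (Φ t)) (fun t => Q (p t)) (fun t => Q (X t)) := by
    intro X hX
    have hXc := continuousOn_of_initial hM0 hX.continuousOn hΦ hX.initial
    have hξc : ContinuousOn (fun t => Q (X t)) (Ici (-hM)) := Q.continuous.comp_continuousOn hXc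
    refine ⟨hξc, fun τ hτ => by rw [hX.initial τ hτ], fun t ht => ?_⟩
    have hac := hX.ac_input
    have hdu := hX.duhamel
    simp only [hfb, absolutelyContinuousOnInterval_smul_ctrlDir_iff] at hac
    simp only [hfb, ← hX.initial 0 h0mem, add_assoc _ (c • X _)] at hdu
    have hx := (mild_iff_modes hS he hB (intervalIntegrable_delayed hXc hh hhb hpi) hac).1 hdu
    have hξ := (hmodes (fun t => Q (X t)) (fun s => c • Q (X (s - h s)) + Q (p s)) t ht).2 (by
      simpa only [hforce (fun t => Q (X t)), hRQ] using hx t ht)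
    have := (hD.mild_iff hν ht (intervalIntegrable_delayed hξc hh hhb hQp t ht)).2 hξ t ⟨ht, le_rfl⟩
    rw [this, hX.initial 0 h0mem]
  obtain ⟨ξ, hξ⟩ := hD.exists_isDelaySolution (c := c) hν hm_pos hm_lt.le hh hhb hQΦ hQp
  have hX : IsMildSolution a b c θ₁ θ₂ k S hM Φ p h (feedback e K fun t => R (ξ t))
      (fun t => R (ξ t)) := by
    have hXc : ContinuousOn (fun t => R (ξ t)) (Ici (-hM)) :=
      R.continuous.comp_continuousOn hξ.continuousOn
    have hinit : ∀ τ ∈ Icc (-hM) 0, R (ξ τ) = Φ τ := fun τ hτ => by rw [hξ.initial τ hτ, hRQ]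
    have hx : ∀ T, 0 ≤ T → ∀ n, IsPrim (fun t => inner ℝ (B n) (R (ξ t)))
        (fun s => (lam n - c) * inner ℝ (B n) (R (ξ s)) + (inputCoeff a b c θ₁ θ₂ k lam e n *
          ∑ i : Fin (m + 1), g i * inner ℝ (B i) (R (ξ s)) +
            inner ℝ (B n) (c • R (ξ (s - h s)) + p s))) T := by
      intro T hT
      have h1 := (hD.mild_iff (y := ξ) hν hT
        (intervalIntegrable_delayed (c := c) hξ.continuousOn hh hhb hQp T hT)).1 fun t ht => by
          rw [hξ.initial 0 h0mem]; exact hξ.duhamel t ht.1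
      simpa only [hforce] using (hmodes ξ (fun s => c • ξ (s - h s) + Q (p s)) T hT).1 h1
    -- Absolute continuity of the input is automatic: it is a finite combination of modes, each a
    -- primitive.
    have hac : ∀ T, 0 ≤ T → AbsolutelyContinuousOnInterval
        (fun t => ∑ i : Fin (m + 1), g i * inner ℝ (B i) (R (ξ t))) 0 T := fun T hT =>
      (IsPrim.sum Finset.univ hT fun (i : Fin (m + 1)) _ =>
        (hx T hT i).const_mul hT (g i)).ac hT
    have hdu := (mild_iff_modes hS he hB (intervalIntegrable_delayed hXc hh hhb hpi) hac).2 hx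
    refine ⟨hXc.mono (Ici_subset_Ici.2 (by linarith)), ?_, hinit, ?_⟩
    · simpa only [hfb, absolutelyContinuousOnInterval_smul_ctrlDir_iff] using hac
    · simpa only [hfb, ← hinit 0 h0mem, add_assoc _ (c • R _)] using hdu
  refine ⟨fun t => R (ξ t), hX, fun X' hX' t ht => ?_, fun t ht => ?_⟩
  · have hQX : Q (X' t) = ξ t := (hmild X' hX').eqOn hm_pos hhb hξ ht
    simp only [← hQX, hRQ]
  · have hb := norm_apply_le_fadingBound hD hκ (by linarith) hm_pos hm_lt.le hhb hΦ hp R Q hξ ht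
    refine ⟨hb, (norm_feedback_le (he.orthonormal ha) K _ t).trans ?_⟩
    rw [← mul_fadingBound]
    exact mul_le_mul_of_nonneg_left hb (norm_nonneg _)
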